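/- Let $f:\mathbb R^{d_1}\times\mathbb R^{d_2}\to\mathbb R$ be $C^2$, write $z=(x,y)$, $F=(\nabla_x f,-\nabla_y f)$, and suppose that for some $L>0$ the operator norm satisfies $\|DF(z)\|\le L$ for all $z$. Let $z^*$ be an equilibrium, $F(z^*)=0$, such that $H=DF(z^*)$ is invertible, and let $A=\nabla^2_{xx}f$, $B=\nabla^2_{yy}f$, $C=\nabla^2_{xy}f$ at $z^*$. *Restricted Schur complement.* Let $r=\operatorname{rank}B$ and $B=P\Delta P^\top$ with $P$ orthogonal and $\Delta$ diagonal; let $C_2$ be the submatrix of the $d_2-r$ columns of $CP$ that belong to the zero diagonal entries of $\Delta$; let the columns of $U$ form an orthonormal basis of $\operatorname{range}(C_2)^\perp$; and put $S_r=U^\top(A-CB^\dagger C^\top)U$, where $B^\dagger$ is the Moore–Penrose pseudoinverse (a $0\times0$ matrix is positive semidefinite). *Hemicurvature and $s_0$.* For $\tau\ge1$ let $\Lambda_\tau=\operatorname{diag}(\tfrac1\tau I_{d_1},I_{d_2})$, $H_\tau=\Lambda_\tau H$, $\epsilon=1/\tau$. Let $\sigma_1,\dots,\sigma_{d_2-r}$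 be the singular values of $C_2$. Consider the eigenvalue functions of $H_\tau$ given for small $\epsilon>0$ by convergent Puiseux series $\lambda(\epsilon)=\sum_k\alpha^{(k)}\epsilon^{k/p}$ and satisfying $\lambda(\epsilon)=\pm i\sigma_j\sqrt\epsilon+o(\sqrt\epsilon)$ for some $j$. For such $\lambda$ let $k_0$ be the least $k$ with $\operatorname{Re}\alpha^{(k)}\ne0$, and put $\varrho=k_0/p$, $\xi=\operatorname{Re}\alpha^{(k_0)}$ ($\varrho=1$, $\xi=0$ if there is no such $k$). The hemicurvature of $\lambda$ is $\iota=\lim_{\epsilon\to0+}\xi\epsilon^{\varrho-1}/\sigma_j^2\in[-\infty,\infty]$, and $s_0=\max(-\iota)$ over all these eigenvalue functions ($s_0=-\infty$ if there are none). *Stability.* For $\eta>0$ let $w_\tau(z)=z-\eta\Lambda_\tau F\big(z-\eta\Lambda_\tau F(z)\big)$ be one step of two-timescale extragradient (EG). The point $z^*$ is a strict linearly stable point of $\infty$-EG with step size $\eta$ if there is $\tau^\star$ such that, for every $\tau>\tau^\star$, $w_\tau(z^*)=z^*$ and the spectral radius of $Dw_\tau(z^*)$ is less than $1$. **Theorem.**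 The following are equivalent: 1. $S_r\succeq0$, $B\preceq0$ and $s_0<\frac1{2L}$; 2. there is a constant $0<\eta^\star<\frac1L$ such that $z^*$ is a strict linearly stable point of $\infty$-EG for every step size $\eta$ with $\eta^\star<\eta<\frac1L$. -/

import Mathlib

open Filter Topology Asymptotics
open scoped Matrix

noncomputable section

/-! ### Derivatives in coordinates

A point `z = (x, y)` of `ℝ^{d₁+d₂}` is an element of `EuclideanSpace ℝ (Fin d₁ ⊕ Fin d₂)`; the
coordinates `Sum.inl i` form `x`, the coordinates `Sum.inr j` form `y`. -/

/-- The space `ℝ^{d₁+d₂}` of pairs `z = (x, y)`, with the Euclidean norm. -/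
abbrev ZSpace (d₁ d₂ : ℕ) : Type := EuclideanSpace ℝ (Fin d₁ ⊕ Fin d₂)

/-- The Jacobian matrix of `φ` at `z`. -/
def jacobianMatrix {n : Type*} [Fintype n] [DecidableEq n]
    (φ : EuclideanSpace ℝ n → EuclideanSpace ℝ n) (z : EuclideanSpace ℝ n) : Matrix n n ℝ :=
  Matrix.of fun i j => fderiv ℝ φ z (EuclideanSpace.single j 1) i

/-- The Hessian matrix of `f` at `z`. -/
def hessianMatrix {n : Type*} [Fintype n] [DecidableEq n]
    (f : EuclideanSpace ℝ n → ℝ) (z : EuclideanSpace ℝ n) : Matrix n n ℝ :=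
  Matrix.of fun i j =>
    fderiv ℝ (fderiv ℝ f) z (EuclideanSpace.single i 1) (EuclideanSpace.single j 1)

/-- `A = ∇²ₓₓ f (z)`. -/
def hessXX {d₁ d₂ : ℕ} (f : ZSpace d₁ d₂ → ℝ) (z : ZSpace d₁ d₂) : Matrix (Fin d₁) (Fin d₁) ℝ :=
  (hessianMatrix f z).toBlocks₁₁

/-- `B = ∇²_yy f (z)`. -/
def hessYY {d₁ d₂ : ℕ} (f : ZSpace d₁ d₂ → ℝ) (z : ZSpace d₁ d₂) : Matrix (Fin d₂) (Fin d₂) ℝ :=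
  (hessianMatrix f z).toBlocks₂₂

/-- `C = ∇²ₓ_y f (z)`. -/
def hessXY {d₁ d₂ : ℕ} (f : ZSpace d₁ d₂ → ℝ) (z : ZSpace d₁ d₂) : Matrix (Fin d₁) (Fin d₂) ℝ :=
  (hessianMatrix f z).toBlocks₁₂

theorem hessYY_isHermitian {d₁ d₂ : ℕ} {f : ZSpace d₁ d₂ → ℝ} (hf : ContDiff ℝ 2 f)
    (z : ZSpace d₁ d₂) : (hessYY f z).IsHermitian := by
  have h : IsSymmSndFDerivAt ℝ f z := hf.contDiffAt.isSymmSndFDerivAt (by simp)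
  ext i j
  simp only [hessYY, hessianMatrix, Matrix.toBlocks₂₂, Matrix.conjTranspose_apply, Matrix.of_apply,
    star_trivial]
  exact h.eq _ _

/-- The saddle-gradient operator `F = (∇ₓ f, -∇_y f)`. -/
def saddleGradient {d₁ d₂ : ℕ} (f : ZSpace d₁ d₂ → ℝ) (z : ZSpace d₁ d₂) : ZSpace d₁ d₂ :=
  WithLp.toLp 2 (Sum.elim (fun i => gradient f z (Sum.inl i)) (fun j => -gradient f z (Sum.inr j)))

/-! ### Two-timescale extragradient and stability -/

/-- `Λ_τ = diag{(1/τ) I, I}`. -/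
def timescaleMatrix (d₁ d₂ : ℕ) (τ : ℝ) : Matrix (Fin d₁ ⊕ Fin d₂) (Fin d₁ ⊕ Fin d₂) ℝ :=
  Matrix.diagonal (Sum.elim (fun _ => 1 / τ) (fun _ => 1))

/-- One step `w_τ(z) = z - η Λ_τ F(z - η Λ_τ F(z))` of the two-timescale extragradient method. -/
def extragradientStep {d₁ d₂ : ℕ} (f : ZSpace d₁ d₂ → ℝ) (η τ : ℝ) (z : ZSpace d₁ d₂) :
    ZSpace d₁ d₂ :=
  z - η • (timescaleMatrix d₁ d₂ τ).toEuclideanLin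
    (saddleGradient f (z - η • (timescaleMatrix d₁ d₂ τ).toEuclideanLin (saddleGradient f z)))

/-- `z` is a strict linearly stable equilibrium of the discrete system `z_{k+1} = w(z_k)`:
it is a fixed point, and all complex eigenvalues of the Jacobian matrix have modulus `< 1`. -/
def IsStrictLinearlyStable {n : Type*} [Fintype n] [DecidableEq n]
    (w : EuclideanSpace ℝ n → EuclideanSpace ℝ n) (z : EuclideanSpace ℝ n) : Prop :=
  w z = z ∧ spectralRadius ℂ ((jacobianMatrix w z).map (algebraMap ℝ ℂ)) < 1

/-- Strict linear stability for `∞`-EG with step size `η`: stability for two-timescale EG with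
every sufficiently large timescale parameter `τ` (which is always taken `≥ 1`). -/
def IsStableInftyEG {d₁ d₂ : ℕ} (f : ZSpace d₁ d₂ → ℝ) (η : ℝ) (z : ZSpace d₁ d₂) : Prop :=
  ∃ τ₀ : ℝ, 1 ≤ τ₀ ∧ ∀ τ : ℝ, τ₀ < τ → IsStrictLinearlyStable (extragradientStep f η τ) z

/-! ### The restricted Schur complement -/

section Schur

variable {d₁ d₂ : ℕ} {B : Matrix (Fin d₂) (Fin d₂) ℝ}

/-- The Moore–Penrose pseudoinverse `B† = P diag(δ)† Pᵀ` of a symmetric matrix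
`B = P diag(δ) Pᵀ`, where `P` is orthogonal; `diag(δ)†` has the entries `δ_j⁻¹`, with `0⁻¹ = 0`. -/
def symmPinv (hB : B.IsHermitian) : Matrix (Fin d₂) (Fin d₂) ℝ :=
  (hB.eigenvectorUnitary : Matrix (Fin d₂) (Fin d₂) ℝ) *
    Matrix.diagonal (fun j => (hB.eigenvalues j)⁻¹) *
    (hB.eigenvectorUnitary : Matrix (Fin d₂) (Fin d₂) ℝ)ᵀ

/-- `symmPinv` satisfies the four Penrose equations, which determine the pseudoinverse. -/
theorem symmPinv_penrose (hB : B.IsHermitian) :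
    B * symmPinv hB * B = B ∧ symmPinv hB * B * symmPinv hB = symmPinv hB ∧
      (B * symmPinv hB)ᵀ = B * symmPinv hB ∧ (symmPinv hB * B)ᵀ = symmPinv hB * B := by
  have hP : (hB.eigenvectorUnitary : Matrix (Fin d₂) (Fin d₂) ℝ)ᵀ *
      (hB.eigenvectorUnitary : Matrix (Fin d₂) (Fin d₂) ℝ) = 1 := by
    have := Unitary.coe_star_mul_self hB.eigenvectorUnitary
    rwa [Matrix.star_eq_conjTranspose, Matrix.conjTranspose_eq_transpose_of_trivial] at this
  have hS : B = (hB.eigenvectorUnitary : Matrix (Fin d₂) (Fin d₂) ℝ) *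
      Matrix.diagonal hB.eigenvalues *
      (hB.eigenvectorUnitary : Matrix (Fin d₂) (Fin d₂) ℝ)ᵀ := by
    have := hB.spectral_theorem
    rw [Unitary.conjStarAlgAut_apply, Matrix.star_eq_conjTranspose,
      Matrix.conjTranspose_eq_transpose_of_trivial] at this
    exact this
  unfold symmPinv
  generalize (hB.eigenvectorUnitary : Matrix (Fin d₂) (Fin d₂) ℝ) = P at hP hS
  generalize hB.eigenvalues = δ at hS
  have key : ∀ u v : Fin d₂ → ℝ, P * Matrix.diagonal u * Pᵀ * (P * Matrix.diagonal v * Pᵀ) =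
      P * Matrix.diagonal (fun j => u j * v j) * Pᵀ := by
    intro u v
    calc P * Matrix.diagonal u * Pᵀ * (P * Matrix.diagonal v * Pᵀ)
        = P * Matrix.diagonal u * (Pᵀ * P) * Matrix.diagonal v * Pᵀ := by
          simp only [Matrix.mul_assoc]
      _ = P * Matrix.diagonal (fun j => u j * v j) * Pᵀ := by
          rw [hP, Matrix.mul_one, Matrix.mul_assoc P, Matrix.diagonal_mul_diagonal]
  have tr : ∀ u : Fin d₂ → ℝ, (P * Matrix.diagonal u * Pᵀ)ᵀ = P * Matrix.diagonal u * Pᵀ := by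
    intro u
    simp [Matrix.transpose_mul, Matrix.mul_assoc]
  rw [hS]
  refine ⟨?_, ?_, ?_, ?_⟩
  · rw [key, key]; congr 3; funext j; exact mul_inv_mul_cancel (δ j)
  · rw [key, key]; congr 3; funext j
    by_cases h : δ j = 0
    · simp [h]
    · field_simp
  · rw [key, tr]
  · rw [key, tr]

/-- `Γ = C₂`: the submatrix of `C P` consisting of the `d₂ - rank B` columns that belong to the
zero eigenvalues in the orthogonal diagonalization `B = P diag(δ) Pᵀ`. -/
def nullColumns (C : Matrix (Fin d₁) (Fin d₂) ℝ) (hB : B.IsHermitian) :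
    Matrix (Fin d₁) {j : Fin d₂ // hB.eigenvalues j = 0} ℝ :=
  (C * (hB.eigenvectorUnitary : Matrix (Fin d₂) (Fin d₂) ℝ)).submatrix id Subtype.val

/-- `range(Γ)^⊥` in `ℝ^{d₁}`. -/
def rangeOrthogonal (C : Matrix (Fin d₁) (Fin d₂) ℝ) (hB : B.IsHermitian) :
    Submodule ℝ (EuclideanSpace ℝ (Fin d₁)) :=
  (LinearMap.range (nullColumns C hB).toEuclideanLin)ᗮ

/-- A matrix `U` whose columns form an orthonormal basis of `range(Γ)^⊥`. -/
def rangeOrthogonalBasis (C : Matrix (Fin d₁) (Fin d₂) ℝ) (hB : B.IsHermitian) :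
    Matrix (Fin d₁) (Fin (Module.finrank ℝ (rangeOrthogonal C hB))) ℝ :=
  Matrix.of fun i k =>
    (stdOrthonormalBasis ℝ (rangeOrthogonal C hB) k : EuclideanSpace ℝ (Fin d₁)) i

/-- The restricted Schur complement `S_r = Uᵀ (A - C B† Cᵀ) U`. -/
def restrictedSchur (A : Matrix (Fin d₁) (Fin d₁) ℝ) (C : Matrix (Fin d₁) (Fin d₂) ℝ)
    (hB : B.IsHermitian) :
    Matrix (Fin (Module.finrank ℝ (rangeOrthogonal C hB)))
      (Fin (Module.finrank ℝ (rangeOrthogonal C hB))) ℝ :=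
  (rangeOrthogonalBasis C hB)ᵀ * (A - C * symmPinv hB * Cᵀ) * rangeOrthogonalBasis C hB

end Schur

/-! ### Hemicurvature -/

/-- `lam(ε) = ∑ₖ α_k ε^{k/p}` is, for all small `ε > 0`, a convergent (Puiseux) series and an
eigenvalue of `H_τ = Λ_τ H`, where `τ = 1/ε`. -/
structure IsPuiseuxEigenvalue {d₁ d₂ : ℕ} (H : Matrix (Fin d₁ ⊕ Fin d₂) (Fin d₁ ⊕ Fin d₂) ℝ)
    (lam : ℝ → ℂ) (p : ℕ) (α : ℕ → ℂ) : Prop where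
  p_pos : 0 < p
  mem_spectrum : ∀ᶠ ε in 𝓝[>] (0 : ℝ),
    lam ε ∈ spectrum ℂ ((timescaleMatrix d₁ d₂ (1 / ε) * H).map (algebraMap ℝ ℂ))
  hasSum : ∀ᶠ ε in 𝓝[>] (0 : ℝ),
    HasSum (fun k : ℕ => α k * ((ε ^ ((k : ℝ) / (p : ℝ)) : ℝ) : ℂ)) (lam ε)

open Classical in
/-- The exponent `ϱ = k₀/p`, where `k₀` is the least `k` with `Re α_k ≠ 0`; `ϱ = 1` if there is no
such `k`. -/
def leadingExponent (p : ℕ) (α : ℕ → ℂ) : ℝ :=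
  if h : ∃ k, (α k).re ≠ 0 then (Nat.find h : ℝ) / (p : ℝ) else 1

open Classical in
/-- The coefficient `ξ = Re α_{k₀}`, where `k₀` is the least `k` with `Re α_k ≠ 0`; `ξ = 0` if there
is no such `k`. -/
def leadingCoefficient (α : ℕ → ℂ) : ℝ :=
  if h : ∃ k, (α k).re ≠ 0 then (α (Nat.find h)).re else 0

/-- `ι = lim_{ε → 0+} ξ ε^{ϱ-1} / σ²`, a limit in `[-∞, ∞]`. -/
def IsHemicurvature (p : ℕ) (α : ℕ → ℂ) (σ : ℝ) (ι : EReal) : Prop :=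
  Tendsto (fun ε : ℝ =>
    ((leadingCoefficient α * ε ^ (leadingExponent p α - 1) / σ ^ 2 : ℝ) : EReal))
    (𝓝[>] (0 : ℝ)) (𝓝 ι)

/-- The hemicurvatures of the eigenvalue functions of type `± i σ √ε + o(√ε)`, where `σ` is one of
the `d₂ - rank B` singular values of `C₂`. The eigenvalue functions of `H_τ`, with `τ = 1/ε`, are
identified with their germs at `ε = 0+`. -/
def hemicurvatures {d₁ d₂ : ℕ} (H : Matrix (Fin d₁ ⊕ Fin d₂) (Fin d₁ ⊕ Fin d₂) ℝ)
    (C : Matrix (Fin d₁) (Fin d₂) ℝ) {B : Matrix (Fin d₂) (Fin d₂) ℝ} (hB : B.IsHermitian) :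
    Set EReal :=
  {ι | ∃ (k : ℕ) (σ : ℝ) (lam : ℝ → ℂ) (p : ℕ) (α : ℕ → ℂ),
    k < d₂ - B.rank ∧ σ = (nullColumns C hB).toEuclideanLin.singularValues k ∧
    IsPuiseuxEigenvalue H lam p α ∧
    ((fun ε : ℝ => lam ε - Complex.I * (σ : ℂ) * (√ε : ℂ)) =o[𝓝[>] (0 : ℝ)] (fun ε : ℝ => √ε) ∨
      (fun ε : ℝ => lam ε + Complex.I * (σ : ℂ) * (√ε : ℂ)) =o[𝓝[>] (0 : ℝ)] (fun ε : ℝ => √ε)) ∧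
    IsHemicurvature p α σ ι}

/-- `s₀ = max (-ι)` over all hemicurvatures `ι`. The supremum is over a finite set, and it is `-∞`
if there are no eigenvalue functions of this type. -/
def sZero {d₁ d₂ : ℕ} (H : Matrix (Fin d₁ ⊕ Fin d₂) (Fin d₁ ⊕ Fin d₂) ℝ)
    (C : Matrix (Fin d₁) (Fin d₂) ℝ) {B : Matrix (Fin d₂) (Fin d₂) ℝ} (hB : B.IsHermitian) :
    EReal :=
  sSup ((fun ι : EReal => -ι) '' hemicurvatures H C hB)

end

/-! Put ε = 1/τ. At the equilibrium the Jacobian of one step is 1 - ηM + (ηM)² with M = H_τ, so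
stability says that every eigenvalue λ of H_τ satisfies |1 - ηλ + (ηλ)²| < 1. As ε → 0+ the
eigenvalues form finitely many branches that are analytic in a root ε^{1/q}: this is Puiseux's
theorem (`hasPuiseuxRoots`, `exists_branches`), proved by Newton's method with an analytic Hensel
lemma. It is therefore enough to decide each branch from its leading behaviour.

After an orthogonal change of the y-coordinates that diagonalizes B, rescaling rows and columns of
the characteristic matrix (`scaledMatrix_eq`) gives a nontrivial limit on each scale, and the limit
matrix must be singular. Nonzero limits are -δ_j, with δ_j the eigenvalues of B. A branch that tends
to 0 cannot be larger than order √ε (`branch_order_ge`); if it is larger than order ε it is ±iσ_j√ε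
+ o(√ε) (`branch_intermediate`); otherwise λ/ε converges to an eigenvalue of S_r (`branch_slow`).
Invertibility of H makes every σ_j positive, excludes the eigenvalue 0 of S_r, and excludes the zero
branch.

Stability on the three scales is then elementary. If B ⪯ 0, the nonzero limits lie in (0, L], where
0 < ηλ < 1 gives stability. If λ/ε → μ > 0, the branch is stable for every η > 0. On the scale √ε
the expansion |1 - ηλ + (ηλ)²|² - 1 = -2η Re λ - η²(Im λ)² + ..., with (Im λ)² ~ σ²ε, compares Re
λ/(σ²ε) with -η/2: a hemicurvature above -η/2 gives stability, one below gives instability.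
Requiring this for η just below 1/L is the condition s₀ < 1/(2L).

Conversely, a positive eigenvalue of B or a negative eigenvalue of S_r persists, by Hurwitz's
theorem, as an eigenvalue of H_τ outside the stability region, and a hemicurvature below -η/2
contradicts stability directly. -/

noncomputable section

/-! ### Factorization of polynomials with analytic coefficients -/

section Puiseux

open Polynomial

/-- The polynomial `∑_{i<n} u_i X^i`. -/
def lowPoly (n : ℕ) (u : Fin n → ℂ) : ℂ[X] := ∑ i, C (u i) * X ^ (i : ℕ)

/-- The monic polynomial `X^n + ∑_{i<n} u_i X^i`. -/
def monicPoly (n : ℕ) (u : Fin n → ℂ) : ℂ[X] := X ^ n + lowPoly n u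

theorem coeff_lowPoly (n : ℕ) (u : Fin n → ℂ) (k : ℕ) :
    (lowPoly n u).coeff k = if h : k < n then u ⟨k, h⟩ else 0 := by
  simp only [lowPoly, finsetSum_coeff, coeff_C_mul, coeff_X_pow, mul_ite, mul_one, mul_zero]
  split_ifs with h
  · rw [Finset.sum_eq_single ⟨k, h⟩]
    · simp
    · intro i _ hi
      rw [if_neg]
      rintro rfl
      exact hi rfl
    · simp
  · refine Finset.sum_eq_zero fun i _ => ?_
    rw [if_neg]
    rintro rfl
    exact h i.2

theorem degree_lowPoly_lt (n : ℕ) (u : Fin n → ℂ) : (lowPoly n u).degree < n := by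
  rw [degree_lt_iff_coeff_zero]
  intro m hm
  rw [coeff_lowPoly, dif_neg (by lia)]

theorem lowPoly_eq_zero {n : ℕ} {u : Fin n → ℂ} (h : lowPoly n u = 0) : u = 0 := by
  funext i
  have := coeff_lowPoly n u i
  rw [h, dif_pos i.2] at this
  simpa using this.symm

theorem monic_monicPoly (n : ℕ) (u : Fin n → ℂ) : (monicPoly n u).Monic :=
  monic_X_pow_add (degree_lowPoly_lt n u)

theorem natDegree_monicPoly (n : ℕ) (u : Fin n → ℂ) : (monicPoly n u).natDegree = n := by
  have : (monicPoly n u).degree = n := by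
    rw [monicPoly, degree_add_eq_left_of_degree_lt] <;> simp [degree_lowPoly_lt]
  exact natDegree_eq_of_degree_eq_some this

theorem coeff_monicPoly (n : ℕ) (u : Fin n → ℂ) (k : ℕ) :
    (monicPoly n u).coeff k = if h : k < n then u ⟨k, h⟩ else if k = n then 1 else 0 := by
  rw [monicPoly, coeff_add, coeff_lowPoly, coeff_X_pow]
  by_cases h : k < n
  · simp [h, h.ne]
  · simp [h]

theorem eq_monicPoly {P : ℂ[X]} (hP : P.Monic) {n : ℕ} (hn : P.natDegree = n) :
    P = monicPoly n fun i => P.coeff i := by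
  ext k
  rw [coeff_monicPoly]
  split_ifs with h1 h2
  · rfl
  · rw [h2, ← hn]; exact hP
  · exact coeff_eq_zero_of_natDegree_lt (by lia)

theorem monicPoly_add_smul (n : ℕ) (u v : Fin n → ℂ) (t : ℂ) :
    monicPoly n (u + t • v) = monicPoly n u + C t * lowPoly n v := by
  simp [monicPoly, lowPoly, Finset.mul_sum, add_mul, Finset.sum_add_distrib, mul_assoc, add_assoc]

/-- The coefficients of the product of two monic polynomials, as a function of the coefficients
of the factors. -/
def mulCoeff (a b : ℕ) (w : (Fin a → ℂ) × (Fin b → ℂ)) : Fin (a + b) → ℂ :=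
  fun k => (monicPoly a w.1 * monicPoly b w.2).coeff k

theorem contDiff_mulCoeff (a b : ℕ) : ContDiff ℂ ⊤ (mulCoeff a b) := by
  rw [contDiff_pi]
  intro k
  simp only [mulCoeff, coeff_mul]
  refine ContDiff.sum fun x _ => ContDiff.mul ?_ ?_ <;>
  · simp only [coeff_monicPoly]
    split_ifs
    · fun_prop
    · fun_prop
    · fun_prop

/-- This is the product rule. Along a line w + t w' each coefficient is a quadratic polynomial in t,
whose linear term is the derivative. -/
theorem fderiv_mulCoeff_apply {a b : ℕ} (w w' : (Fin a → ℂ) × (Fin b → ℂ)) (k : Fin (a + b)) :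
    fderiv ℂ (mulCoeff a b) w w' k =
      (monicPoly a w.1 * lowPoly b w'.2 + lowPoly a w'.1 * monicPoly b w.2).coeff k := by
  have h1 : HasDerivAt (fun t : ℂ => mulCoeff a b (w + t • w')) (fderiv ℂ (mulCoeff a b) w w') 0 := by
    have hd : HasFDerivAt (mulCoeff a b) (fderiv ℂ (mulCoeff a b) w) (w + (0 : ℂ) • w') := by
      simpa using ((contDiff_mulCoeff a b).differentiable (by simp) w).hasFDerivAt
    have hl : HasDerivAt (fun t : ℂ => w + t • w') w' 0 := by
      simpa using ((hasDerivAt_id (0 : ℂ)).smul_const w').const_add w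
    exact hd.comp_hasDerivAt (0 : ℂ) hl
  have h2 := (hasDerivAt_pi.1 h1) k
  refine h2.unique ?_
  have h3 : (fun t : ℂ => mulCoeff a b (w + t • w') k) = fun t =>
      (monicPoly a w.1 * monicPoly b w.2).coeff k +
      t * (monicPoly a w.1 * lowPoly b w'.2 + lowPoly a w'.1 * monicPoly b w.2).coeff k +
      t ^ 2 * (lowPoly a w'.1 * lowPoly b w'.2).coeff k := by
    funext t
    simp only [mulCoeff, Prod.fst_add, Prod.snd_add, Prod.smul_fst, Prod.smul_snd,
      monicPoly_add_smul]
    rw [← coeff_C_mul, ← coeff_C_mul, ← coeff_add, ← coeff_add]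
    congr 1
    rw [C_pow]
    ring
  rw [h3]
  have := (((hasDerivAt_id (0 : ℂ)).mul_const
    ((monicPoly a w.1 * lowPoly b w'.2 + lowPoly a w'.1 * monicPoly b w.2).coeff k)).const_add
    ((monicPoly a w.1 * monicPoly b w.2).coeff k)).fun_add
    (((hasDerivAt_id (0 : ℂ)).fun_pow 2).mul_const ((lowPoly a w'.1 * lowPoly b w'.2).coeff k))
  simpa using this

/-- A kernel element satisfies G v + u H = 0 with deg u < deg G and deg v < deg H. Coprimality gives
G ∣ u and H ∣ v, and the degrees then force u = v = 0. -/
theorem fderiv_mulCoeff_injective {a b : ℕ} (w : (Fin a → ℂ) × (Fin b → ℂ))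
    (hw : IsCoprime (monicPoly a w.1) (monicPoly b w.2)) :
    Function.Injective (fderiv ℂ (mulCoeff a b) w) := by
  rw [injective_iff_map_eq_zero]
  intro w' h
  have h0 : monicPoly a w.1 * lowPoly b w'.2 + lowPoly a w'.1 * monicPoly b w.2 = 0 := by
    ext k
    by_cases hk : k < a + b
    · rw [coeff_zero, ← fderiv_mulCoeff_apply w w' ⟨k, hk⟩, h, Pi.zero_apply]
    · have hd : (monicPoly a w.1 * lowPoly b w'.2 + lowPoly a w'.1 * monicPoly b w.2).degree
          < ((a + b : ℕ) : WithBot ℕ) := by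
        have e1 : (monicPoly a w.1).degree = a := by
          rw [degree_eq_natDegree (monic_monicPoly _ _).ne_zero, natDegree_monicPoly]
        have e2 : (monicPoly b w.2).degree = b := by
          rw [degree_eq_natDegree (monic_monicPoly _ _).ne_zero, natDegree_monicPoly]
        refine (degree_add_le _ _).trans_lt (max_lt ?_ ?_)
        · rw [degree_mul, e1, Nat.cast_add]
          exact WithBot.add_lt_add_left (by simp) (degree_lowPoly_lt _ _)
        · rw [degree_mul, e2, Nat.cast_add]
          exact WithBot.add_lt_add_right (by simp) (degree_lowPoly_lt _ _)
      exact coeff_eq_zero_of_degree_lt (hd.trans_le (by exact_mod_cast not_lt.1 hk))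
  have h1 : monicPoly a w.1 ∣ lowPoly a w'.1 := by
    refine hw.dvd_of_dvd_mul_right ?_
    rw [eq_neg_of_add_eq_zero_right h0]
    exact (dvd_mul_right _ _).neg_right
  have h2 : monicPoly b w.2 ∣ lowPoly b w'.2 := by
    refine hw.symm.dvd_of_dvd_mul_left ?_
    rw [eq_neg_of_add_eq_zero_left h0]
    exact (dvd_mul_left _ _).neg_right
  have z1 := eq_zero_of_dvd_of_degree_lt h1 (by
    rw [degree_eq_natDegree (monic_monicPoly _ _).ne_zero, natDegree_monicPoly]
    exact degree_lowPoly_lt _ _)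
  have z2 := eq_zero_of_dvd_of_degree_lt h2 (by
    rw [degree_eq_natDegree (monic_monicPoly _ _).ne_zero, natDegree_monicPoly]
    exact degree_lowPoly_lt _ _)
  exact Prod.ext (lowPoly_eq_zero z1) (lowPoly_eq_zero z2)

/-- Hensel's lemma for the ring of germs of analytic functions: a coprime factorization of the
polynomial at `0` extends to an analytic factorization near `0`. -/
theorem exists_analytic_factorization {a b : ℕ} {c : ℂ → Fin (a + b) → ℂ}
    (hc : AnalyticAt ℂ c 0) {w : (Fin a → ℂ) × (Fin b → ℂ)}
    (h0 : monicPoly (a + b) (c 0) = monicPoly a w.1 * monicPoly b w.2)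
    (hw : IsCoprime (monicPoly a w.1) (monicPoly b w.2)) :
    ∃ (u : ℂ → Fin a → ℂ) (v : ℂ → Fin b → ℂ), AnalyticAt ℂ u 0 ∧ AnalyticAt ℂ v 0 ∧
      ∀ᶠ t in 𝓝 0, monicPoly (a + b) (c t) = monicPoly a (u t) * monicPoly b (v t) := by
  have hbase : mulCoeff a b w = c 0 := by
    funext k
    rw [mulCoeff, ← h0, coeff_monicPoly, dif_pos k.2]
  -- Source and target both have dimension a + b, so injectivity of the derivative is enough.
  let e : ((Fin a → ℂ) × (Fin b → ℂ)) ≃L[ℂ] (Fin (a + b) → ℂ) :=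
    (LinearMap.linearEquivOfInjective (fderiv ℂ (mulCoeff a b) w).toLinearMap
      (fderiv_mulCoeff_injective w hw) (by simp)).toContinuousLinearEquiv
  have he : (e : ((Fin a → ℂ) × (Fin b → ℂ)) →L[ℂ] (Fin (a + b) → ℂ)) =
      fderiv ℂ (mulCoeff a b) w := ContinuousLinearMap.ext fun _ => rfl
  have hd : HasFDerivAt (mulCoeff a b)
      (e : ((Fin a → ℂ) × (Fin b → ℂ)) →L[ℂ] (Fin (a + b) → ℂ)) w := by
    rw [he]
    exact ((contDiff_mulCoeff a b).differentiable (by simp) w).hasFDerivAt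
  -- Here `⊤` is the analytic order ω, so the inverse function theorem returns an analytic local
  -- inverse of coefficient multiplication.
  have hcd : ContDiffAt ℂ ⊤ (mulCoeff a b) w := (contDiff_mulCoeff a b).contDiffAt
  have hinv := hcd.to_localInverse hd (by simp)
  have hright : ∀ᶠ y in 𝓝 (mulCoeff a b w),
      mulCoeff a b (hcd.localInverse hd (by simp) y) = y :=
    (hcd.hasStrictFDerivAt' hd (by simp)).eventually_right_inverse
  set ψ := hcd.localInverse hd (by simp) with hψ
  rw [hbase] at hinv hright
  have hψa : AnalyticAt ℂ (fun t => ψ (c t)) 0 := by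
    have : AnalyticAt ℂ ψ (c 0) := hinv.analyticAt
    exact this.comp hc
  refine ⟨fun t => (ψ (c t)).1, fun t => (ψ (c t)).2,
    AnalyticAt.comp (g := Prod.fst) analyticAt_fst hψa,
    AnalyticAt.comp (g := Prod.snd) analyticAt_snd hψa, ?_⟩
  filter_upwards [hc.continuousAt.eventually hright] with t ht
  have hm : (monicPoly a (ψ (c t)).1 * monicPoly b (ψ (c t)).2).Monic :=
    (monic_monicPoly _ _).mul (monic_monicPoly _ _)
  have hdeg : (monicPoly a (ψ (c t)).1 * monicPoly b (ψ (c t)).2).natDegree = a + b := by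
    rw [(monic_monicPoly _ _).natDegree_mul (monic_monicPoly _ _), natDegree_monicPoly,
      natDegree_monicPoly]
  rw [eq_monicPoly hm hdeg]
  congr 1
  exact ht.symm

/-! ### Puiseux's theorem -/

/-- After the substitution `t ↦ t ^ q`, the polynomials `P t` split into linear factors that
depend analytically on `t`, near `0`. -/
def HasPuiseuxRoots (P : ℂ → ℂ[X]) : Prop :=
  ∃ q : ℕ, 0 < q ∧ ∃ l : List (ℂ → ℂ), (∀ g ∈ l, AnalyticAt ℂ g 0) ∧
    ∀ᶠ t in 𝓝 (0 : ℂ), P (t ^ q) = (l.map fun g => X - C (g t)).prod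

theorem tendsto_pow_nhds_zero {q : ℕ} (hq : 0 < q) :
    Tendsto (fun t : ℂ => t ^ q) (𝓝 0) (𝓝 0) := by
  have : ContinuousAt (fun t : ℂ => t ^ q) 0 := by fun_prop
  simpa [ContinuousAt, hq.ne'] using this

theorem AnalyticAt.comp_pow {g : ℂ → ℂ} (hg : AnalyticAt ℂ g 0) {q : ℕ} (hq : 0 < q) :
    AnalyticAt ℂ (fun t => g (t ^ q)) 0 := by
  refine AnalyticAt.fun_comp (g := g) ?_ (by fun_prop)
  simpa [hq.ne'] using hg

/-! ### Operations on polynomial families that preserve splitting -/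

namespace HasPuiseuxRoots

theorem congr {P Q : ℂ → ℂ[X]} (hP : HasPuiseuxRoots P) (h : ∀ᶠ t in 𝓝 0, Q t = P t) :
    HasPuiseuxRoots Q := by
  obtain ⟨q, hq, l, hl, hPl⟩ := hP
  refine ⟨q, hq, l, hl, ?_⟩
  filter_upwards [hPl, (tendsto_pow_nhds_zero hq).eventually h] with t h1 h2
  rw [h2, h1]

theorem of_pow {P : ℂ → ℂ[X]} {N : ℕ} (hN : 0 < N) (hP : HasPuiseuxRoots fun t => P (t ^ N)) :
    HasPuiseuxRoots P := by
  obtain ⟨q, hq, l, hl, hPl⟩ := hP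
  exact ⟨q * N, Nat.mul_pos hq hN, l, hl, by simpa only [pow_mul] using hPl⟩

theorem mul {P Q : ℂ → ℂ[X]} (hP : HasPuiseuxRoots P) (hQ : HasPuiseuxRoots Q) :
    HasPuiseuxRoots fun t => P t * Q t := by
  obtain ⟨q, hq, l, hl, hPl⟩ := hP
  obtain ⟨q', hq', l', hl', hPl'⟩ := hQ
  refine ⟨q * q', Nat.mul_pos hq hq', l.map (fun g t => g (t ^ q')) ++
    l'.map (fun g t => g (t ^ q)), ?_, ?_⟩
  · intro g hg
    simp only [List.mem_append, List.mem_map] at hg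
    rcases hg with ⟨f, hf, rfl⟩ | ⟨f, hf, rfl⟩
    · exact (hl f hf).comp_pow hq'
    · exact (hl' f hf).comp_pow hq
  · filter_upwards [(tendsto_pow_nhds_zero hq').eventually hPl,
      (tendsto_pow_nhds_zero hq).eventually hPl'] with t h1 h2
    rw [← pow_mul, mul_comm q' q] at h1
    rw [← pow_mul] at h2
    rw [h1, h2, List.map_append, List.prod_append, List.map_map, List.map_map]
    rfl

theorem comp {P : ℂ → ℂ[X]} (hP : HasPuiseuxRoots P) {s : ℂ → ℂ} (hs : AnalyticAt ℂ s 0) :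
    HasPuiseuxRoots fun t => (P t).comp (X - C (s t)) := by
  obtain ⟨q, hq, l, hl, hPl⟩ := hP
  refine ⟨q, hq, l.map (fun g t => g t + s (t ^ q)), ?_, ?_⟩
  · intro g hg
    obtain ⟨f, hf, rfl⟩ := List.mem_map.1 hg
    exact (hl f hf).add (hs.comp_pow hq)
  · filter_upwards [hPl] with t h1
    rw [h1, List.map_map]
    clear h1 hPl hl
    induction l with
    | nil => simp
    | cons f l ih =>
      rw [List.map_cons, List.prod_cons, mul_comp, ih, List.map_cons, List.prod_cons]
      congr 1
      simp only [sub_comp, X_comp, C_comp, Function.comp_apply, C_add]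
      ring

theorem scaleRoots {P : ℂ → ℂ[X]} (hP : HasPuiseuxRoots P) (m : ℕ) :
    HasPuiseuxRoots fun t => (P t).scaleRoots (t ^ m) := by
  obtain ⟨q, hq, l, hl, hPl⟩ := hP
  refine ⟨q, hq, l.map (fun g t => g t * (t ^ q) ^ m), ?_, ?_⟩
  · intro g hg
    obtain ⟨f, hf, rfl⟩ := List.mem_map.1 hg
    exact AnalyticAt.mul (hl f hf) (by fun_prop)
  · filter_upwards [hPl] with t h1
    rw [h1, List.map_map]
    clear h1 hPl hl
    induction l with
    | nil => simp [one_scaleRoots]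
    | cons f l ih =>
      rw [List.map_cons, List.prod_cons, mul_scaleRoots_of_noZeroDivisors, ih, List.map_cons,
        List.prod_cons, X_sub_C_scaleRoots]
      rfl

end HasPuiseuxRoots

/-- Split off the full power (X - x)^r of one root. If that were all of Q, the coefficient of
X^{n-1} would be -n x, so its vanishing would force x = 0 and Q = X^n. -/
theorem exists_coprime_factorization {n : ℕ} {Q : ℂ[X]} (hQ : Q.Monic) (hn : Q.natDegree = n)
    (hpos : 0 < n) (h1 : Q.coeff (n - 1) = 0) (hne : Q ≠ X ^ n) :
    ∃ (a b : ℕ) (G H : ℂ[X]), a < n ∧ b < n ∧ a + b = n ∧ G.Monic ∧ H.Monic ∧ G.natDegree = a ∧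
      H.natDegree = b ∧ Q = G * H ∧ IsCoprime G H := by
  obtain ⟨x, hx⟩ := Complex.exists_root (f := Q) (by
    rw [degree_eq_natDegree hQ.ne_zero, hn]; exact_mod_cast hpos)
  obtain ⟨H, hH, hnd⟩ := exists_eq_pow_rootMultiplicity_mul_and_not_dvd Q hQ.ne_zero x
  have hr : 0 < rootMultiplicity x Q := (rootMultiplicity_pos hQ.ne_zero).2 hx
  set r := rootMultiplicity x Q
  have hG : ((X - C x) ^ r).Monic := (monic_X_sub_C x).pow r
  have hHm : H.Monic := hG.of_mul_monic_left (hH ▸ hQ)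
  have hdG : ((X - C x) ^ r).natDegree = r := by simp
  have hsum : r + H.natDegree = n := by
    rw [← hn, hH, hG.natDegree_mul hHm, hdG]
  refine ⟨r, H.natDegree, _, H, ?_, by lia, hsum, hG, hHm, hdG, rfl, hH, ?_⟩
  · by_contra hlt
    have hd0 : H.natDegree = 0 := by lia
    have hrn : r = n := by lia
    have hH1 : H = 1 := hHm.natDegree_eq_zero.1 hd0
    rw [hH1, mul_one, hrn] at hH
    rw [hH, sub_eq_add_neg, ← C_neg, coeff_X_add_C_pow] at h1
    have hnn : n - (n - 1) = 1 := by lia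
    rw [hnn, pow_one, Nat.choose_symm (by lia : 1 ≤ n), Nat.choose_one_right] at h1
    have hx0 : x = 0 := by
      rcases mul_eq_zero.1 h1 with h | h
      · simpa using h
      · exact absurd (Nat.cast_eq_zero.1 h) (by lia)
    exact hne (by rw [hH, hx0]; simp)
  · exact (((irreducible_X_sub_C x).coprime_iff_not_dvd).2 hnd).pow_left

theorem coeff_comp_X_sub_C {P : ℂ[X]} {n : ℕ} (hn : P.natDegree = n) (s : ℂ) (k : ℕ) :
    (P.comp (X - C s)).coeff k =
      ∑ i ∈ Finset.range (n + 1), P.coeff i * ((-s) ^ (i - k) * (i.choose k : ℂ)) := by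
  rw [comp_eq_sum_left, sum_over_range _ (by simp), hn, finsetSum_coeff]
  refine Finset.sum_congr rfl fun i _ => ?_
  rw [coeff_C_mul, sub_eq_add_neg, ← C_neg, coeff_X_add_C_pow]

/-- The coefficients of an analytic family of monic polynomials can be rescaled so that they do not
all vanish at `0`. -/
theorem exists_rescaling {n : ℕ} {c : ℂ → Fin n → ℂ} (hc : ∀ k, AnalyticAt ℂ (fun t => c t k) 0)
    (hne : ∃ k, ¬ ∀ᶠ t in 𝓝 0, c t k = 0) :
    ∃ (N m : ℕ) (b : ℂ → Fin n → ℂ), 0 < N ∧ (∀ k, AnalyticAt ℂ (fun t => b t k) 0) ∧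
      (∀ k, ∀ᶠ t in 𝓝 0, c (t ^ N) k = b t k * (t ^ m) ^ (n - (k : ℕ))) ∧ b 0 ≠ 0 ∧
      ∀ k, (∀ᶠ t in 𝓝 0, c t k = 0) → b 0 k = 0 := by
  classical
  have hfac : ∀ k, (¬ ∀ᶠ t in 𝓝 0, c t k = 0) → ∃ (v : ℕ) (h : ℂ → ℂ), AnalyticAt ℂ h 0 ∧
      h 0 ≠ 0 ∧ ∀ᶠ t in 𝓝 0, c t k = t ^ v * h t := by
    intro k hk
    obtain ⟨v, h, h1, h2, h3⟩ := (hc k).exists_eventuallyEq_pow_smul_nonzero_iff.2 hk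
    exact ⟨v, h, h1, h2, by simpa using h3⟩
  choose! v h hha hh0 hh using hfac
  let S : Finset (Fin n) := Finset.univ.filter fun k => ¬ ∀ᶠ t in 𝓝 0, c t k = 0
  have hS : S.Nonempty := by
    obtain ⟨k, hk⟩ := hne
    exact ⟨k, by simpa [S] using hk⟩
  -- If v_k is the order of vanishing of c_k, the Newton polygon slope is the minimum of v_k/(n-k).
  -- Multiplying by n! makes all these quotients integers. After t ↦ t^{n!} the coefficient c_k has
  -- order (n-k) w_k, so dividing by t^{(n-k) w_{k₀}} leaves a nonnegative order, equal to 0 at the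
  -- minimizer k₀.
  let w : Fin n → ℕ := fun k => v k * (n.factorial / (n - (k : ℕ)))
  obtain ⟨k₀, hk₀S, hk₀⟩ := Finset.exists_min_image S w hS
  have hw : ∀ k : Fin n, v k * n.factorial = (n - (k : ℕ)) * w k := by
    intro k
    have hd : n - (k : ℕ) ∣ n.factorial := Nat.dvd_factorial (by lia) (by lia)
    calc v k * n.factorial = v k * ((n - (k : ℕ)) * (n.factorial / (n - (k : ℕ)))) := by
          rw [Nat.mul_div_cancel' hd]
      _ = _ := by ring
  have hN : 0 < n.factorial := n.factorial_pos
  let b : ℂ → Fin n → ℂ := fun t k =>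
    if ∀ᶠ t in 𝓝 0, c t k = 0 then 0 else
      t ^ ((n - (k : ℕ)) * (w k - w k₀)) * h k (t ^ n.factorial)
  refine ⟨n.factorial, w k₀, b, hN, ?_, ?_, ?_, ?_⟩
  · intro k
    by_cases hk : ∀ᶠ t in 𝓝 0, c t k = 0
    · simp only [b, if_pos hk]
      fun_prop
    · simp only [b, if_neg hk]
      exact AnalyticAt.mul (by fun_prop) ((hha k hk).comp_pow hN)
  · intro k
    by_cases hk : ∀ᶠ t in 𝓝 0, c t k = 0
    · simp only [b, if_pos hk, zero_mul]
      exact (tendsto_pow_nhds_zero hN).eventually hk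
    · have hle : w k₀ ≤ w k := hk₀ k (by simpa [S] using hk)
      filter_upwards [(tendsto_pow_nhds_zero hN).eventually (hh k hk)] with t ht
      simp only [b, if_neg hk]
      have hexp : n.factorial * v k =
          (n - (k : ℕ)) * (w k - w k₀) + w k₀ * (n - (k : ℕ)) := by
        rw [mul_comm, hw, mul_comm (w k₀), ← Nat.mul_add, Nat.sub_add_cancel hle]
      rw [ht, ← pow_mul, ← pow_mul, hexp, pow_add]
      ring
  · intro h0
    have hk : ¬ ∀ᶠ t in 𝓝 0, c t k₀ = 0 := by simpa [S] using hk₀S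
    have := congrFun h0 k₀
    simp only [b, if_neg hk, Nat.sub_self, Nat.mul_zero, pow_zero, one_mul, zero_pow hN.ne',
      Pi.zero_apply] at this
    exact hh0 k₀ hk this
  · intro k hk
    simp only [b, if_pos hk]

/-- Puiseux's theorem: a monic polynomial whose coefficients are germs of analytic functions
of `t` splits over the germs of analytic functions of a root `t ^ (1 / q)`. -/
theorem hasPuiseuxRoots (n : ℕ) (c : ℂ → Fin n → ℂ) (hc : ∀ k, AnalyticAt ℂ (fun t => c t k) 0) :
    HasPuiseuxRoots fun t => monicPoly n (c t) := by
  induction n using Nat.strong_induction_on with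
  | _ n ih =>
  rcases Nat.eq_zero_or_pos n with rfl | hpos
  · exact ⟨1, one_pos, [], by simp, by simp [monicPoly, lowPoly]⟩
  -- The shift X ↦ X - c_{n-1}/n kills the coefficient of X^{n-1}, which is what the coprime
  -- splitting below requires.
  set s : ℂ → ℂ := fun t => c t ⟨n - 1, by lia⟩ / n with hs
  have hsa : AnalyticAt ℂ s 0 := (hc _).div_const
  set P : ℂ → ℂ[X] := fun t => (monicPoly n (c t)).comp (X - C (s t)) with hP
  have hPm : ∀ t, (P t).Monic := fun t => (monic_monicPoly _ _).comp_X_sub_C _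
  have hPd : ∀ t, (P t).natDegree = n := fun t => by simp [hP, natDegree_comp, natDegree_monicPoly]
  set c' : ℂ → Fin n → ℂ := fun t k => (P t).coeff k with hc'
  have hPc : ∀ t, P t = monicPoly n (c' t) := fun t => eq_monicPoly (hPm t) (hPd t)
  have hc'a : ∀ k, AnalyticAt ℂ (fun t => c' t k) 0 := by
    intro k
    simp only [hc', hP, coeff_comp_X_sub_C (natDegree_monicPoly _ _), coeff_monicPoly]
    refine Finset.analyticAt_fun_sum _ fun i _ => ?_
    refine AnalyticAt.mul ?_ ((hsa.neg.pow _).mul analyticAt_const)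
    split_ifs
    · exact hc _
    · exact analyticAt_const
    · exact analyticAt_const
  have hlast : ∀ t, c' t ⟨n - 1, by lia⟩ = 0 := by
    intro t
    simp only [hc', hP, coeff_comp_X_sub_C (natDegree_monicPoly _ _)]
    obtain ⟨m, rfl⟩ : ∃ m, n = m + 1 := ⟨n - 1, by lia⟩
    -- Only the terms i = n and i = n-1 contribute to the coefficient of X^{n-1}, namely -n s and
    -- c_{n-1}.
    rw [Finset.sum_range_succ, Finset.sum_range_succ, Finset.sum_eq_zero]
    · have : ((m : ℂ) + 1) ≠ 0 := by exact_mod_cast Nat.succ_ne_zero m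
      simp [coeff_monicPoly, hs]
      field_simp
      ring
    · intro i hi
      rw [Nat.choose_eq_zero_of_lt (by simpa using hi)]
      simp
  suffices hmain : HasPuiseuxRoots fun t => monicPoly n (c' t) by
    refine (hmain.comp (s := fun t => - s t) hsa.neg).congr (Eventually.of_forall fun t => ?_)
    simp only [← hPc, hP, comp_assoc]
    simp
  clear_value c'
  clear hPc hPd hPm hc' hP P hs
  by_cases hne : ∃ k, ¬ ∀ᶠ t in 𝓝 0, c' t k = 0
  swap
  · push Not at hne
    refine ⟨1, one_pos, List.replicate n 0, ?_, ?_⟩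
    · intro g hg
      rw [List.eq_of_mem_replicate hg]
      exact analyticAt_const
    · filter_upwards [eventually_all.2 hne] with t ht
      have : c' t = 0 := funext ht
      simp [this, monicPoly, lowPoly]
  obtain ⟨N, m, b, hN, hba, hb, hb0, hbz⟩ := exists_rescaling hc'a hne
  refine HasPuiseuxRoots.of_pow hN ?_
  -- The polynomial with coefficients c'(t^N) has the roots of the one with coefficients b(t),
  -- multiplied by t^m.
  suffices hmain : HasPuiseuxRoots fun t => monicPoly n (b t) by
    refine (hmain.scaleRoots m).congr ?_
    filter_upwards [eventually_all.2 hb] with t ht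
    ext k
    rw [coeff_scaleRoots, natDegree_monicPoly, coeff_monicPoly, coeff_monicPoly]
    split_ifs with h1 h2
    · exact ht ⟨k, h1⟩
    · simp [h2]
    · simp
  obtain ⟨d, e, G, H, hd, he, hde, hG, hH, hGd, hHd, hGH, hco⟩ :=
    exists_coprime_factorization (monic_monicPoly n (b 0)) (natDegree_monicPoly _ _) hpos
      (by
        rw [coeff_monicPoly, dif_pos (by lia)]
        -- The rescaling keeps identically zero coefficients zero, so the normalization of X^{n-1}
        -- survives.
        exact hbz _ (Eventually.of_forall hlast))
      (by
        intro h
        rw [monicPoly, add_eq_left] at h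
        exact hb0 (lowPoly_eq_zero h))
  subst hde
  rw [eq_monicPoly hG hGd, eq_monicPoly hH hHd] at hGH hco
  obtain ⟨u, v, hu, hv, huv⟩ := exists_analytic_factorization (c := b)
    (w := (fun i => G.coeff i, fun i => H.coeff i)) (analyticAt_pi_iff.2 hba) hGH hco
  exact ((ih d hd u (analyticAt_pi_iff.1 hu)).mul (ih e he v (analyticAt_pi_iff.1 hv))).congr huv

end Puiseux

/-! ### Persistence of zeros -/

/-- Hurwitz's theorem: near a zero of a nonzero entire function, nearby entire functions
have zeros. -/
theorem eventually_exists_zero_near {f : ℝ → ℂ → ℂ} (hc : Continuous (Function.uncurry f))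
    (hd : ∀ x, Differentiable ℂ (f x)) {w₀ : ℂ} (hw₀ : f 0 w₀ ≠ 0) {z₀ : ℂ} (hz₀ : f 0 z₀ = 0)
    {r : ℝ} (hr : 0 < r) :
    ∀ᶠ x in 𝓝 (0 : ℝ), ∃ z, ‖z - z₀‖ < r ∧ f x z = 0 := by
  have hiso : ∀ᶠ z in 𝓝[≠] z₀, f 0 z ≠ 0 := by
    by_contra h
    have han : AnalyticOnNhd ℂ (f 0) Set.univ := fun z _ => (hd 0).analyticAt z
    have := han.eqOn_zero_of_preconnected_of_frequently_eq_zero isPreconnected_univ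
      (Set.mem_univ z₀) h
    exact hw₀ (this (Set.mem_univ w₀))
  obtain ⟨ρ, hρ, hball⟩ := Metric.eventually_nhds_iff.1 (eventually_nhdsWithin_iff.1 hiso)
  -- The circle of radius s lies within the required radius r and within the disc where z₀ is the
  -- only zero of the limit function.
  set s := min r ρ / 2 with hs
  have hs0 : 0 < s := by positivity
  have hsr : s < r := by have := min_le_left r ρ; have := lt_min hr hρ; linarith
  have hsρ : s < ρ := by have := min_le_right r ρ; have := lt_min hr hρ; linarith
  have hsph : ∀ z ∈ Metric.sphere z₀ s, f 0 z ≠ 0 := by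
    intro z hz
    rw [mem_sphere_iff_norm] at hz
    refine hball (by rw [dist_eq_norm]; linarith) ?_
    rintro rfl
    simp at hz
    linarith
  have hcomp : IsCompact (Metric.sphere z₀ s) := isCompact_sphere _ _
  obtain ⟨z₁, hz₁, hmin⟩ := hcomp.exists_isMinOn
    (NormedSpace.sphere_nonempty.2 hs0.le) ((hd 0).continuous.norm.continuousOn)
  set δ := ‖f 0 z₁‖ / 2 with hδ
  have hδ0 : 0 < δ := half_pos (norm_pos_iff.2 (hsph z₁ hz₁))
  have h1 : ∀ᶠ x in 𝓝 (0 : ℝ), ∀ z ∈ Metric.sphere z₀ s, δ < ‖f x z‖ := by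
    refine hcomp.eventually_forall_of_forall_eventually fun z hz => ?_
    have : ContinuousAt (fun y : ℝ × ℂ => ‖f y.1 y.2‖) (0, z) := by
      exact (hc.norm).continuousAt
    refine this.eventually (lt_mem_nhds ?_)
    have hle : ‖f 0 z₁‖ ≤ ‖f 0 z‖ := hmin hz
    simp only
    linarith [norm_pos_iff.2 (hsph z₁ hz₁)]
  have h2 : ∀ᶠ x in 𝓝 (0 : ℝ), ‖f x z₀‖ < δ := by
    have : ContinuousAt (fun x : ℝ => ‖f x z₀‖) 0 :=
      (hc.norm.comp (Continuous.prodMk_left z₀)).continuousAt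
    exact this.eventually (gt_mem_nhds (by simpa [hz₀] using hδ0))
  filter_upwards [h1, h2] with x hx1 hx2
  by_contra! hno
  have hnz : ∀ z ∈ Metric.closedBall z₀ s, f x z ≠ 0 := by
    intro z hz
    rw [mem_closedBall_iff_norm] at hz
    exact hno z (by linarith)
  have hz₀n := hnz z₀ (Metric.mem_closedBall_self hs0.le)
  -- Without zeros in the disc, 1/f_x is holomorphic there and bounded by 1/δ on the circle. The
  -- maximum principle then gives |f_x(z₀)| ≥ δ, against the smallness of f_x at z₀.
  have hdc : DiffContOnCl ℂ (fun z => (f x z)⁻¹) (Metric.ball z₀ s) := by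
    have : DifferentiableOn ℂ (fun z => (f x z)⁻¹) (Metric.closedBall z₀ s) :=
      (hd x).differentiableOn.inv hnz
    exact DifferentiableOn.diffContOnCl (by rwa [closure_ball _ hs0.ne'])
  have hmax := Complex.norm_le_of_forall_mem_frontier_norm_le (C := δ⁻¹) Metric.isBounded_ball hdc
    (by
      intro z hz
      rw [frontier_ball _ hs0.ne'] at hz
      rw [norm_inv]
      exact inv_anti₀ hδ0 (hx1 z hz).le) (subset_closure (Metric.mem_ball_self hs0))
  rw [norm_inv] at hmax
  have := (inv_le_inv₀ (norm_pos_iff.2 hz₀n) hδ0).1 hmax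
  linarith

/-! ### The extragradient stability region near the origin -/

/-- The grouping isolates the term linear in Re μ, which alone may have any size relative to ε. Each
remaining monomial contains the factor (Re μ)² or (Im μ)², whose quotient by ε has a known limit. -/
theorem normSq_egFactor (μ : ℂ) : ‖1 - μ + μ ^ 2‖ ^ 2 =
    1 + (-2 * μ.re * (1 + μ.im ^ 2) + (3 * μ.re ^ 2 - 2 * μ.re * μ.re ^ 2 + μ.re ^ 2 * μ.re ^ 2
      - μ.im ^ 2 + 2 * μ.re ^ 2 * μ.im ^ 2 + μ.im ^ 2 * μ.im ^ 2)) := by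
  rw [← Complex.normSq_eq_norm_sq, Complex.normSq_apply]
  simp [pow_two]
  ring

section Asymptotics

variable {lam : ℝ → ℂ} {η v : ℝ}

/-- Since (Re λ)² = o(ε) and (Im λ)² ~ vε, every monomial except -(Im)² is o(ε). -/
theorem tendsto_egRemainder
    (hre : Tendsto (fun ε => (lam ε).re ^ 2 / ε) (𝓝[>] 0) (𝓝 0))
    (him : Tendsto (fun ε => (lam ε).im ^ 2 / ε) (𝓝[>] 0) (𝓝 v)) :
    Tendsto (fun ε => (η * lam ε).im ^ 2) (𝓝[>] (0 : ℝ)) (𝓝 0) ∧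
    Tendsto (fun ε => (3 * (η * lam ε).re ^ 2 - 2 * (η * lam ε).re * (η * lam ε).re ^ 2 +
      (η * lam ε).re ^ 2 * (η * lam ε).re ^ 2 - (η * lam ε).im ^ 2 +
      2 * (η * lam ε).re ^ 2 * (η * lam ε).im ^ 2 +
      (η * lam ε).im ^ 2 * (η * lam ε).im ^ 2) / ε) (𝓝[>] (0 : ℝ)) (𝓝 (-(η ^ 2 * v))) := by
  have hε : Tendsto (fun ε : ℝ => ε) (𝓝[>] 0) (𝓝 0) := tendsto_nhdsWithin_of_tendsto_nhds tendsto_id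
  have hpos : ∀ᶠ ε : ℝ in 𝓝[>] 0, 0 < ε := self_mem_nhdsWithin
  have hR : Tendsto (fun ε => (η * lam ε).re ^ 2 / ε) (𝓝[>] 0) (𝓝 0) := by
    have := hre.const_mul (η ^ 2)
    rw [mul_zero] at this
    refine this.congr fun ε => ?_
    simp [mul_pow, mul_div_assoc]
  have hI : Tendsto (fun ε => (η * lam ε).im ^ 2 / ε) (𝓝[>] 0) (𝓝 (η ^ 2 * v)) := by
    refine (him.const_mul (η ^ 2)).congr fun ε => ?_
    simp [mul_pow, mul_div_assoc]
  have hR0 : Tendsto (fun ε => (η * lam ε).re ^ 2) (𝓝[>] (0 : ℝ)) (𝓝 0) := by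
    have := hR.mul hε
    rw [mul_zero] at this
    refine this.congr' ?_
    filter_upwards [hpos] with ε h
    field_simp
  have hI0 : Tendsto (fun ε => (η * lam ε).im ^ 2) (𝓝[>] (0 : ℝ)) (𝓝 0) := by
    have := hI.mul hε
    rw [mul_zero] at this
    refine this.congr' ?_
    filter_upwards [hpos] with ε h
    field_simp
  have hr0 : Tendsto (fun ε => (η * lam ε).re) (𝓝[>] (0 : ℝ)) (𝓝 0) := by
    rw [tendsto_zero_iff_abs_tendsto_zero]
    have := hR0.sqrt
    simpa [Real.sqrt_sq_eq_abs, Function.comp_def] using this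
  refine ⟨hI0, ?_⟩
  have := ((((hR.const_mul 3).sub ((hr0.const_mul 2).mul hR)).add (hR0.mul hR)).sub hI).add
    ((hR.mul hI0).const_mul 2) |>.add (hI0.mul hI)
  simp only [mul_zero, sub_zero, add_zero, zero_mul, zero_sub] at this
  refine this.congr fun ε => ?_
  ring

theorem norm_egFactor_lt_one_iff (μ : ℂ) {ε : ℝ} (hε : 0 < ε) : ‖1 - μ + μ ^ 2‖ < 1 ↔
    -2 * (μ.re / ε) * (1 + μ.im ^ 2) + (3 * μ.re ^ 2 - 2 * μ.re * μ.re ^ 2 + μ.re ^ 2 * μ.re ^ 2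
      - μ.im ^ 2 + 2 * μ.re ^ 2 * μ.im ^ 2 + μ.im ^ 2 * μ.im ^ 2) / ε < 0 := by
  have h : -2 * (μ.re / ε) * (1 + μ.im ^ 2) + (3 * μ.re ^ 2 - 2 * μ.re * μ.re ^ 2 +
      μ.re ^ 2 * μ.re ^ 2 - μ.im ^ 2 + 2 * μ.re ^ 2 * μ.im ^ 2 + μ.im ^ 2 * μ.im ^ 2) / ε =
      (‖1 - μ + μ ^ 2‖ ^ 2 - 1) / ε := by
    rw [normSq_egFactor]; ring
  rw [h, div_lt_iff₀ hε, zero_mul, sub_lt_zero, sq_lt_one_iff₀ (norm_nonneg _)]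

/-- To leading order the sign is that of -2η Re λ/ε - η²v, so the threshold for Re λ/ε is -ηv/2.
Only a one-sided bound c is assumed because Re λ/ε may be unbounded. -/
theorem eventually_norm_egFactor_lt_one (hη : 0 < η)
    (hre : Tendsto (fun ε => (lam ε).re ^ 2 / ε) (𝓝[>] 0) (𝓝 0))
    (him : Tendsto (fun ε => (lam ε).im ^ 2 / ε) (𝓝[>] 0) (𝓝 v))
    {c : ℝ} (hc : -(η * v / 2) < c) (hlam : ∀ᶠ ε in 𝓝[>] (0 : ℝ), c ≤ (lam ε).re / ε) :
    ∀ᶠ ε in 𝓝[>] (0 : ℝ), ‖1 - η * lam ε + (η * lam ε) ^ 2‖ < 1 := by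
  obtain ⟨hI, hR⟩ := tendsto_egRemainder (η := η) hre him
  have hlim := ((((hI.const_add 1).const_mul (-2 * (η * c))).add hR))
  have hneg : -2 * (η * c) * (1 + 0) + -(η ^ 2 * v) < 0 := by
    nlinarith [mul_lt_mul_of_pos_left hc hη]
  filter_upwards [hlim.eventually (gt_mem_nhds hneg), hlam, self_mem_nhdsWithin] with ε h1 h2 h3
  rw [norm_egFactor_lt_one_iff _ h3]
  refine lt_of_le_of_lt ?_ h1
  gcongr ?_ + _
  have h4 : η * c ≤ (η * lam ε).re / ε := by
    have := mul_le_mul_of_nonneg_left h2 hη.le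
    simpa [mul_div_assoc] using this
  have h5 : 0 ≤ 1 + (η * lam ε).im ^ 2 := by positivity
  exact mul_le_mul_of_nonneg_right (by linarith) h5

theorem eventually_one_lt_norm_egFactor (hη : 0 < η)
    (hre : Tendsto (fun ε => (lam ε).re ^ 2 / ε) (𝓝[>] 0) (𝓝 0))
    (him : Tendsto (fun ε => (lam ε).im ^ 2 / ε) (𝓝[>] 0) (𝓝 v))
    {c : ℝ} (hc : c < -(η * v / 2)) (hlam : ∀ᶠ ε in 𝓝[>] (0 : ℝ), (lam ε).re / ε ≤ c) :
    ∀ᶠ ε in 𝓝[>] (0 : ℝ), ¬ ‖1 - η * lam ε + (η * lam ε) ^ 2‖ < 1 := by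
  obtain ⟨hI, hR⟩ := tendsto_egRemainder (η := η) hre him
  have hlim := ((((hI.const_add 1).const_mul (-2 * (η * c))).add hR))
  have hneg : 0 < -2 * (η * c) * (1 + 0) + -(η ^ 2 * v) := by
    nlinarith [mul_lt_mul_of_pos_left hc hη]
  filter_upwards [hlim.eventually (lt_mem_nhds hneg), hlam, self_mem_nhdsWithin] with ε h1 h2 h3
  rw [norm_egFactor_lt_one_iff _ h3, not_lt]
  refine h1.le.trans ?_
  gcongr ?_ + _
  have h4 : (η * lam ε).re / ε ≤ η * c := by
    have := mul_le_mul_of_nonneg_left h2 hη.le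
    simpa [mul_div_assoc] using this
  have h5 : 0 ≤ 1 + (η * lam ε).im ^ 2 := by positivity
  exact mul_le_mul_of_nonneg_right (by linarith) h5

end Asymptotics

/-! ### The real part of a Puiseux series -/

/-- For real ε > 0 the powers of ε are real, so Re λ is the series of the Re α_k. Dividing by its
first nonzero term leaves a series that tends to its constant term 1. -/
theorem exists_re_eq_leading {lam : ℝ → ℂ} {p : ℕ} {α : ℕ → ℂ} (hp : 0 < p)
    (hs : ∀ᶠ ε in 𝓝[>] (0 : ℝ),
      HasSum (fun k : ℕ => α k * ((ε ^ ((k : ℝ) / (p : ℝ)) : ℝ) : ℂ)) (lam ε)) :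
    ∃ u : ℝ → ℝ, Tendsto u (𝓝[>] 0) (𝓝 1) ∧ ∀ᶠ ε in 𝓝[>] (0 : ℝ),
      (lam ε).re = leadingCoefficient α * ε ^ leadingExponent p α * u ε := by
  classical
  have hsre : ∀ᶠ ε in 𝓝[>] (0 : ℝ),
      HasSum (fun k : ℕ => (α k).re * ε ^ ((k : ℝ) / (p : ℝ))) (lam ε).re := by
    filter_upwards [hs] with ε h
    have := Complex.hasSum_re h
    simpa only [Complex.re_mul_ofReal] using this
  by_cases hex : ∃ k, (α k).re ≠ 0
  swap
  · refine ⟨fun _ => 1, tendsto_const_nhds, ?_⟩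
    filter_upwards [hsre] with ε h
    push Not at hex
    simp only [hex, zero_mul] at h
    rw [leadingCoefficient, dif_neg (by simpa using hex), zero_mul, zero_mul]
    exact h.unique hasSum_zero
  set k₀ := Nat.find hex with hk₀
  have hβ : (α k₀).re ≠ 0 := Nat.find_spec hex
  have hlc : leadingCoefficient α = (α k₀).re := by
    rw [leadingCoefficient, dif_pos hex]
  have hle : leadingExponent p α = (k₀ : ℝ) / p := by
    rw [leadingExponent, dif_pos hex]
  have hlow : ∀ k < k₀, (α k).re = 0 := fun k hk => not_not.1 (Nat.find_min hex hk)
  have hp' : (0 : ℝ) < p := by exact_mod_cast hp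
  have hshift : ∀ᶠ ε in 𝓝[>] (0 : ℝ),
      HasSum (fun j : ℕ => (α (j + k₀)).re / (α k₀).re * ε ^ ((j : ℝ) / (p : ℝ)))
        ((lam ε).re / ((α k₀).re * ε ^ ((k₀ : ℝ) / p))) := by
    filter_upwards [hsre, self_mem_nhdsWithin] with ε h (hε : 0 < ε)
    have h1 := (hasSum_nat_add_iff' k₀).2 h
    rw [Finset.sum_eq_zero (fun i hi => by rw [hlow i (by simpa using hi), zero_mul]),
      sub_zero] at h1
    have h2 := h1.div_const ((α k₀).re * ε ^ ((k₀ : ℝ) / p))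
    refine h2.congr_fun fun j => ?_
    have : ((j + k₀ : ℕ) : ℝ) / p = (j : ℝ) / p + (k₀ : ℝ) / p := by push_cast; ring
    rw [this, Real.rpow_add hε]
    have := (Real.rpow_pos_of_pos hε ((k₀ : ℝ) / p)).ne'
    field_simp
  refine ⟨fun ε => ∑' j : ℕ, (α (j + k₀)).re / (α k₀).re * ε ^ ((j : ℝ) / (p : ℝ)), ?_, ?_⟩
  · obtain ⟨ε₁, hε₁, hε₁0⟩ := (hshift.and self_mem_nhdsWithin).exists
    have hε₁0 : 0 < ε₁ := hε₁0
    have hlim : ∑' j : ℕ, (if j = 0 then (1 : ℝ) else 0) = 1 := by simp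
    rw [← hlim]
    refine tendsto_tsum_of_dominated_convergence hε₁.summable.abs ?_ ?_
    · intro j
      by_cases hj : j = 0
      · subst hj
        simp [hβ]
      · rw [if_neg hj]
        have h1 : Tendsto (fun ε : ℝ => ε ^ ((j : ℝ) / p)) (𝓝[>] 0) (𝓝 0) := by
          have hpos : 0 < (j : ℝ) / p := by positivity
          have := (Real.continuousAt_rpow_const 0 ((j : ℝ) / p) (Or.inr hpos.le)).tendsto
          rw [Real.zero_rpow hpos.ne'] at this
          exact tendsto_nhdsWithin_of_tendsto_nhds this
        simpa using h1.const_mul ((α (j + k₀)).re / (α k₀).re)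
    · have hlt : ∀ᶠ ε in 𝓝[>] (0 : ℝ), ε ≤ ε₁ :=
        eventually_nhdsWithin_of_eventually_nhds (ge_mem_nhds hε₁0)
      filter_upwards [hlt, self_mem_nhdsWithin] with ε h1 (h2 : 0 < ε) j
      rw [Real.norm_eq_abs, abs_mul, abs_mul, abs_of_nonneg (Real.rpow_nonneg h2.le _),
        abs_of_nonneg (Real.rpow_nonneg hε₁0.le _)]
      gcongr
  · filter_upwards [hshift, self_mem_nhdsWithin] with ε h (hε : 0 < ε)
    rw [h.tsum_eq, hlc, hle]
    have := (Real.rpow_pos_of_pos hε ((k₀ : ℝ) / p)).ne'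
    field_simp

/-- A monomial in ε always has a limit in [-∞, ∞]. This ensures that each branch of type ±iσ√ε
contributes a member of `hemicurvatures`. -/
theorem exists_isHemicurvature (p : ℕ) (α : ℕ → ℂ) (σ : ℝ) :
    ∃ ι, IsHemicurvature p α σ ι := by
  unfold IsHemicurvature
  set ξ := leadingCoefficient α
  set e := leadingExponent p α - 1
  have hε : Tendsto (fun ε : ℝ => ε) (𝓝[>] 0) (𝓝 0) := tendsto_nhdsWithin_of_tendsto_nhds tendsto_id
  have hcoe : ∀ {g : ℝ → ℝ} {x : ℝ}, Tendsto g (𝓝[>] 0) (𝓝 x) →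
      ∃ ι, Tendsto (fun ε => (g ε : EReal)) (𝓝[>] (0 : ℝ)) (𝓝 ι) :=
    fun h => ⟨_, (continuous_coe_real_ereal.tendsto _).comp h⟩
  rcases lt_trichotomy e 0 with he | he | he
  · have htop : Tendsto (fun ε : ℝ => ε ^ e) (𝓝[>] 0) atTop := tendsto_rpow_neg_nhdsGT_zero he
    rcases lt_trichotomy (ξ / σ ^ 2) 0 with h | h | h
    · refine ⟨⊥, EReal.tendsto_coe_nhds_bot_iff.2 ?_⟩
      refine (htop.const_mul_atTop_of_neg h).congr fun ε => by ring
    · refine hcoe (x := 0) (tendsto_const_nhds.congr fun ε => ?_)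
      rw [mul_div_right_comm, h, zero_mul]
    · refine ⟨⊤, EReal.tendsto_coe_nhds_top_iff.2 ?_⟩
      refine (htop.const_mul_atTop h).congr fun ε => by ring
  · refine hcoe (x := ξ / σ ^ 2) (tendsto_const_nhds.congr fun ε => ?_)
    rw [he, Real.rpow_zero, mul_one]
  · refine hcoe (x := ξ * 0 / σ ^ 2) (Tendsto.div_const (Tendsto.const_mul _ ?_) _)
    have := (Real.continuousAt_rpow_const 0 e (Or.inr he.le)).tendsto
    rw [Real.zero_rpow he.ne'] at this
    exact this.comp hε

/-- Dividing by √ε gives λ/√ε → iσ, and the claims are the squares of the real and imaginary parts.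
Squaring forgets the sign in ±iσ. -/
theorem tendsto_sq_div_of_isLittleO {lam : ℝ → ℂ} {σ : ℝ}
    (h : (fun ε : ℝ => lam ε - Complex.I * (σ : ℂ) * (√ε : ℂ)) =o[𝓝[>] (0 : ℝ)] fun ε : ℝ => √ε) :
    Tendsto (fun ε => (lam ε).re ^ 2 / ε) (𝓝[>] 0) (𝓝 0) ∧
    Tendsto (fun ε => (lam ε).im ^ 2 / ε) (𝓝[>] 0) (𝓝 (σ ^ 2)) := by
  have h1 : Tendsto (fun ε : ℝ => (lam ε - Complex.I * (σ : ℂ) * (√ε : ℂ)) / ((√ε : ℝ) : ℂ))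
      (𝓝[>] 0) (𝓝 0) := by
    have h' : (fun ε : ℝ => lam ε - Complex.I * (σ : ℂ) * (√ε : ℂ)) =o[𝓝[>] (0 : ℝ)]
        fun ε : ℝ => ((√ε : ℝ) : ℂ) := by
      exact h.trans_le fun ε => by simp
    exact h'.tendsto_div_nhds_zero
  have h2 : Tendsto (fun ε : ℝ => lam ε / ((√ε : ℝ) : ℂ)) (𝓝[>] 0) (𝓝 (Complex.I * σ)) := by
    have := h1.add_const (Complex.I * (σ : ℂ))
    rw [zero_add] at this
    refine this.congr' ?_
    filter_upwards [self_mem_nhdsWithin] with ε (hε : 0 < ε)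
    have : ((√ε : ℝ) : ℂ) ≠ 0 := by exact_mod_cast (Real.sqrt_pos.2 hε).ne'
    field_simp
    ring
  have hre := ((Complex.continuous_re.tendsto _).comp h2).pow 2
  have him := ((Complex.continuous_im.tendsto _).comp h2).pow 2
  constructor
  · refine (Tendsto.congr' ?_ hre).trans (by simp)
    filter_upwards [self_mem_nhdsWithin] with ε (hε : 0 < ε)
    simp [Complex.div_ofReal_re, div_pow, Real.sq_sqrt hε.le]
  · refine (Tendsto.congr' ?_ him).trans (by simp)
    filter_upwards [self_mem_nhdsWithin] with ε (hε : 0 < ε)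
    simp [Complex.div_ofReal_im, div_pow, Real.sq_sqrt hε.le]

theorem tendsto_sq_div_of_isLittleO_or {lam : ℝ → ℂ} {σ : ℝ}
    (h : (fun ε : ℝ => lam ε - Complex.I * (σ : ℂ) * (√ε : ℂ)) =o[𝓝[>] (0 : ℝ)] (fun ε : ℝ => √ε) ∨
      (fun ε : ℝ => lam ε + Complex.I * (σ : ℂ) * (√ε : ℂ)) =o[𝓝[>] (0 : ℝ)] (fun ε : ℝ => √ε)) :
    Tendsto (fun ε => (lam ε).re ^ 2 / ε) (𝓝[>] 0) (𝓝 0) ∧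
    Tendsto (fun ε => (lam ε).im ^ 2 / ε) (𝓝[>] 0) (𝓝 (σ ^ 2)) := by
  rcases h with h | h
  · exact tendsto_sq_div_of_isLittleO h
  · rw [← neg_sq σ]
    refine tendsto_sq_div_of_isLittleO (σ := -σ) (h.congr_left fun ε => ?_)
    push_cast
    ring

/-! ### Stability of a branch decided by its hemicurvature -/

section Hemicurvature

variable {lam : ℝ → ℂ} {p : ℕ} {α : ℕ → ℂ} {σ η : ℝ} {ι : EReal}

theorem eventually_stable_of_hemicurvature (hp : 0 < p)
    (hs : ∀ᶠ ε in 𝓝[>] (0 : ℝ),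
      HasSum (fun k : ℕ => α k * ((ε ^ ((k : ℝ) / (p : ℝ)) : ℝ) : ℂ)) (lam ε))
    (hre : Tendsto (fun ε => (lam ε).re ^ 2 / ε) (𝓝[>] 0) (𝓝 0))
    (him : Tendsto (fun ε => (lam ε).im ^ 2 / ε) (𝓝[>] 0) (𝓝 (σ ^ 2)))
    (hσ : 0 < σ) (hη : 0 < η) (hι : IsHemicurvature p α σ ι) (h : ((-(η / 2) : ℝ) : EReal) < ι) :
    ∀ᶠ ε in 𝓝[>] (0 : ℝ), ‖1 - η * lam ε + (η * lam ε) ^ 2‖ < 1 := by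
  obtain ⟨u, hu, hlam⟩ := exists_re_eq_leading hp hs
  -- Here Re λ/ε = σ² X u with X → ι and u → 1. The margin between -η/2 and c absorbs the
  -- convergence of X, even when ι = ∞, and the further margin c' < c absorbs the factor u.
  obtain ⟨c, hc1, hc2⟩ : ∃ c : ℝ, -(η / 2) < c ∧ c < 0 ∧ (c : EReal) < ι := by
    have h0 : ((-(η / 2) : ℝ) : EReal) < min ι (0 : ℝ) :=
      lt_min h (EReal.coe_lt_coe_iff.2 (by linarith))
    obtain ⟨c, h1, h2⟩ := EReal.lt_iff_exists_real_btwn.1 h0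
    exact ⟨c, EReal.coe_lt_coe_iff.1 h1, EReal.coe_lt_coe_iff.1 (h2.trans_le (min_le_right _ _)),
      h2.trans_le (min_le_left _ _)⟩
  obtain ⟨hc2, hc3⟩ := hc2
  obtain ⟨c', hc'1, hc'2⟩ := exists_between hc1
  have hX := hι.eventually (lt_mem_nhds hc3)
  have hcu : ∀ᶠ ε in 𝓝[>] (0 : ℝ), c' < c * u ε := by
    have := hu.const_mul c
    rw [mul_one] at this
    exact this.eventually (lt_mem_nhds hc'2)
  have hσ2 : 0 < σ ^ 2 := by positivity
  refine eventually_norm_egFactor_lt_one (c := σ ^ 2 * c') hη hre him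
    (by nlinarith) ?_
  filter_upwards [hX, hcu, hu.eventually (lt_mem_nhds one_pos), hlam, self_mem_nhdsWithin]
    with ε h1 h2 h3 h4 (h5 : 0 < ε)
  have h1 := EReal.coe_lt_coe_iff.1 h1
  have hrw : (lam ε).re / ε = σ ^ 2 *
      (leadingCoefficient α * ε ^ (leadingExponent p α - 1) / σ ^ 2 * u ε) := by
    rw [h4, Real.rpow_sub_one h5.ne']
    field_simp
  rw [hrw]
  gcongr
  exact h2.le.trans (mul_le_mul_of_nonneg_right h1.le h3.le)

theorem eventually_unstable_of_hemicurvature (hp : 0 < p)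
    (hs : ∀ᶠ ε in 𝓝[>] (0 : ℝ),
      HasSum (fun k : ℕ => α k * ((ε ^ ((k : ℝ) / (p : ℝ)) : ℝ) : ℂ)) (lam ε))
    (hre : Tendsto (fun ε => (lam ε).re ^ 2 / ε) (𝓝[>] 0) (𝓝 0))
    (him : Tendsto (fun ε => (lam ε).im ^ 2 / ε) (𝓝[>] 0) (𝓝 (σ ^ 2)))
    (hσ : 0 < σ) (hη : 0 < η) (hι : IsHemicurvature p α σ ι) (h : ι < ((-(η / 2) : ℝ) : EReal)) :
    ∀ᶠ ε in 𝓝[>] (0 : ℝ), ¬ ‖1 - η * lam ε + (η * lam ε) ^ 2‖ < 1 := by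
  obtain ⟨u, hu, hlam⟩ := exists_re_eq_leading hp hs
  obtain ⟨c, hc3, hc1⟩ := EReal.lt_iff_exists_real_btwn.1 h
  have hc1 := EReal.coe_lt_coe_iff.1 hc1
  obtain ⟨c', hc'1, hc'2⟩ := exists_between hc1
  have hX := hι.eventually (gt_mem_nhds hc3)
  have hcu : ∀ᶠ ε in 𝓝[>] (0 : ℝ), c * u ε < c' := by
    have := hu.const_mul c
    rw [mul_one] at this
    exact this.eventually (gt_mem_nhds hc'1)
  have hσ2 : 0 < σ ^ 2 := by positivity
  refine eventually_one_lt_norm_egFactor (c := σ ^ 2 * c') hη hre him (by nlinarith) ?_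
  filter_upwards [hX, hcu, hu.eventually (lt_mem_nhds one_pos), hlam, self_mem_nhdsWithin]
    with ε h1 h2 h3 h4 (h5 : 0 < ε)
  have h1 := EReal.coe_lt_coe_iff.1 h1
  have hrw : (lam ε).re / ε = σ ^ 2 *
      (leadingCoefficient α * ε ^ (leadingExponent p α - 1) / σ ^ 2 * u ε) := by
    rw [h4, Real.rpow_sub_one h5.ne']
    field_simp
  rw [hrw]
  gcongr
  exact (mul_le_mul_of_nonneg_right h1.le h3.le).trans h2.le

end Hemicurvature

/-! ### Kernels of block matrices -/

section Blocks

variable {R : Type*} [CommRing R] [IsDomain R] {m n : Type*} [Fintype m] [Fintype n]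
  [DecidableEq m] [DecidableEq n]

theorem det_fromBlocks_eq_zero_iff (a : Matrix m m R) (b : Matrix m n R) (c : Matrix n m R)
    (d : Matrix n n R) : (Matrix.fromBlocks a b c d).det = 0 ↔
      ∃ (x : m → R) (w : n → R), (x ≠ 0 ∨ w ≠ 0) ∧ a *ᵥ x + b *ᵥ w = 0 ∧ c *ᵥ x + d *ᵥ w = 0 := by
  rw [← Matrix.exists_mulVec_eq_zero_iff]
  constructor
  · rintro ⟨v, hv, h⟩
    rw [Matrix.fromBlocks_mulVec] at h
    refine ⟨v ∘ Sum.inl, v ∘ Sum.inr, ?_, ?_, ?_⟩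
    · by_contra! hne
      refine hv (funext fun k => ?_)
      rcases k with i | j
      · exact congrFun hne.1 i
      · exact congrFun hne.2 j
    · funext i; simpa using congrFun h (Sum.inl i)
    · funext j; simpa using congrFun h (Sum.inr j)
  · rintro ⟨x, w, hne, h1, h2⟩
    refine ⟨Sum.elim x w, ?_, ?_⟩
    · intro h
      rcases hne with hx | hw
      · exact hx (funext fun i => congrFun h (Sum.inl i))
      · exact hw (funext fun j => congrFun h (Sum.inr j))
    · rw [Matrix.fromBlocks_mulVec, Sum.elim_comp_inl, Sum.elim_comp_inr, h1, h2]
      funext k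
      rcases k <;> rfl

end Blocks

/-! ### The two-timescale linearization in an eigenbasis of `B` -/

section Rotated

variable {d₁ d₂ : ℕ}

/-- The matrix `diag(e I, I) [[A, K], [-Kᵀ, -diag δ]]`. -/
def rotatedMatrix (A : Matrix (Fin d₁) (Fin d₁) ℝ) (K : Matrix (Fin d₁) (Fin d₂) ℝ)
    (δ : Fin d₂ → ℝ) (e : ℂ) : Matrix (Fin d₁ ⊕ Fin d₂) (Fin d₁ ⊕ Fin d₂) ℂ :=
  Matrix.fromBlocks (e • A.map (algebraMap ℝ ℂ)) (e • K.map (algebraMap ℝ ℂ))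
    (-(K.map (algebraMap ℝ ℂ))ᵀ) (-Matrix.diagonal fun j => (δ j : ℂ))

/-- The characteristic matrix of `rotatedMatrix` after a rescaling of the rows and columns;
the coordinates `j` with `δ j = 0` are scaled differently from the others. -/
def scaledMatrix (A : Matrix (Fin d₁) (Fin d₁) ℝ) (K : Matrix (Fin d₁) (Fin d₂) ℝ)
    (δ : Fin d₂ → ℝ) (κ ω χ ρ l : ℂ) : Matrix (Fin d₁ ⊕ Fin d₂) (Fin d₁ ⊕ Fin d₂) ℂ :=
  Matrix.fromBlocks (ω • (1 : Matrix (Fin d₁) (Fin d₁) ℂ) - κ • A.map (algebraMap ℝ ℂ))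
    (-(K.map (algebraMap ℝ ℂ) * Matrix.diagonal fun j => if δ j = 0 then 1 else κ))
    (Matrix.diagonal (fun j => if δ j = 0 then χ else 1) * (K.map (algebraMap ℝ ℂ))ᵀ)
    (Matrix.diagonal fun j => if δ j = 0 then ρ else l + δ j)

variable {A : Matrix (Fin d₁) (Fin d₁) ℝ} {C K : Matrix (Fin d₁) (Fin d₂) ℝ}
  {B : Matrix (Fin d₂) (Fin d₂) ℝ} {δ : Fin d₂ → ℝ}

theorem continuous_det_scaledMatrix : Continuous fun w : ℂ × ℂ × ℂ × ℂ × ℂ =>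
    (scaledMatrix A K δ w.1 w.2.1 w.2.2.1 w.2.2.2.1 w.2.2.2.2).det := by
  refine Continuous.matrix_det ?_
  unfold scaledMatrix
  refine Continuous.matrix_fromBlocks ?_ ?_ ?_ ?_
  · fun_prop
  · refine (Continuous.matrix_mul continuous_const (Continuous.matrix_diagonal ?_)).neg
    refine continuous_pi fun j => ?_
    split_ifs <;> fun_prop
  · refine Continuous.matrix_mul (Continuous.matrix_diagonal ?_) continuous_const
    refine continuous_pi fun j => ?_
    split_ifs <;> fun_prop
  · refine Continuous.matrix_diagonal ?_
    refine continuous_pi fun j => ?_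
    split_ifs <;> fun_prop

/-- One identity covers three regimes for l = λ(ε), e = ε. With a = λ/ε, b = ε/λ² it treats branches
larger than √ε; with a = λ/ε, b = 1 those between √ε and ε; with a = b = 1 those of order at most ε.
In each case the five parameters have finite limits. -/
theorem scaledMatrix_eq {a b e l : ℂ} (ha : a ≠ 0) (he : e ≠ 0) :
    scaledMatrix A K δ (1 / a) (l / (e * a)) b (b * a * l) l =
      Matrix.diagonal (Sum.elim (fun _ => 1 / (e * a)) fun j => if δ j = 0 then b else 1) *
        (l • 1 - rotatedMatrix A K δ e) *
        Matrix.diagonal (Sum.elim (fun _ => 1) fun j => if δ j = 0 then a else 1) := by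
  ext i j
  rw [Matrix.mul_diagonal, Matrix.diagonal_mul]
  rcases i with i | i <;> rcases j with j | j
  · simp [scaledMatrix, rotatedMatrix, Matrix.one_apply]
    split_ifs
    · field_simp
    · field_simp
      ring
  · simp [scaledMatrix, rotatedMatrix]
    split_ifs <;> field_simp
  · simp [scaledMatrix, rotatedMatrix]
  · by_cases hij : i = j
    · subst hij
      simp [scaledMatrix, rotatedMatrix]
      split_ifs with h
      · simp [h]; ring
      · simp
    · simp [scaledMatrix, rotatedMatrix, hij]

theorem det_scaledMatrix_eq_zero_iff {a b e l : ℂ} (ha : a ≠ 0) (hb : b ≠ 0) (he : e ≠ 0) :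
    (scaledMatrix A K δ (1 / a) (l / (e * a)) b (b * a * l) l).det = 0 ↔
      (l • 1 - rotatedMatrix A K δ e).det = 0 := by
  rw [scaledMatrix_eq ha he, Matrix.det_mul, Matrix.det_mul, Matrix.det_diagonal,
    Matrix.det_diagonal, mul_eq_zero, mul_eq_zero]
  have h1 : ∏ i, Sum.elim (fun _ : Fin d₁ => 1 / (e * a))
      (fun j : Fin d₂ => if δ j = 0 then b else 1) i ≠ 0 := by
    refine Finset.prod_ne_zero_iff.2 fun i _ => ?_
    rcases i with i | i
    · simp [ha, he]
    · simp only [Sum.elim_inr]; split_ifs <;> simp [hb]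
  have h2 : ∏ i, Sum.elim (fun _ : Fin d₁ => (1 : ℂ))
      (fun j : Fin d₂ => if δ j = 0 then a else 1) i ≠ 0 := by
    refine Finset.prod_ne_zero_iff.2 fun i _ => ?_
    rcases i with i | i
    · simp
    · simp only [Sum.elim_inr]; split_ifs <;> simp [ha]
  rw [or_iff_left h2, or_iff_right h1]

theorem eigenvectorUnitary_transpose_mul_self (hB : B.IsHermitian) :
    (hB.eigenvectorUnitary : Matrix (Fin d₂) (Fin d₂) ℝ)ᵀ *
      (hB.eigenvectorUnitary : Matrix (Fin d₂) (Fin d₂) ℝ) = 1 := by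
  have := Unitary.coe_star_mul_self hB.eigenvectorUnitary
  rwa [Matrix.star_eq_conjTranspose, Matrix.conjTranspose_eq_transpose_of_trivial] at this

theorem eq_mul_diagonal_mul_transpose (hB : B.IsHermitian) :
    B = (hB.eigenvectorUnitary : Matrix (Fin d₂) (Fin d₂) ℝ) *
      Matrix.diagonal hB.eigenvalues *
      (hB.eigenvectorUnitary : Matrix (Fin d₂) (Fin d₂) ℝ)ᵀ := by
  have := hB.spectral_theorem
  rw [Unitary.conjStarAlgAut_apply, Matrix.star_eq_conjTranspose,
    Matrix.conjTranspose_eq_transpose_of_trivial] at this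
  exact this

/-- The matrix `C P`, where the columns of `P` are the eigenvectors of `B`. -/
def rotatedCoupling (C : Matrix (Fin d₁) (Fin d₂) ℝ) (hB : B.IsHermitian) :
    Matrix (Fin d₁) (Fin d₂) ℝ :=
  C * (hB.eigenvectorUnitary : Matrix (Fin d₂) (Fin d₂) ℝ)

theorem timescaleMatrix_mul_eq (hB : B.IsHermitian) {ε : ℝ} :
    timescaleMatrix d₁ d₂ (1 / ε) * Matrix.fromBlocks A C (-Cᵀ) (-B) =
      Matrix.fromBlocks 1 0 0 (hB.eigenvectorUnitary : Matrix (Fin d₂) (Fin d₂) ℝ) *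
      Matrix.fromBlocks (ε • A) (ε • rotatedCoupling C hB) (-(rotatedCoupling C hB)ᵀ)
        (-Matrix.diagonal hB.eigenvalues) *
      Matrix.fromBlocks 1 0 0 (hB.eigenvectorUnitary : Matrix (Fin d₂) (Fin d₂) ℝ)ᵀ := by
  have hts : timescaleMatrix d₁ d₂ (1 / ε) =
      Matrix.fromBlocks (ε • (1 : Matrix (Fin d₁) (Fin d₁) ℝ)) 0 0 1 := by
    rw [timescaleMatrix, ← Matrix.fromBlocks_diagonal, one_div_one_div]
    congr 1
    ext i j
    simp [Matrix.diagonal_apply, Matrix.one_apply]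
  have hP := eigenvectorUnitary_transpose_mul_self hB
  have hP' := mul_eq_one_comm.1 hP
  have hS := eq_mul_diagonal_mul_transpose hB
  unfold rotatedCoupling
  generalize (hB.eigenvectorUnitary : Matrix (Fin d₂) (Fin d₂) ℝ) = P at *
  rw [hts, Matrix.fromBlocks_multiply, Matrix.fromBlocks_multiply, Matrix.fromBlocks_multiply]
  congr 1
  · simp
  · simp [Matrix.mul_assoc, hP']
  · simp [← Matrix.mul_assoc, hP']
  · simp only [Matrix.mul_zero, Matrix.zero_mul, zero_add, Matrix.mul_neg, Matrix.neg_mul,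
      Matrix.one_mul]
    rw [← hS]

/-- The timescale matrix is scalar on each block, so it commutes with diag(I, P), and conjugation by
the latter carries the linearization to its rotated form. -/
theorem mem_spectrum_iff_det_rotatedMatrix (hB : B.IsHermitian) {ε : ℝ} {l : ℂ} :
    l ∈ spectrum ℂ ((timescaleMatrix d₁ d₂ (1 / ε) *
      Matrix.fromBlocks A C (-Cᵀ) (-B)).map (algebraMap ℝ ℂ)) ↔
      (l • 1 - rotatedMatrix A (rotatedCoupling C hB) hB.eigenvalues ε).det = 0 := by
  have hP := eigenvectorUnitary_transpose_mul_self hB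
  have hP' := mul_eq_one_comm.1 hP
  set Q := Matrix.fromBlocks (1 : Matrix (Fin d₁) (Fin d₁) ℝ) 0 0
    (hB.eigenvectorUnitary : Matrix (Fin d₂) (Fin d₂) ℝ) with hQ
  set Q' := Matrix.fromBlocks (1 : Matrix (Fin d₁) (Fin d₁) ℝ) 0 0
    (hB.eigenvectorUnitary : Matrix (Fin d₂) (Fin d₂) ℝ)ᵀ with hQ'
  have hQQ : Q * Q' = 1 := by
    rw [hQ, hQ', Matrix.fromBlocks_multiply]
    simp [hP', Matrix.fromBlocks_one]
  have hQQc : Q.map (algebraMap ℝ ℂ) * Q'.map (algebraMap ℝ ℂ) = 1 := by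
    rw [← Matrix.map_mul, hQQ, Matrix.map_one _ (map_zero _) (map_one _)]
  have hN : (Matrix.fromBlocks (ε • A) (ε • rotatedCoupling C hB) (-(rotatedCoupling C hB)ᵀ)
      (-Matrix.diagonal hB.eigenvalues)).map (algebraMap ℝ ℂ) =
      rotatedMatrix A (rotatedCoupling C hB) hB.eigenvalues ε := by
    ext i j
    rcases i with i | i <;> rcases j with j | j <;>
      simp [rotatedMatrix, Matrix.diagonal_apply]
    split_ifs <;> simp
  rw [timescaleMatrix_mul_eq hB, Matrix.map_mul, Matrix.map_mul, hN,
    Matrix.mem_spectrum_iff_isRoot_charpoly, Polynomial.IsRoot, Matrix.eval_charpoly]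
  have : (Matrix.scalar (Fin d₁ ⊕ Fin d₂)) l - Q.map (algebraMap ℝ ℂ) *
      rotatedMatrix A (rotatedCoupling C hB) hB.eigenvalues ε * Q'.map (algebraMap ℝ ℂ) =
      Q.map (algebraMap ℝ ℂ) * (l • 1 - rotatedMatrix A (rotatedCoupling C hB) hB.eigenvalues ε) *
        Q'.map (algebraMap ℝ ℂ) := by
    rw [Matrix.mul_sub, Matrix.sub_mul, Matrix.mul_smul, Matrix.smul_mul, Matrix.mul_one, hQQc]
    congr 1
    ext i j
    simp [Matrix.scalar_apply, Matrix.diagonal_apply, Matrix.one_apply]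
  rw [this, Matrix.det_mul, Matrix.det_mul, mul_right_comm, ← Matrix.det_mul, hQQc, Matrix.det_one,
    one_mul]

theorem rotatedMatrix_sub_eq (e l : ℂ) : l • 1 - rotatedMatrix A K δ e =
    Matrix.fromBlocks (l • 1 - e • A.map (algebraMap ℝ ℂ)) (-(e • K.map (algebraMap ℝ ℂ)))
      (K.map (algebraMap ℝ ℂ))ᵀ (Matrix.diagonal fun j => l + δ j) := by
  ext i j
  rcases i with i | i <;> rcases j with j | j
  · simp [rotatedMatrix, Matrix.one_apply]
  · simp [rotatedMatrix]
  · simp [rotatedMatrix]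
  · by_cases h : i = j
    · subst h; simp [rotatedMatrix]
    · simp [rotatedMatrix, h]

/-- At e = 0 the x-equation is l x = 0, so for l ≠ 0 only the diagonal y-block remains. -/
theorem det_rotatedMatrix_zero {l : ℂ} (hl : l ≠ 0) :
    (l • 1 - rotatedMatrix A K δ 0).det = 0 ↔ ∃ j, l = -(δ j : ℂ) := by
  rw [rotatedMatrix_sub_eq, det_fromBlocks_eq_zero_iff]
  constructor
  · rintro ⟨x, w, hne, h1, h2⟩
    have hx : x = 0 := by simpa [Matrix.smul_mulVec, hl] using h1
    have hw : w ≠ 0 := by simpa [hx] using hne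
    obtain ⟨j, hj⟩ := Function.ne_iff.1 hw
    refine ⟨j, ?_⟩
    have := congrFun h2 j
    rw [hx, Matrix.mulVec_zero, zero_add, Matrix.mulVec_diagonal] at this
    rcases mul_eq_zero.1 this with h | h
    · exact eq_neg_of_add_eq_zero_left h
    · exact absurd h hj
  · rintro ⟨j, rfl⟩
    refine ⟨0, Pi.single j 1, Or.inr (by simp), by
      simp only [zero_smul, neg_zero, Matrix.mulVec_zero, Matrix.zero_mulVec, add_zero], ?_⟩
    funext k
    by_cases h : k = j
    · subst h; simp
    · simp

end Rotated

/-! ### Limits of the scaled characteristic matrix -/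

section Limits

variable {d₁ d₂ : ℕ} {A : Matrix (Fin d₁) (Fin d₁) ℝ} {C : Matrix (Fin d₁) (Fin d₂) ℝ}
  {B : Matrix (Fin d₂) (Fin d₂) ℝ}

/-- A complex kernel vector of a real matrix gives a real one. -/
theorem exists_real_mulVec_eq_zero {n : Type*} [Fintype n] [DecidableEq n] {M : Matrix n n ℝ}
    (h : (M.map (algebraMap ℝ ℂ)).det = 0) : ∃ v, v ≠ 0 ∧ M *ᵥ v = 0 := by
  rw [Matrix.exists_mulVec_eq_zero_iff]
  have := (algebraMap ℝ ℂ).map_det M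
  rw [RingHom.mapMatrix_apply, h] at this
  simpa using this

theorem star_dotProduct_self_eq {n : Type*} [Fintype n] (x : n → ℂ) :
    star x ⬝ᵥ x = ((∑ i, ‖x i‖ ^ 2 : ℝ) : ℂ) := by
  simp [dotProduct, Complex.conj_mul']

theorem sum_norm_sq_pos {n : Type*} [Fintype n] {x : n → ℂ} (hx : x ≠ 0) :
    0 < ∑ i, ‖x i‖ ^ 2 := by
  obtain ⟨i, hi⟩ := Function.ne_iff.1 hx
  exact Finset.sum_pos' (fun _ _ => by positivity) ⟨i, Finset.mem_univ _, by
    have : 0 < ‖x i‖ := norm_pos_iff.2 hi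
    positivity⟩

/-- A kernel vector vanishes successively: the null rows kill the null part of w, the first row then
kills x, and the remaining rows kill the rest of w. -/
theorem det_scaledMatrix_zero_one_ne_zero {K : Matrix (Fin d₁) (Fin d₂) ℝ} {δ : Fin d₂ → ℝ} :
    (scaledMatrix A K δ 0 1 0 1 0).det ≠ 0 := by
  rw [scaledMatrix, Ne, det_fromBlocks_eq_zero_iff]
  rintro ⟨x, w, hne, h1, h2⟩
  have hw0 : ∀ j, δ j = 0 → w j = 0 := by
    intro j hj
    have := congrFun h2 j
    simpa [← Matrix.mulVec_mulVec, Matrix.mulVec_diagonal, hj] using this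
  have hx : x = 0 := by
    have hz : (Matrix.diagonal fun j => if δ j = 0 then (1 : ℂ) else 0) *ᵥ w = 0 := by
      funext j
      rw [Matrix.mulVec_diagonal]
      split_ifs with h
      · simp [hw0 j h]
      · simp
    simpa [Matrix.neg_mulVec, ← Matrix.mulVec_mulVec, hz] using h1
  have hw : w = 0 := by
    funext j
    by_cases hj : δ j = 0
    · exact hw0 j hj
    · have := congrFun h2 j
      simpa [hx, Matrix.mulVec_diagonal, hj] using this
  exact hne.elim (fun h => h hx) (fun h => h hw)

/-- A solution (x, w) of the rotated system gives the kernel vector (x, Pw) of H. -/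
theorem rotatedCoupling_ker (hB : B.IsHermitian)
    (hH : (Matrix.fromBlocks A C (-Cᵀ) (-B)).det ≠ 0) {x : Fin d₁ → ℝ} {w : Fin d₂ → ℝ}
    (h1 : A *ᵥ x + rotatedCoupling C hB *ᵥ w = 0)
    (h2 : (rotatedCoupling C hB)ᵀ *ᵥ x + (Matrix.diagonal hB.eigenvalues) *ᵥ w = 0) :
    x = 0 ∧ w = 0 := by
  have hP := eigenvectorUnitary_transpose_mul_self hB
  have hP' := mul_eq_one_comm.1 hP
  have hS := eq_mul_diagonal_mul_transpose hB
  unfold rotatedCoupling at h1 h2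
  generalize (hB.eigenvectorUnitary : Matrix (Fin d₂) (Fin d₂) ℝ) = P at *
  by_contra hne
  refine hH ((det_fromBlocks_eq_zero_iff _ _ _ _).2 ⟨x, P *ᵥ w, ?_, ?_, ?_⟩)
  · by_contra! h
    refine hne ⟨h.1, ?_⟩
    have := congrArg (Pᵀ *ᵥ ·) h.2
    simpa [Matrix.mulVec_mulVec, hP] using this
  · rw [Matrix.mulVec_mulVec]; exact h1
  · have h3 := congrArg (P *ᵥ ·) h2
    simp only [Matrix.mulVec_add, Matrix.mulVec_zero, Matrix.transpose_mul, Matrix.mulVec_mulVec,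
      ← Matrix.mul_assoc, hP', Matrix.one_mul] at h3
    have h4 : B * P = P * Matrix.diagonal hB.eigenvalues := by
      nth_rewrite 1 [hS]
      rw [Matrix.mul_assoc, hP, Matrix.mul_one]
    rw [Matrix.neg_mulVec, Matrix.neg_mulVec, Matrix.mulVec_mulVec, h4, ← neg_add, h3, neg_zero]

theorem nullColumns_mulVec (hB : B.IsHermitian) (u : {j : Fin d₂ // hB.eigenvalues j = 0} → ℝ) :
    nullColumns C hB *ᵥ u =
      rotatedCoupling C hB *ᵥ fun j => if h : hB.eigenvalues j = 0 then u ⟨j, h⟩ else 0 := by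
  classical
  funext i
  simp only [Matrix.mulVec, dotProduct, mul_dite, mul_zero]
  rw [Finset.sum_dite, Finset.sum_const_zero, add_zero]
  refine Finset.sum_bij (fun k _ => ⟨k.1, by simpa using k.2⟩) (by simp) ?_ ?_ ?_
  · intro a _ b _ h
    exact Subtype.ext (by simpa using h)
  · intro b _
    exact ⟨⟨b.1, (Finset.mem_filter.1 b.2).2⟩, Finset.mem_univ _, rfl⟩
  · intro a _
    rfl

/-- A vector in the kernel of C₂, extended by zero to w, makes (0, w) a solution of the rotated
kernel equations. This is how invertibility of H makes all singular values of C₂ positive. -/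
theorem nullColumns_injective (hB : B.IsHermitian)
    (hH : (Matrix.fromBlocks A C (-Cᵀ) (-B)).det ≠ 0) :
    Function.Injective (nullColumns C hB).toEuclideanLin := by
  rw [injective_iff_map_eq_zero]
  intro u hu
  have h1 : nullColumns C hB *ᵥ u.ofLp = 0 := by
    rw [Matrix.toEuclideanLin, Matrix.toLpLin_apply] at hu
    exact congrArg WithLp.ofLp hu
  rw [nullColumns_mulVec] at h1
  have h2 := (rotatedCoupling_ker hB hH (x := 0) (w := fun j =>
    if h : hB.eigenvalues j = 0 then u.ofLp ⟨j, h⟩ else 0) (by rw [h1]; simp) (by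
      funext j
      simp only [Matrix.mulVec_zero, zero_add, Matrix.mulVec_diagonal, Pi.zero_apply]
      split_ifs with h <;> simp [h])).2
  ext ⟨j, hj⟩
  have := congrFun h2 j
  simpa [hj] using this

theorem card_null_eigenvalues (hB : B.IsHermitian) :
    Fintype.card {j : Fin d₂ // hB.eigenvalues j = 0} = d₂ - B.rank := by
  rw [hB.rank_eq_card_non_zero_eigs, Fintype.card_subtype_compl, Fintype.card_fin]
  have := Fintype.card_subtype_le (fun j => hB.eigenvalues j = 0)
  rw [Fintype.card_fin] at this
  lia

theorem singularValues_nullColumns_pos (hB : B.IsHermitian)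
    (hH : (Matrix.fromBlocks A C (-Cᵀ) (-B)).det ≠ 0) {k : ℕ} (hk : k < d₂ - B.rank) :
    0 < (nullColumns C hB).toEuclideanLin.singularValues k := by
  refine (LinearMap.injective_iff_forall_lt_finrank_singularValues_pos _).1
    (nullColumns_injective hB hH) k ?_
  rwa [finrank_euclideanSpace, card_null_eigenvalues hB]

theorem exists_singularValue_sq_eq (hB : B.IsHermitian) {s : ℝ}
    {u : {j : Fin d₂ // hB.eigenvalues j = 0} → ℝ} (hu : u ≠ 0)
    (h : (nullColumns C hB)ᵀ *ᵥ (nullColumns C hB *ᵥ u) = s • u) :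
    ∃ k, k < d₂ - B.rank ∧ (nullColumns C hB).toEuclideanLin.singularValues k ^ 2 = s := by
  set T := (nullColumns C hB).toEuclideanLin with hT
  have hadj : LinearMap.adjoint T = (nullColumns C hB)ᵀ.toEuclideanLin := by
    rw [hT, ← Matrix.toEuclideanLin_conjTranspose_eq_adjoint,
      Matrix.conjTranspose_eq_transpose_of_trivial]
  have hev : Module.End.HasEigenvalue (LinearMap.adjoint T ∘ₗ T) s := by
    refine Module.End.hasEigenvalue_of_hasEigenvector (x := WithLp.toLp 2 u) ⟨?_, ?_⟩
    · rw [Module.End.mem_eigenspace_iff, LinearMap.comp_apply, hadj, hT, Matrix.toEuclideanLin,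
        Matrix.toEuclideanLin, Matrix.toLpLin_apply, Matrix.toLpLin_apply]
      simp only [h]
      rfl
    · intro h0
      exact hu (congrArg WithLp.ofLp h0)
  obtain ⟨i, hi⟩ := T.isSymmetric_adjoint_comp_self.exists_eigenvalues_eq
    (finrank_euclideanSpace.trans (card_null_eigenvalues hB)) hev
  refine ⟨i, i.2, ?_⟩
  rw [T.sq_singularValues_fin (finrank_euclideanSpace.trans (card_null_eigenvalues hB))]
  simpa using hi

/-- In the intermediate regime the limits of `-λ² / ε` are squares of singular values. -/
theorem exists_singularValue_of_det_eq_zero (hB : B.IsHermitian) {ρ : ℂ}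
    (h : (scaledMatrix A (rotatedCoupling C hB) hB.eigenvalues 0 1 1 ρ 0).det = 0) :
    ∃ k, k < d₂ - B.rank ∧
      ρ = -(((nullColumns C hB).toEuclideanLin.singularValues k ^ 2 : ℝ) : ℂ) := by
  set K := rotatedCoupling C hB with hK
  set δ := hB.eigenvalues with hδ
  -- With D the null part of w, the equations read x = K D and (Kᵀx)_j = -ρ w_j on null coordinates.
  -- Pairing gives |x|² = -ρ|D|², so ρ is real, and real kernel vectors become available.
  have hreal : ρ.im = 0 := by
    rw [scaledMatrix, det_fromBlocks_eq_zero_iff] at h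
    obtain ⟨x, w, hne, h1, h2⟩ := h
    set D : (Fin d₂ → ℂ) := fun j => if δ j = 0 then w j else 0 with hD
    have hx : x = K.map (algebraMap ℝ ℂ) *ᵥ D := by
      have hz : (Matrix.diagonal fun j => if δ j = 0 then (1 : ℂ) else 0) *ᵥ w = D := by
        funext j
        simp [hD, Matrix.mulVec_diagonal]
      rw [Matrix.neg_mulVec, ← Matrix.mulVec_mulVec, hz, ← sub_eq_add_neg, sub_eq_zero] at h1
      simpa using h1
    have hKx : ∀ j, δ j = 0 → ((K.map (algebraMap ℝ ℂ))ᵀ *ᵥ x) j = -(ρ * w j) := by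
      intro j hj
      have := congrFun h2 j
      rw [Pi.add_apply, ← Matrix.mulVec_mulVec, Matrix.mulVec_diagonal, Matrix.mulVec_diagonal,
        if_pos hj, if_pos hj, one_mul] at this
      exact eq_neg_of_add_eq_zero_left this
    have hD0 : D ≠ 0 := by
      intro h0
      rw [h0, Matrix.mulVec_zero] at hx
      refine hne.elim (fun h => h hx) (fun h => h (funext fun j => ?_))
      by_cases hj : δ j = 0
      · simpa [hD, hj] using congrFun h0 j
      · have := congrFun h2 j
        simpa [hx, Matrix.mulVec_diagonal, hj] using this
    have hstar : star (K.map (algebraMap ℝ ℂ) *ᵥ D) = star D ᵥ* (K.map (algebraMap ℝ ℂ))ᵀ := by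
      rw [Matrix.star_mulVec]
      congr 1
      ext i j
      simp
    have hq : star x ⬝ᵥ x = -(ρ * (star D ⬝ᵥ D)) := by
      nth_rewrite 1 [hx]
      rw [hstar, ← Matrix.dotProduct_mulVec]
      simp only [dotProduct, Finset.mul_sum, ← Finset.sum_neg_distrib]
      refine Finset.sum_congr rfl fun j _ => ?_
      by_cases hj : δ j = 0
      · rw [hKx j hj]
        simp only [hD, Pi.star_apply, if_pos hj]
        ring
      · simp [hD, hj]
    rw [star_dotProduct_self_eq, star_dotProduct_self_eq] at hq
    have him := congrArg Complex.im hq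
    rw [Complex.ofReal_im, Complex.neg_im, Complex.im_mul_ofReal, zero_eq_neg] at him
    exact (mul_eq_zero.1 him).resolve_right (sum_norm_sq_pos hD0).ne'
  obtain ⟨r, rfl⟩ : ∃ r : ℝ, ρ = r := ⟨ρ.re, Complex.ext (by simp) (by simpa using hreal)⟩
  have hmap : scaledMatrix A K δ 0 1 1 r 0 = (Matrix.fromBlocks (1 : Matrix (Fin d₁) (Fin d₁) ℝ)
      (-(K * Matrix.diagonal fun j => if δ j = 0 then (1 : ℝ) else 0)) Kᵀ
      (Matrix.diagonal fun j => if δ j = 0 then r else δ j)).map (algebraMap ℝ ℂ) := by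
    ext i j
    rcases i with i | i <;> rcases j with j | j
    · simp [scaledMatrix, Matrix.one_apply]
      split_ifs <;> simp
    · simp [scaledMatrix]
      split_ifs <;> simp
    · simp [scaledMatrix]
    · by_cases hij : i = j
      · subst hij
        simp [scaledMatrix]
        split_ifs <;> simp
      · simp [scaledMatrix, hij]
  rw [hmap] at h
  obtain ⟨v, hv, hv0⟩ := exists_real_mulVec_eq_zero h
  obtain ⟨x, w, hne, h1, h2⟩ := (det_fromBlocks_eq_zero_iff _ _ _ _).1
    (Matrix.exists_mulVec_eq_zero_iff.1 ⟨v, hv, hv0⟩)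
  -- On the null coordinates the system is x = C₂u and C₂ᵀx = -ρu, so -ρ is an eigenvalue of C₂ᵀC₂.
  set u : {j : Fin d₂ // δ j = 0} → ℝ := fun j => w j with hu
  have hx : x = nullColumns C hB *ᵥ u := by
    rw [Matrix.neg_mulVec, ← sub_eq_add_neg, sub_eq_zero, Matrix.one_mulVec,
      ← Matrix.mulVec_mulVec] at h1
    rw [h1, nullColumns_mulVec]
    congr 1
    funext j
    rw [Matrix.mulVec_diagonal]
    split_ifs <;> simp [hu]
  have hu0 : u ≠ 0 := by
    intro h0
    rw [h0, Matrix.mulVec_zero] at hx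
    refine hne.elim (fun h => h hx) (fun h => h (funext fun j => ?_))
    by_cases hj : δ j = 0
    · exact congrFun h0 ⟨j, hj⟩
    · have := congrFun h2 j
      simpa [hx, Matrix.mulVec_diagonal, hj] using this
  obtain ⟨k, hk, hks⟩ := exists_singularValue_sq_eq (C := C) hB (s := -r) hu0 (by
    rw [← hx]
    funext j
    have := congrFun h2 j
    rw [Pi.add_apply, Matrix.mulVec_diagonal, if_pos j.2] at this
    have h3 : ((nullColumns C hB)ᵀ *ᵥ x) j = (Kᵀ *ᵥ x) j := rfl
    rw [h3, Pi.smul_apply, smul_eq_mul, neg_mul]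
    exact eq_neg_of_add_eq_zero_left this)
  exact ⟨k, hk, by rw [hks]; simp⟩

end Limits

/-! ### The restricted Schur complement and the slow eigenvalues -/

section Slow

variable {d₁ d₂ : ℕ} {A : Matrix (Fin d₁) (Fin d₁) ℝ} {C : Matrix (Fin d₁) (Fin d₂) ℝ}
  {B : Matrix (Fin d₂) (Fin d₂) ℝ}

theorem scaledMatrix_slow_eq {K : Matrix (Fin d₁) (Fin d₂) ℝ} {δ : Fin d₂ → ℝ} (μ : ℂ) :
    scaledMatrix A K δ 1 μ 1 0 0 = Matrix.fromBlocks
      (μ • (1 : Matrix (Fin d₁) (Fin d₁) ℂ) - A.map (algebraMap ℝ ℂ)) (-K.map (algebraMap ℝ ℂ))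
      (K.map (algebraMap ℝ ℂ))ᵀ (Matrix.diagonal fun j => (δ j : ℂ)) := by
  ext i j
  rcases i with i | i <;> rcases j with j | j
  · simp [scaledMatrix]
  · simp [scaledMatrix]
  · simp [scaledMatrix]
  · by_cases hij : i = j
    · subst hij
      simp [scaledMatrix]
      intro h
      simp [h]
    · simp [scaledMatrix, hij]

theorem det_slow_real {K : Matrix (Fin d₁) (Fin d₂) ℝ} {δ : Fin d₂ → ℝ} {μ : ℝ}
    (h : (scaledMatrix A K δ 1 μ 1 0 0).det = 0) :
    ∃ (x : Fin d₁ → ℝ) (w : Fin d₂ → ℝ), (x ≠ 0 ∨ w ≠ 0) ∧ A *ᵥ x + K *ᵥ w = μ • x ∧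
      Kᵀ *ᵥ x + Matrix.diagonal δ *ᵥ w = 0 := by
  have hmap : scaledMatrix A K δ 1 μ 1 0 0 = (Matrix.fromBlocks
      (μ • (1 : Matrix (Fin d₁) (Fin d₁) ℝ) - A) (-K) Kᵀ (Matrix.diagonal δ)).map
        (algebraMap ℝ ℂ) := by
    rw [scaledMatrix_slow_eq]
    ext i j
    rcases i with i | i <;> rcases j with j | j
    · simp [Matrix.one_apply]
      split_ifs <;> simp
    · simp
    · simp
    · simp [Matrix.diagonal_apply]
      split_ifs <;> simp
  rw [hmap] at h
  obtain ⟨v, hv, hv0⟩ := exists_real_mulVec_eq_zero h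
  obtain ⟨x, w, hne, h1, h2⟩ := (det_fromBlocks_eq_zero_iff _ _ _ _).1
    (Matrix.exists_mulVec_eq_zero_iff.1 ⟨v, hv, hv0⟩)
  refine ⟨x, w, hne, ?_, h2⟩
  rw [Matrix.sub_mulVec, Matrix.neg_mulVec, Matrix.smul_mulVec, Matrix.one_mulVec, sub_add,
    sub_neg_eq_add, sub_eq_zero] at h1
  exact h1.symm

theorem det_slow_of_real {K : Matrix (Fin d₁) (Fin d₂) ℝ} {δ : Fin d₂ → ℝ} {μ : ℝ}
    {x : Fin d₁ → ℝ} {w : Fin d₂ → ℝ} (hne : x ≠ 0) (h1 : A *ᵥ x + K *ᵥ w = μ • x)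
    (h2 : Kᵀ *ᵥ x + Matrix.diagonal δ *ᵥ w = 0) :
    (scaledMatrix A K δ 1 μ 1 0 0).det = 0 := by
  have hcoe : ∀ {m n : ℕ} (M : Matrix (Fin m) (Fin n) ℝ) (v : Fin n → ℝ),
      M.map (algebraMap ℝ ℂ) *ᵥ (fun i => (v i : ℂ)) = fun i => ((M *ᵥ v) i : ℂ) := by
    intro m n M v
    funext i
    simp [Matrix.mulVec, dotProduct]
  rw [scaledMatrix_slow_eq, det_fromBlocks_eq_zero_iff]
  refine ⟨fun i => x i, fun j => w j, Or.inl ?_, ?_, ?_⟩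
  · intro h
    exact hne (funext fun i => by simpa using congrFun h i)
  · rw [Matrix.sub_mulVec, Matrix.neg_mulVec, Matrix.smul_mulVec, Matrix.one_mulVec, hcoe, hcoe]
    funext i
    have := congrFun h1 i
    simp only [Pi.add_apply, Pi.smul_apply, smul_eq_mul, Pi.sub_apply, Pi.neg_apply,
      Pi.zero_apply] at this ⊢
    rw [← Complex.ofReal_mul, ← this]
    push_cast
    ring
  · rw [← Matrix.transpose_map, hcoe]
    funext j
    have := congrFun h2 j
    simp only [Pi.add_apply, Matrix.mulVec_diagonal, Pi.zero_apply] at this ⊢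
    exact_mod_cast this

/-- Pairing the first equation with x gives μ|x|² = x*Ax - Σ δ_j|w_j|², whose right side is real. -/
theorem im_eq_zero_of_det_slow (hA : A.IsHermitian) (hB : B.IsHermitian)
    (hH : (Matrix.fromBlocks A C (-Cᵀ) (-B)).det ≠ 0) {μ : ℂ}
    (h : (scaledMatrix A (rotatedCoupling C hB) hB.eigenvalues 1 μ 1 0 0).det = 0) :
    μ.im = 0 := by
  have h0 : (scaledMatrix A (rotatedCoupling C hB) hB.eigenvalues 1 (0 : ℝ) 1 0 0).det ≠ 0 := by
    intro h
    obtain ⟨x, w, hne, h1, h2⟩ := det_slow_real h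
    obtain ⟨hx, hw⟩ := rotatedCoupling_ker hB hH (by simpa using h1) h2
    exact hne.elim (fun h => h hx) (fun h => h hw)
  set K := rotatedCoupling C hB with hK
  set δ := hB.eigenvalues with hδ
  rw [scaledMatrix_slow_eq, det_fromBlocks_eq_zero_iff] at h
  obtain ⟨x, w, hne, h1, h2⟩ := h
  -- If x = 0 the parameter μ drops out, and the same vector would be in the kernel at μ = 0, which
  -- invertibility of H excludes.
  have hx0 : x ≠ 0 := by
    intro hx
    refine h0 ?_
    rw [scaledMatrix_slow_eq, det_fromBlocks_eq_zero_iff]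
    exact ⟨x, w, hne, by simpa [hx] using h1, h2⟩
  have e1 : μ • x = A.map (algebraMap ℝ ℂ) *ᵥ x + K.map (algebraMap ℝ ℂ) *ᵥ w := by
    rw [Matrix.sub_mulVec, Matrix.neg_mulVec, Matrix.smul_mulVec, Matrix.one_mulVec, sub_add,
      sub_neg_eq_add, sub_eq_zero] at h1
    exact h1
  have e2 : ∀ j, ((K.map (algebraMap ℝ ℂ))ᵀ *ᵥ x) j = -(δ j * w j) := by
    intro j
    have := congrFun h2 j
    rw [Pi.add_apply, Matrix.mulVec_diagonal] at this
    exact eq_neg_of_add_eq_zero_left this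
  have hAr : (star x ⬝ᵥ (A.map (algebraMap ℝ ℂ) *ᵥ x)).im = 0 := by
    refine Matrix.IsHermitian.im_star_dotProduct_mulVec_self ?_ x
    ext i j
    have := congrFun (congrFun hA i) j
    simp only [Matrix.conjTranspose_apply, star_trivial] at this
    simp [this]
  have hKr : star x ⬝ᵥ (K.map (algebraMap ℝ ℂ) *ᵥ w) = -((∑ j, δ j * ‖w j‖ ^ 2 : ℝ) : ℂ) := by
    have hst : star x ᵥ* K.map (algebraMap ℝ ℂ) = star ((K.map (algebraMap ℝ ℂ))ᵀ *ᵥ x) := by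
      rw [Matrix.star_mulVec]
      congr 1
      ext i j
      simp
    rw [Matrix.dotProduct_mulVec, hst]
    simp only [dotProduct, Pi.star_apply, e2]
    push_cast
    rw [← Finset.sum_neg_distrib]
    refine Finset.sum_congr rfl fun j _ => ?_
    rw [← Complex.conj_mul']
    simp
    ring
  have e3 : star x ⬝ᵥ (μ • x) = star x ⬝ᵥ (A.map (algebraMap ℝ ℂ) *ᵥ x) +
      star x ⬝ᵥ (K.map (algebraMap ℝ ℂ) *ᵥ w) := by rw [e1, dotProduct_add]
  rw [dotProduct_smul, star_dotProduct_self_eq, hKr, smul_eq_mul] at e3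
  have him := congrArg Complex.im e3
  rw [Complex.im_mul_ofReal, Complex.add_im, hAr, Complex.neg_im, Complex.ofReal_im, neg_zero,
    add_zero] at him
  exact (mul_eq_zero.1 him).resolve_right (sum_norm_sq_pos hx0).ne'

/-! ### The orthonormal basis of range(C₂)^⊥ -/

section Basis

variable (hB : B.IsHermitian)

theorem rangeOrthogonalBasis_transpose_mul_self :
    (rangeOrthogonalBasis C hB)ᵀ * rangeOrthogonalBasis C hB = 1 := by
  ext k l
  have h := (stdOrthonormalBasis ℝ (rangeOrthogonal C hB)).inner_eq_ite k l
  rw [Submodule.coe_inner, PiLp.inner_apply] at h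
  rw [Matrix.mul_apply, Matrix.one_apply, ← h]
  refine Finset.sum_congr rfl fun i _ => ?_
  simp [rangeOrthogonalBasis, mul_comm]

theorem rangeOrthogonalBasis_mulVec (u : Fin (Module.finrank ℝ (rangeOrthogonal C hB)) → ℝ) :
    WithLp.toLp 2 (rangeOrthogonalBasis C hB *ᵥ u) =
      ((∑ k, u k • stdOrthonormalBasis ℝ (rangeOrthogonal C hB) k : rangeOrthogonal C hB) :
        EuclideanSpace ℝ (Fin d₁)) := by
  ext i
  simp [rangeOrthogonalBasis, Matrix.mulVec, dotProduct, mul_comm]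

theorem mem_rangeOrthogonal_iff (x : Fin d₁ → ℝ) :
    WithLp.toLp 2 x ∈ rangeOrthogonal C hB ↔ (nullColumns C hB)ᵀ *ᵥ x = 0 := by
  rw [rangeOrthogonal, LinearMap.orthogonal_range,
    ← Matrix.toEuclideanLin_conjTranspose_eq_adjoint,
    Matrix.conjTranspose_eq_transpose_of_trivial, LinearMap.mem_ker, Matrix.toEuclideanLin,
    Matrix.toLpLin_apply, WithLp.toLp_eq_zero]

theorem exists_eq_rangeOrthogonalBasis_mulVec {x : Fin d₁ → ℝ}
    (hx : (nullColumns C hB)ᵀ *ᵥ x = 0) : ∃ u, x = rangeOrthogonalBasis C hB *ᵥ u := by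
  set v : rangeOrthogonal C hB := ⟨WithLp.toLp 2 x, (mem_rangeOrthogonal_iff hB x).2 hx⟩ with hv
  refine ⟨fun k => (stdOrthonormalBasis ℝ (rangeOrthogonal C hB)).repr v k, ?_⟩
  have h := rangeOrthogonalBasis_mulVec hB
    fun k => (stdOrthonormalBasis ℝ (rangeOrthogonal C hB)).repr v k
  rw [(stdOrthonormalBasis ℝ (rangeOrthogonal C hB)).sum_repr v] at h
  exact (congrArg WithLp.ofLp h).symm

theorem nullColumns_transpose_mul_rangeOrthogonalBasis_mulVec
    (u : Fin (Module.finrank ℝ (rangeOrthogonal C hB)) → ℝ) :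
    (nullColumns C hB)ᵀ *ᵥ (rangeOrthogonalBasis C hB *ᵥ u) = 0 := by
  rw [← mem_rangeOrthogonal_iff, rangeOrthogonalBasis_mulVec]
  exact Submodule.coe_mem _

/-- A vector orthogonal to all columns of U lies in the double orthogonal complement of range(C₂),
which is range(C₂) itself. -/
theorem exists_nullColumns_mulVec_of_transpose_mulVec_eq_zero {r : Fin d₁ → ℝ}
    (hr : (rangeOrthogonalBasis C hB)ᵀ *ᵥ r = 0) : ∃ w, r = nullColumns C hB *ᵥ w := by
  have hmem : WithLp.toLp 2 r ∈ (rangeOrthogonal C hB)ᗮ := by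
    rw [Submodule.mem_orthogonal]
    intro y hy
    obtain ⟨u, hu⟩ := exists_eq_rangeOrthogonalBasis_mulVec hB (x := y.ofLp)
      ((mem_rangeOrthogonal_iff hB y.ofLp).1 hy)
    rw [EuclideanSpace.inner_eq_star_dotProduct, star_trivial, hu, Matrix.dotProduct_mulVec,
      ← Matrix.mulVec_transpose, hr, zero_dotProduct]
  rw [rangeOrthogonal, Submodule.orthogonal_orthogonal] at hmem
  obtain ⟨w, hw⟩ := hmem
  refine ⟨w.ofLp, ?_⟩
  rw [Matrix.toEuclideanLin, Matrix.toLpLin_apply] at hw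
  exact (congrArg WithLp.ofLp hw).symm

end Basis

theorem mul_symmPinv_mul (hB : B.IsHermitian) : C * symmPinv hB * Cᵀ =
    rotatedCoupling C hB * Matrix.diagonal (fun j => (hB.eigenvalues j)⁻¹) *
      (rotatedCoupling C hB)ᵀ := by
  simp only [symmPinv, rotatedCoupling, Matrix.transpose_mul, Matrix.mul_assoc]

theorem nullColumns_transpose_mulVec (hB : B.IsHermitian) (x : Fin d₁ → ℝ)
    (j : {j : Fin d₂ // hB.eigenvalues j = 0}) :
    ((nullColumns C hB)ᵀ *ᵥ x) j = ((rotatedCoupling C hB)ᵀ *ᵥ x) j := rfl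

/-- The slow eigenvalues are eigenvalues of the restricted Schur complement. -/
theorem exists_restrictedSchur_eigenvector (hB : B.IsHermitian)
    (hH : (Matrix.fromBlocks A C (-Cᵀ) (-B)).det ≠ 0) {μ : ℝ}
    (h : (scaledMatrix A (rotatedCoupling C hB) hB.eigenvalues 1 μ 1 0 0).det = 0) :
    μ ≠ 0 ∧ ∃ u, u ≠ 0 ∧ restrictedSchur A C hB *ᵥ u = μ • u := by
  obtain ⟨x, w, hne, h1, h2⟩ := det_slow_real h
  have hx0 : x ≠ 0 := by
    intro hx
    obtain ⟨-, hw⟩ := rotatedCoupling_ker hB hH (by simpa [hx] using h1) h2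
    exact hne.elim (fun h => h hx) (fun h => h hw)
  refine ⟨?_, ?_⟩
  · rintro rfl
    exact hx0 (rotatedCoupling_ker hB hH (by simpa using h1) h2).1
  have h2' : ∀ j, ((rotatedCoupling C hB)ᵀ *ᵥ x) j = -(hB.eigenvalues j * w j) := by
    intro j
    have := congrFun h2 j
    rw [Pi.add_apply, Matrix.mulVec_diagonal] at this
    exact eq_neg_of_add_eq_zero_left this
  -- The null rows of the second equation say C₂ᵀx = 0, so x = Uu.
  obtain ⟨u, hu⟩ := exists_eq_rangeOrthogonalBasis_mulVec hB (C := C) (x := x) (by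
    funext j
    rw [nullColumns_transpose_mulVec, h2', j.2]
    simp)
  refine ⟨u, ?_, ?_⟩
  · rintro rfl
    simp at hu
    exact hx0 hu
  set w₀ : {j : Fin d₂ // hB.eigenvalues j = 0} → ℝ := fun j => w j with hw₀
  -- The non-null coordinates of w are eliminated, which produces the pseudoinverse. The null
  -- coordinates act as Lagrange multipliers: they contribute a vector of range(C₂), which Uᵀ
  -- annihilates.
  have hkey : (A - C * symmPinv hB * Cᵀ) *ᵥ x = μ • x - nullColumns C hB *ᵥ w₀ := by
    rw [nullColumns_mulVec, Matrix.sub_mulVec, mul_symmPinv_mul, ← h1, add_sub_assoc,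
      ← Matrix.mulVec_sub, ← Matrix.mulVec_mulVec, ← Matrix.mulVec_mulVec, sub_eq_add_neg,
      ← Matrix.mulVec_neg]
    congr 2
    funext j
    rw [Pi.neg_apply, Matrix.mulVec_diagonal, h2', Pi.sub_apply]
    split_ifs with hj
    · simp [hj, hw₀]
    · field_simp
      simp
  have hz : (rangeOrthogonalBasis C hB)ᵀ *ᵥ (nullColumns C hB *ᵥ w₀) = 0 := by
    refine funext fun k => ?_
    have := nullColumns_transpose_mul_rangeOrthogonalBasis_mulVec (C := C) hB (Pi.single k 1)
    have h3 := congrArg (w₀ ⬝ᵥ ·) this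
    simp only [dotProduct_zero] at h3
    rw [Matrix.dotProduct_mulVec, Matrix.vecMul_transpose, Matrix.dotProduct_mulVec,
      dotProduct_single, mul_one] at h3
    rw [Matrix.mulVec_transpose, h3, Pi.zero_apply]
  rw [restrictedSchur, ← Matrix.mulVec_mulVec, ← Matrix.mulVec_mulVec, ← hu, hkey,
    Matrix.mulVec_sub, hz, sub_zero, Matrix.mulVec_smul, hu, Matrix.mulVec_mulVec,
    rangeOrthogonalBasis_transpose_mul_self, Matrix.one_mulVec]

theorem isHermitian_restrictedSchur (hA : A.IsHermitian) (hB : B.IsHermitian) :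
    (restrictedSchur A C hB).IsHermitian := by
  have hA' : Aᵀ = A := by rwa [← Matrix.conjTranspose_eq_transpose_of_trivial]
  rw [Matrix.IsHermitian, Matrix.conjTranspose_eq_transpose_of_trivial, restrictedSchur,
    mul_symmPinv_mul]
  simp only [Matrix.transpose_mul, Matrix.transpose_sub, Matrix.transpose_transpose, hA',
    Matrix.diagonal_transpose, Matrix.mul_assoc]

/-- Eigenvalues of the restricted Schur complement are slow eigenvalues. -/
theorem det_slow_of_restrictedSchur_eigenvector (hB : B.IsHermitian) {μ : ℝ}
    {u : Fin (Module.finrank ℝ (rangeOrthogonal C hB)) → ℝ} (hu : u ≠ 0)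
    (h : restrictedSchur A C hB *ᵥ u = μ • u) :
    (scaledMatrix A (rotatedCoupling C hB) hB.eigenvalues 1 μ 1 0 0).det = 0 := by
  set x := rangeOrthogonalBasis C hB *ᵥ u with hx
  have hx0 : x ≠ 0 := by
    intro h0
    have := congrArg ((rangeOrthogonalBasis C hB)ᵀ *ᵥ ·) h0
    simp only [hx, Matrix.mulVec_mulVec, rangeOrthogonalBasis_transpose_mul_self,
      Matrix.one_mulVec, Matrix.mulVec_zero] at this
    exact hu this
  -- The eigenvalue equation holds only after applying Uᵀ. The residual is therefore in range(C₂),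
  -- and its preimage supplies the null coordinates of w.
  obtain ⟨w₀, hw₀⟩ := exists_nullColumns_mulVec_of_transpose_mulVec_eq_zero hB (C := C)
    (r := μ • x - (A - C * symmPinv hB * Cᵀ) *ᵥ x) (by
      rw [Matrix.mulVec_sub, Matrix.mulVec_smul, hx, Matrix.mulVec_mulVec,
        rangeOrthogonalBasis_transpose_mul_self, Matrix.one_mulVec, ← h, restrictedSchur,
        ← Matrix.mulVec_mulVec, ← Matrix.mulVec_mulVec, sub_self])
  have hnull := nullColumns_transpose_mul_rangeOrthogonalBasis_mulVec (C := C) hB u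
  refine det_slow_of_real (x := x) (w := fun j => if h : hB.eigenvalues j = 0 then w₀ ⟨j, h⟩ else
    -((hB.eigenvalues j)⁻¹ * ((rotatedCoupling C hB)ᵀ *ᵥ x) j)) hx0 ?_ ?_
  · rw [sub_eq_iff_eq_add, nullColumns_mulVec, Matrix.sub_mulVec, mul_symmPinv_mul] at hw₀
    rw [hw₀, add_sub, add_sub_right_comm, add_comm, add_left_inj, ← Matrix.mulVec_mulVec,
      ← Matrix.mulVec_mulVec, ← Matrix.mulVec_sub]
    congr 1
    funext j
    rw [Pi.sub_apply, Matrix.mulVec_diagonal]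
    split_ifs with hj
    · simp [hj]
    · simp
  · funext j
    rw [Pi.add_apply, Matrix.mulVec_diagonal]
    split_ifs with hj
    · have := congrFun hnull ⟨j, hj⟩
      rw [nullColumns_transpose_mulVec] at this
      rw [hj, zero_mul, add_zero]
      exact this
    · field_simp
      simp

end Slow

/-! ### The linearization of the extragradient step -/

section Linearization

variable {n : Type*} [Fintype n] [DecidableEq n]

theorem ofLp_eq_jacobian_mulVec {φ : EuclideanSpace ℝ n → EuclideanSpace ℝ n}
    {z : EuclideanSpace ℝ n} (v : EuclideanSpace ℝ n) :
    (fderiv ℝ φ z v).ofLp = jacobianMatrix φ z *ᵥ v.ofLp := by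
  have hv : v = ∑ j, v.ofLp j • EuclideanSpace.single j (1 : ℝ) := by
    ext i
    simp [Finset.sum_apply, Pi.single_apply]
  funext i
  conv_lhs => rw [hv]
  simp [jacobianMatrix, Matrix.mulVec, dotProduct, mul_comm]

/-- The spectrum is finite, so the supremum is attained when the spectrum is nonempty, and the
strict bound on each eigenvalue survives. -/
theorem spectralRadius_lt_one_iff (M : Matrix n n ℂ) :
    spectralRadius ℂ M < 1 ↔ ∀ l ∈ spectrum ℂ M, ‖l‖ < 1 := by
  have hfin : (spectrum ℂ M).Finite := by
    refine (M.charpoly.rootSet_finite ℂ).subset fun l hl => ?_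
    rw [Matrix.mem_spectrum_iff_isRoot_charpoly] at hl
    rw [Polynomial.mem_rootSet']
    refine ⟨by simpa using M.charpoly_monic.ne_zero, by simpa using hl⟩
  have hnorm : ∀ l : ℂ, ((‖l‖₊ : ENNReal) < 1 ↔ ‖l‖ < 1) := by
    intro l
    rw [← ENNReal.coe_one, ENNReal.coe_lt_coe, ← NNReal.coe_lt_coe]
    simp
  constructor
  · intro h l hl
    rw [← hnorm]
    exact lt_of_le_of_lt (le_iSup₂ (f := fun k (_ : k ∈ spectrum ℂ M) => (‖k‖₊ : ENNReal)) l hl) h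
  · intro h
    rcases (spectrum ℂ M).eq_empty_or_nonempty with he | hne
    · simp [spectralRadius, he]
    · obtain ⟨l, hl, hmax⟩ := Set.exists_max_image (spectrum ℂ M) (fun k => ‖k‖₊) hfin hne
      refine lt_of_le_of_lt (iSup₂_le fun k hk => ?_) ((hnorm l).2 (h l hl))
      exact ENNReal.coe_le_coe.2 (hmax k hk)

/-- This is the spectral mapping theorem for 1 - ηX + η²X². The 0×0 case is separate because the
form used needs a nonempty spectrum. -/
theorem forall_mem_spectrum_egFactor_iff (N : Matrix n n ℂ) (η : ℂ) :
    (∀ l ∈ spectrum ℂ (1 - η • N + η ^ 2 • (N * N)), ‖l‖ < 1) ↔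
      ∀ l ∈ spectrum ℂ N, ‖1 - η * l + (η * l) ^ 2‖ < 1 := by
  rcases isEmpty_or_nonempty n with hn | hn
  · have h : ∀ M : Matrix n n ℂ, spectrum ℂ M = ∅ := fun M => spectrum.of_subsingleton M
    simp only [h, Set.mem_empty_iff_false, false_imp_iff]
  · have hne : (spectrum ℂ N).Nonempty :=
      spectrum.nonempty_of_isAlgClosed_of_finiteDimensional ℂ N
    have hp : 1 - η • N + η ^ 2 • (N * N) = Polynomial.aeval N
        (1 - Polynomial.C η * Polynomial.X + Polynomial.C (η ^ 2) * (Polynomial.X * Polynomial.X)) := by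
      rw [map_add, map_sub, map_one, map_mul, map_mul, map_mul, Polynomial.aeval_X,
        Polynomial.aeval_C, Polynomial.aeval_C, Algebra.smul_def, Algebra.smul_def]
    rw [hp, spectrum.map_polynomial_aeval_of_nonempty N _ hne, Set.forall_mem_image]
    refine forall₂_congr fun l _ => ?_
    simp [mul_pow, ← pow_two]

variable {d₁ d₂ : ℕ} {f : ZSpace d₁ d₂ → ℝ} {z : ZSpace d₁ d₂}

theorem gradient_apply (f : ZSpace d₁ d₂ → ℝ) (z : ZSpace d₁ d₂) (k : Fin d₁ ⊕ Fin d₂) :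
    gradient f z k = fderiv ℝ f z (EuclideanSpace.single k 1) := by
  rw [← InnerProductSpace.toDual_symm_apply (𝕜 := ℝ), EuclideanSpace.inner_single_right]
  simp [gradient]

theorem hasFDerivAt_gradient_apply (hf : ContDiff ℝ 2 f) (k : Fin d₁ ⊕ Fin d₂) :
    HasFDerivAt (fun z => gradient f z k)
      ((ContinuousLinearMap.apply ℝ ℝ (EuclideanSpace.single k (1 : ℝ))).comp
        (fderiv ℝ (fderiv ℝ f) z)) z := by
  have h1 : HasFDerivAt (fderiv ℝ f) (fderiv ℝ (fderiv ℝ f) z) z :=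
    ((hf.fderiv_right (m := 1) (by norm_num)).differentiable (by norm_num) z).hasFDerivAt
  have h2 := (ContinuousLinearMap.apply ℝ ℝ (EuclideanSpace.single k (1 : ℝ))).hasFDerivAt.comp z h1
  refine h2.congr_of_eventuallyEq (Eventually.of_forall fun y => ?_)
  simp [gradient_apply]

theorem differentiable_saddleGradient (hf : ContDiff ℝ 2 f) :
    Differentiable ℝ (saddleGradient f) := by
  rw [differentiable_euclidean]
  rintro (i | j) z
  · exact (hasFDerivAt_gradient_apply hf (Sum.inl i)).differentiableAt
  · exact (hasFDerivAt_gradient_apply hf (Sum.inr j)).differentiableAt.neg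

theorem jacobianMatrix_saddleGradient (hf : ContDiff ℝ 2 f) :
    jacobianMatrix (saddleGradient f) z =
      Matrix.fromBlocks (hessXX f z) (hessXY f z) (-(hessXY f z)ᵀ) (-hessYY f z) := by
  have hsymm : IsSymmSndFDerivAt ℝ f z := hf.contDiffAt.isSymmSndFDerivAt (by simp)
  have hd := (differentiable_saddleGradient hf z).hasFDerivAt
  have hcoord : ∀ k, HasFDerivAt (fun y => saddleGradient f y k)
      ((EuclideanSpace.proj k).comp (fderiv ℝ (saddleGradient f) z)) z := fun k =>
    (EuclideanSpace.proj k : ZSpace d₁ d₂ →L[ℝ] ℝ).hasFDerivAt.comp z hd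
  have hl : ∀ i v, fderiv ℝ (saddleGradient f) z v (Sum.inl i) =
      fderiv ℝ (fderiv ℝ f) z v (EuclideanSpace.single (Sum.inl i) 1) := by
    intro i v
    exact congrArg (fun T => T v)
      ((hcoord (Sum.inl i)).unique (hasFDerivAt_gradient_apply hf (Sum.inl i)))
  have hr : ∀ j v, fderiv ℝ (saddleGradient f) z v (Sum.inr j) =
      -fderiv ℝ (fderiv ℝ f) z v (EuclideanSpace.single (Sum.inr j) 1) := by
    intro j v
    exact congrArg (fun T => T v)
      ((hcoord (Sum.inr j)).unique (hasFDerivAt_gradient_apply hf (Sum.inr j)).neg)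
  ext k k'
  rcases k with i | j <;> rcases k' with i' | j'
  · exact (hl i _).trans (hsymm.eq _ _)
  · exact (hl i _).trans (hsymm.eq _ _)
  · exact hr j _
  · exact (hr j _).trans (congrArg Neg.neg (hsymm.eq _ _))

theorem isHermitian_hessXX (hf : ContDiff ℝ 2 f) (z : ZSpace d₁ d₂) : (hessXX f z).IsHermitian := by
  have h : IsSymmSndFDerivAt ℝ f z := hf.contDiffAt.isSymmSndFDerivAt (by simp)
  ext i j
  simp only [hessXX, hessianMatrix, Matrix.toBlocks₁₁, Matrix.conjTranspose_apply, Matrix.of_apply,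
    star_trivial]
  exact h.eq _ _

/-- For a unit eigenvector b of B the test vector v = (0, b) gives ⟨v, DF v⟩ = -δ_j, and the
operator norm bounds this Rayleigh quotient. -/
theorem abs_eigenvalue_hessYY_le (hf : ContDiff ℝ 2 f) {L : ℝ}
    (hbound : ‖fderiv ℝ (saddleGradient f) z‖ ≤ L) (j : Fin d₂) :
    |(hessYY_isHermitian hf z).eigenvalues j| ≤ L := by
  set hB := hessYY_isHermitian hf z
  set b := hB.eigenvectorBasis j with hb
  set v : ZSpace d₁ d₂ := WithLp.toLp 2 (Sum.elim 0 b.ofLp) with hv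
  have hvn : ‖v‖ = 1 := by
    have h1 : ‖b‖ = 1 := hB.eigenvectorBasis.orthonormal.1 j
    rw [EuclideanSpace.norm_eq] at h1 ⊢
    rw [← h1]
    simp [hv, Fintype.sum_sum_type]
  have hD : ∀ i, fderiv ℝ (saddleGradient f) z v (Sum.inr i) = -(hB.eigenvalues j * b.ofLp i) := by
    intro i
    have h1 := congrFun (ofLp_eq_jacobian_mulVec (φ := saddleGradient f) (z := z) v) (Sum.inr i)
    rw [h1, jacobianMatrix_saddleGradient hf, Matrix.fromBlocks_mulVec]
    have h2 := congrFun (hB.mulVec_eigenvectorBasis j) i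
    simp only [hv, Sum.elim_inr, Sum.elim_comp_inl, Sum.elim_comp_inr, Matrix.mulVec_zero, zero_add,
      Matrix.neg_mulVec, Pi.neg_apply]
    rw [h2]
    simp [hb]
  have hin : inner ℝ v (fderiv ℝ (saddleGradient f) z v) = -hB.eigenvalues j := by
    have h1 : inner ℝ b b = (1 : ℝ) := by
      rw [real_inner_self_eq_norm_sq, hB.eigenvectorBasis.orthonormal.1 j, one_pow]
    rw [PiLp.inner_apply, Fintype.sum_sum_type]
    rw [PiLp.inner_apply] at h1
    simp only [hD]
    have h2 : ∀ i, inner ℝ (v.ofLp (Sum.inr i)) (-(hB.eigenvalues j * b.ofLp i)) =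
        -hB.eigenvalues j * inner ℝ (b.ofLp i) (b.ofLp i) := by
      intro i
      simp [hv]
      ring
    simp only [h2, ← Finset.mul_sum, h1]
    simp [hv]
  rw [← abs_neg, ← hin]
  refine (abs_real_inner_le_norm _ _).trans ?_
  rw [hvn, one_mul]
  refine ((fderiv ℝ (saddleGradient f) z).le_opNorm v).trans ?_
  rwa [hvn, mul_one]

/-- At a zero of F the inner step fixes z, so both evaluations of F are differentiated at the same
point. -/
theorem hasFDerivAt_two_step {E : Type*} [NormedAddCommGroup E] [NormedSpace ℝ E] {F : E → E}
    {D T : E →L[ℝ] E} {z : E} (hF : HasFDerivAt F D z) (hz : F z = 0) (η : ℝ) :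
    HasFDerivAt (fun z => z - η • T (F (z - η • T (F z))))
      (ContinuousLinearMap.id ℝ E - η • T.comp (D.comp (ContinuousLinearMap.id ℝ E - η • T.comp D)))
      z := by
  have h0 : z - η • T (F z) = z := by rw [hz]; simp
  have h1 : HasFDerivAt (fun z => z - η • T (F z)) (ContinuousLinearMap.id ℝ E - η • T.comp D) z :=
    (hasFDerivAt_id z).sub ((T.hasFDerivAt.comp z hF).const_smul η)
  have h2 : HasFDerivAt F D (z - η • T (F z)) := by rwa [h0]
  exact (hasFDerivAt_id z).sub ((T.hasFDerivAt.comp z (h2.comp z h1)).const_smul η)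

theorem two_step_mulVec (Λ J : Matrix n n ℝ) (η : ℝ) (v : n → ℝ) :
    v - η • Λ *ᵥ (J *ᵥ (v - η • Λ *ᵥ (J *ᵥ v))) =
      (1 - η • (Λ * J) + η ^ 2 • ((Λ * J) * (Λ * J))) *ᵥ v := by
  simp only [Matrix.add_mulVec, Matrix.sub_mulVec, Matrix.one_mulVec, Matrix.smul_mulVec,
    Matrix.mulVec_sub, Matrix.mulVec_smul, Matrix.mulVec_mulVec, smul_sub, smul_smul, pow_two,
    Matrix.mul_assoc]
  abel

theorem jacobianMatrix_extragradientStep (hf : ContDiff ℝ 2 f) (hz : saddleGradient f z = 0)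
    (η τ : ℝ) : jacobianMatrix (extragradientStep f η τ) z =
      1 - η • (timescaleMatrix d₁ d₂ τ * jacobianMatrix (saddleGradient f) z) +
        η ^ 2 • ((timescaleMatrix d₁ d₂ τ * jacobianMatrix (saddleGradient f) z) *
          (timescaleMatrix d₁ d₂ τ * jacobianMatrix (saddleGradient f) z)) := by
  have h3 := hasFDerivAt_two_step
    (T := LinearMap.toContinuousLinearMap (timescaleMatrix d₁ d₂ τ).toEuclideanLin)
    (differentiable_saddleGradient hf z).hasFDerivAt hz η
  have hstep : extragradientStep f η τ = fun z => z - η •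
      (LinearMap.toContinuousLinearMap (timescaleMatrix d₁ d₂ τ).toEuclideanLin)
        (saddleGradient f (z - η •
          (LinearMap.toContinuousLinearMap (timescaleMatrix d₁ d₂ τ).toEuclideanLin)
            (saddleGradient f z))) := by
    funext z
    simp only [extragradientStep, LinearMap.coe_toContinuousLinearMap']
  have hcol : ∀ v, (fderiv ℝ (extragradientStep f η τ) z v).ofLp =
      (1 - η • (timescaleMatrix d₁ d₂ τ * jacobianMatrix (saddleGradient f) z) +
        η ^ 2 • ((timescaleMatrix d₁ d₂ τ * jacobianMatrix (saddleGradient f) z) *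
          (timescaleMatrix d₁ d₂ τ * jacobianMatrix (saddleGradient f) z))) *ᵥ v.ofLp := by
    intro v
    rw [hstep, h3.fderiv, ← two_step_mulVec]
    simp only [_root_.sub_apply, _root_.smul_apply,
      ContinuousLinearMap.comp_apply, ContinuousLinearMap.id_apply, WithLp.ofLp_sub,
      WithLp.ofLp_smul, LinearMap.coe_toContinuousLinearMap', Matrix.toEuclideanLin,
      Matrix.toLpLin_apply, ofLp_eq_jacobian_mulVec]
  ext i j
  have := congrFun (hcol (EuclideanSpace.single j 1)) i
  rw [jacobianMatrix, Matrix.of_apply, this, PiLp.ofLp_single, Matrix.mulVec_single_one]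
  rfl

theorem isStrictLinearlyStable_extragradientStep_iff (hf : ContDiff ℝ 2 f)
    (hz : saddleGradient f z = 0) (η τ : ℝ) :
    IsStrictLinearlyStable (extragradientStep f η τ) z ↔
      ∀ l ∈ spectrum ℂ ((timescaleMatrix d₁ d₂ τ *
        jacobianMatrix (saddleGradient f) z).map (algebraMap ℝ ℂ)),
        ‖1 - η * l + (η * l) ^ 2‖ < 1 := by
  have hfix : extragradientStep f η τ z = z := by simp [extragradientStep, hz]
  have hmap : (1 - η • (timescaleMatrix d₁ d₂ τ * jacobianMatrix (saddleGradient f) z) +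
      η ^ 2 • ((timescaleMatrix d₁ d₂ τ * jacobianMatrix (saddleGradient f) z) *
        (timescaleMatrix d₁ d₂ τ * jacobianMatrix (saddleGradient f) z))).map (algebraMap ℝ ℂ) =
      1 - (η : ℂ) • (timescaleMatrix d₁ d₂ τ *
        jacobianMatrix (saddleGradient f) z).map (algebraMap ℝ ℂ) +
      (η : ℂ) ^ 2 • ((timescaleMatrix d₁ d₂ τ *
        jacobianMatrix (saddleGradient f) z).map (algebraMap ℝ ℂ) *
        (timescaleMatrix d₁ d₂ τ * jacobianMatrix (saddleGradient f) z).map (algebraMap ℝ ℂ)) := by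
    rw [← Matrix.map_mul]
    ext i j
    simp [Matrix.one_apply]
    split_ifs <;> simp
  rw [IsStrictLinearlyStable, and_iff_right hfix, jacobianMatrix_extragradientStep hf hz, hmap,
    spectralRadius_lt_one_iff, forall_mem_spectrum_egFactor_iff]

theorem isStableInftyEG_iff (hf : ContDiff ℝ 2 f) (hz : saddleGradient f z = 0) (η : ℝ) :
    IsStableInftyEG f η z ↔ ∀ᶠ ε : ℝ in 𝓝[>] 0,
      ∀ l : ℂ, (l • 1 - rotatedMatrix (hessXX f z)
        (rotatedCoupling (hessXY f z) (hessYY_isHermitian hf z))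
        (hessYY_isHermitian hf z).eigenvalues ε).det = 0 → ‖1 - η * l + (η * l) ^ 2‖ < 1 := by
  have hiff : ∀ ε : ℝ, IsStrictLinearlyStable (extragradientStep f η (1 / ε)) z ↔
      ∀ l : ℂ, (l • 1 - rotatedMatrix (hessXX f z)
        (rotatedCoupling (hessXY f z) (hessYY_isHermitian hf z))
        (hessYY_isHermitian hf z).eigenvalues ε).det = 0 → ‖1 - η * l + (η * l) ^ 2‖ < 1 := by
    intro ε
    rw [isStrictLinearlyStable_extragradientStep_iff hf hz, jacobianMatrix_saddleGradient hf]
    exact forall_congr' fun l => by rw [mem_spectrum_iff_det_rotatedMatrix (hessYY_isHermitian hf z)]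
  simp only [← hiff]
  constructor
  · rintro ⟨τ₀, hτ₀, h⟩
    have hpos : 0 < τ₀ := by linarith
    filter_upwards [Ioo_mem_nhdsGT (show (0 : ℝ) < 1 / τ₀ by positivity)] with ε hε
    exact h _ ((lt_one_div hpos hε.1).2 hε.2)
  · intro h
    obtain ⟨u, hu, hsub⟩ := mem_nhdsGT_iff_exists_Ioo_subset.1 h
    have hu : 0 < u := hu
    refine ⟨max 1 (1 / u), le_max_left _ _, fun τ hτ => ?_⟩
    have hτ1 : 1 < τ := (le_max_left _ _).trans_lt hτ
    have hτu : 1 / u < τ := (le_max_right _ _).trans_lt hτ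
    have := hsub (show 1 / τ ∈ Set.Ioo 0 u from ⟨by positivity, (one_div_lt hu (by linarith)).1 hτu⟩)
    simpa using this

end Linearization

/-! ### Eigenvalue branches -/

section Branches

variable {d₁ d₂ : ℕ} {A : Matrix (Fin d₁) (Fin d₁) ℝ} {C K : Matrix (Fin d₁) (Fin d₂) ℝ}
  {B : Matrix (Fin d₂) (Fin d₂) ℝ} {δ : Fin d₂ → ℝ}

theorem tendsto_rpow_inv_nhdsGT_zero {q : ℕ} (hq : 0 < q) :
    Tendsto (fun ε : ℝ => ε ^ (1 / (q : ℝ))) (𝓝[>] 0) (𝓝 0) := by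
  have hpos : (0 : ℝ) < 1 / q := by positivity
  have := (Real.continuousAt_rpow_const 0 (1 / (q : ℝ)) (Or.inr hpos.le)).tendsto
  rw [Real.zero_rpow hpos.ne'] at this
  exact tendsto_nhdsWithin_of_tendsto_nhds this

theorem rpow_inv_pow {q : ℕ} {ε : ℝ} (hε : 0 < ε) (k : ℕ) :
    (ε ^ (1 / (q : ℝ))) ^ k = ε ^ ((k : ℝ) / q) := by
  rw [← Real.rpow_natCast, ← Real.rpow_mul hε.le]
  congr 1
  ring

theorem rpow_inv_pow_self {q : ℕ} (hq : 0 < q) {ε : ℝ} (hε : 0 < ε) :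
    (ε ^ (1 / (q : ℝ))) ^ q = ε := by
  rw [rpow_inv_pow hε, div_self (by positivity), Real.rpow_one]

/-- The eigenvalues of the rotated linearization form finitely many analytic branches. -/
theorem exists_branches (A : Matrix (Fin d₁) (Fin d₁) ℝ) (K : Matrix (Fin d₁) (Fin d₂) ℝ)
    (δ : Fin d₂ → ℝ) : ∃ (q : ℕ) (l : List (ℂ → ℂ)), 0 < q ∧ (∀ g ∈ l, AnalyticAt ℂ g 0) ∧
      ∀ᶠ ε : ℝ in 𝓝[>] 0, ∀ z : ℂ, (z • 1 - rotatedMatrix A K δ ε).det = 0 ↔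
        ∃ g ∈ l, z = g ((ε ^ (1 / (q : ℝ)) : ℝ) : ℂ) := by
  -- Lifting the matrix to ℂ[X], with X in place of ε, shows that the coefficients of the
  -- characteristic polynomial are polynomials in ε, hence analytic.
  set M : Matrix (Fin d₁ ⊕ Fin d₂) (Fin d₁ ⊕ Fin d₂) (Polynomial ℂ) := Matrix.fromBlocks
    ((Polynomial.X : Polynomial ℂ) • A.map (fun a => Polynomial.C (a : ℂ)))
    ((Polynomial.X : Polynomial ℂ) • K.map (fun a => Polynomial.C (a : ℂ)))
    (-(K.map (fun a => Polynomial.C (a : ℂ)))ᵀ)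
    (-Matrix.diagonal fun j => Polynomial.C (δ j : ℂ)) with hM
  have hmap : ∀ e : ℂ, rotatedMatrix A K δ e = M.map (Polynomial.evalRingHom e) := by
    intro e
    ext i j
    rcases i with i | i <;> rcases j with j | j
    · simp [rotatedMatrix, hM]; ring
    · simp [rotatedMatrix, hM]; ring
    · simp [rotatedMatrix, hM]
    · by_cases hij : i = j
      · subst hij; simp [rotatedMatrix, hM]
      · simp [rotatedMatrix, hM, hij]
  have hchar : ∀ e : ℂ, (rotatedMatrix A K δ e).charpoly = monicPoly (d₁ + d₂)
      fun k => (M.charpoly.coeff k).eval e := by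
    intro e
    rw [eq_monicPoly (n := d₁ + d₂) (Matrix.charpoly_monic _) (by
      rw [Matrix.charpoly_natDegree_eq_dim]; simp)]
    congr 1
    funext k
    rw [hmap, Matrix.charpoly_map, Polynomial.coeff_map]
    rfl
  obtain ⟨q, hq, l, hl, hev⟩ := hasPuiseuxRoots (d₁ + d₂)
    (fun e k => (M.charpoly.coeff k).eval e) (fun k => by
      have := (AnalyticAt.aeval_polynomial (𝕜 := ℂ) (f := fun z : ℂ => z) (z := 0) analyticAt_id
        (M.charpoly.coeff k))
      simpa [Polynomial.coe_aeval_eq_eval] using this)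
  refine ⟨q, l, hq, hl, ?_⟩
  have hs : Tendsto (fun ε : ℝ => ((ε ^ (1 / (q : ℝ)) : ℝ) : ℂ)) (𝓝[>] 0) (𝓝 0) := by
    have := (Complex.continuous_ofReal.tendsto 0).comp (tendsto_rpow_inv_nhdsGT_zero hq)
    simpa [Function.comp_def] using this
  filter_upwards [hs.eventually hev, self_mem_nhdsWithin] with ε h (hε : 0 < ε) z
  rw [← Complex.ofReal_pow, rpow_inv_pow_self hq hε, ← hchar] at h
  have hdet : (z • 1 - rotatedMatrix A K δ ε).det = (rotatedMatrix A K δ ε).charpoly.eval z := by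
    rw [Matrix.eval_charpoly]
    congr 2
    ext i j
    simp [Matrix.scalar_apply, Matrix.diagonal_apply, Matrix.one_apply]
  rw [hdet, h, Polynomial.eval_list_prod, List.prod_eq_zero_iff, List.map_map, List.mem_map]
  refine exists_congr fun g => and_congr_right fun _ => ?_
  simp [sub_eq_zero]

theorem norm_egFactor_lt_one_of_real {η s : ℝ} (h0 : 0 < η * s) (h1 : η * s < 1) :
    ‖1 - (η : ℂ) * s + ((η : ℂ) * s) ^ 2‖ < 1 := by
  have : (1 - (η : ℂ) * s + ((η : ℂ) * s) ^ 2) = ((1 - η * s + (η * s) ^ 2 : ℝ) : ℂ) := by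
    push_cast; ring
  rw [this, Complex.norm_real, Real.norm_eq_abs, abs_lt]
  constructor <;> nlinarith

/-- A singular limit of the scaled characteristic matrices along a branch. -/
theorem det_scaledMatrix_limit {κ ω χ ρ l : ℝ → ℂ} {κ₀ ω₀ χ₀ ρ₀ l₀ : ℂ}
    (hκ : Tendsto κ (𝓝[>] 0) (𝓝 κ₀)) (hω : Tendsto ω (𝓝[>] 0) (𝓝 ω₀))
    (hχ : Tendsto χ (𝓝[>] 0) (𝓝 χ₀)) (hρ : Tendsto ρ (𝓝[>] 0) (𝓝 ρ₀))
    (hl : Tendsto l (𝓝[>] 0) (𝓝 l₀))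
    (h : ∀ᶠ ε in 𝓝[>] (0 : ℝ), (scaledMatrix A K δ (κ ε) (ω ε) (χ ε) (ρ ε) (l ε)).det = 0) :
    (scaledMatrix A K δ κ₀ ω₀ χ₀ ρ₀ l₀).det = 0 := by
  have hlim := (continuous_det_scaledMatrix (A := A) (K := K) (δ := δ)).tendsto
    (κ₀, ω₀, χ₀, ρ₀, l₀) |>.comp (hκ.prodMk_nhds (hω.prodMk_nhds (hχ.prodMk_nhds
      (hρ.prodMk_nhds hl))))
  exact tendsto_nhds_unique_of_eventuallyEq hlim tendsto_const_nhds h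

variable {g : ℂ → ℂ} {q : ℕ}

theorem tendsto_branch (hg : ContinuousAt g 0) (hq : 0 < q) :
    Tendsto (fun ε : ℝ => g ((ε ^ (1 / (q : ℝ)) : ℝ) : ℂ)) (𝓝[>] 0) (𝓝 (g 0)) := by
  have := (Complex.continuous_ofReal.tendsto 0).comp (tendsto_rpow_inv_nhdsGT_zero hq)
  rw [Complex.ofReal_zero] at this
  exact hg.tendsto.comp this

/-- The limit is some -δ_j ∈ (0, L]. As ηL < 1, it lies inside the open stability region, and so do
nearby values. -/
theorem branch_stable_of_ne_zero {η L : ℝ} (hη : 0 < η) (hηL : η * L < 1)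
    (hδ : ∀ j, δ j ≤ 0) (hδL : ∀ j, |δ j| ≤ L) (hg : AnalyticAt ℂ g 0) (hq : 0 < q)
    (hroot : ∀ᶠ ε : ℝ in 𝓝[>] 0,
      (g ((ε ^ (1 / (q : ℝ)) : ℝ) : ℂ) • 1 - rotatedMatrix A K δ ε).det = 0)
    (h0 : g 0 ≠ 0) : ∀ᶠ ε : ℝ in 𝓝[>] 0,
      ‖1 - η * g ((ε ^ (1 / (q : ℝ)) : ℝ) : ℂ) +
        (η * g ((ε ^ (1 / (q : ℝ)) : ℝ) : ℂ)) ^ 2‖ < 1 := by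
  have hlim := tendsto_branch hg.continuousAt hq
  have hdet : (g 0 • 1 - rotatedMatrix A K δ 0).det = 0 := by
    have hc : Continuous fun w : ℂ × ℂ => (w.1 • 1 - rotatedMatrix A K δ w.2).det := by
      refine Continuous.matrix_det ?_
      unfold rotatedMatrix
      refine Continuous.sub (by fun_prop) (Continuous.matrix_fromBlocks ?_ ?_ ?_ ?_) <;> fun_prop
    have hε : Tendsto (fun ε : ℝ => (ε : ℂ)) (𝓝[>] 0) (𝓝 0) := by
      have := Complex.continuous_ofReal.tendsto 0
      rw [Complex.ofReal_zero] at this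
      exact tendsto_nhdsWithin_of_tendsto_nhds this
    exact tendsto_nhds_unique_of_eventuallyEq
      ((hc.tendsto (g 0, 0)).comp (hlim.prodMk_nhds hε)) tendsto_const_nhds hroot
  obtain ⟨j, hj⟩ := (det_rotatedMatrix_zero h0).1 hdet
  have hs : 0 < -δ j := by
    refine lt_of_le_of_ne (by linarith [hδ j]) fun h => h0 ?_
    rw [hj, ← Complex.ofReal_neg, ← h, Complex.ofReal_zero]
  have hs' : -δ j ≤ L := (neg_le_abs _).trans (hδL j)
  have hbound := norm_egFactor_lt_one_of_real (η := η) (s := -δ j) (by positivity)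
    ((mul_le_mul_of_nonneg_left hs' hη.le).trans_lt hηL)
  rw [Complex.ofReal_neg, ← hj] at hbound
  have hc : Continuous fun z : ℂ => ‖1 - η * z + (η * z) ^ 2‖ := by fun_prop
  exact ((hc.tendsto _).comp hlim).eventually (gt_mem_nhds hbound)

theorem branch_factorization (hB : B.IsHermitian)
    (hH : (Matrix.fromBlocks A C (-Cᵀ) (-B)).det ≠ 0) (hg : AnalyticAt ℂ g 0) (hq : 0 < q)
    (hroot : ∀ᶠ ε : ℝ in 𝓝[>] 0, (g ((ε ^ (1 / (q : ℝ)) : ℝ) : ℂ) • 1 -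
      rotatedMatrix A (rotatedCoupling C hB) hB.eigenvalues ε).det = 0) :
    ∃ (m : ℕ) (h : ℂ → ℂ), AnalyticAt ℂ h 0 ∧ h 0 ≠ 0 ∧ ∀ᶠ t in 𝓝 0, g t = t ^ m * h t := by
  -- A vanishing branch would make 0 an eigenvalue of H_τ. With a = b = 1 and l = 0 the scaled
  -- matrix is the slow pencil at μ = 0, which is nonsingular.
  have hne : ¬ ∀ᶠ t in 𝓝 0, g t = 0 := by
    intro h0
    have hs : Tendsto (fun ε : ℝ => ((ε ^ (1 / (q : ℝ)) : ℝ) : ℂ)) (𝓝[>] 0) (𝓝 0) :=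
      tendsto_branch (g := id) continuousAt_id hq
    obtain ⟨ε, h1, h2, h3⟩ := (hroot.and ((hs.eventually h0).and self_mem_nhdsWithin)).exists
    have h3 : 0 < ε := h3
    rw [h2, ← det_scaledMatrix_eq_zero_iff one_ne_zero one_ne_zero
      (by exact_mod_cast h3.ne')] at h1
    simp only [div_one, mul_one, zero_div, mul_zero] at h1
    exact (exists_restrictedSchur_eigenvector hB hH (μ := 0) (by simpa using h1)).1 rfl
  obtain ⟨m, h, h1, h2, h3⟩ := hg.exists_eventuallyEq_pow_smul_nonzero_iff.2 hne
  exact ⟨m, h, h1, h2, by simpa using h3⟩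

end Branches

/-! ### Branches that tend to zero -/

section BranchAtZero

variable {d₁ d₂ : ℕ} {A : Matrix (Fin d₁) (Fin d₁) ℝ} {C K : Matrix (Fin d₁) (Fin d₂) ℝ}
  {B : Matrix (Fin d₂) (Fin d₂) ℝ} {δ : Fin d₂ → ℝ} {S H : ℝ → ℂ} {c : ℂ} {q : ℕ}

theorem tendsto_pow_mul_limit (hS0 : Tendsto S (𝓝[>] 0) (𝓝 0)) {G : ℝ → ℂ} {c : ℂ}
    (hG : Tendsto G (𝓝[>] 0) (𝓝 c)) (k : ℕ) :
    Tendsto (fun ε => S ε ^ k * G ε) (𝓝[>] 0) (𝓝 (if k = 0 then c else 0)) := by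
  have := (hS0.pow k).mul hG
  split_ifs with hk
  · subst hk; simpa using this
  · simpa [hk] using this

/-- A branch cannot decay more slowly than `√ε`. -/
theorem branch_order_ge (hS0 : Tendsto S (𝓝[>] 0) (𝓝 0))
    (hS : ∀ᶠ ε in 𝓝[>] (0 : ℝ), S ε ≠ 0 ∧ S ε ^ q = ε) (hH : Tendsto H (𝓝[>] 0) (𝓝 c)) (hc : c ≠ 0)
    {m : ℕ} (hm : 0 < m) (hroot : ∀ᶠ ε : ℝ in 𝓝[>] 0,
      ((S ε ^ m * H ε) • 1 - rotatedMatrix A K δ ε).det = 0) : q ≤ 2 * m := by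
  by_contra! hlt
  -- With S = ε^{1/q} and λ = S^m H, the scaling a = λ/ε = H/S^{m+k}, b = ε/λ² = S^k/H² makes ω = ρ
  -- = 1 and sends κ, χ and λ to 0.
  obtain ⟨k, rfl⟩ : ∃ k, q = 2 * m + k := ⟨q - 2 * m, by lia⟩
  have hk : 0 < k := by lia
  have hκ : Tendsto (fun ε => S ε ^ (m + k) * (H ε)⁻¹) (𝓝[>] 0) (𝓝 0) := by
    simpa [hk.ne'] using tendsto_pow_mul_limit hS0 (hH.inv₀ hc) (m + k)
  have hχ : Tendsto (fun ε => S ε ^ k * (H ε ^ 2)⁻¹) (𝓝[>] 0) (𝓝 0) := by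
    simpa [hk.ne'] using tendsto_pow_mul_limit hS0 ((hH.pow 2).inv₀ (pow_ne_zero 2 hc)) k
  have hl : Tendsto (fun ε => S ε ^ m * H ε) (𝓝[>] 0) (𝓝 0) := by
    simpa [hm.ne'] using tendsto_pow_mul_limit hS0 hH m
  refine det_scaledMatrix_zero_one_ne_zero (A := A) (K := K) (δ := δ)
    (det_scaledMatrix_limit hκ tendsto_const_nhds hχ tendsto_const_nhds hl ?_)
  filter_upwards [hroot, hS, hH.eventually_ne hc] with ε h1 ⟨h2, h3⟩ h4
  have hε : (ε : ℂ) ≠ 0 := by rw [← h3]; exact pow_ne_zero _ h2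
  have h5 := (det_scaledMatrix_eq_zero_iff (a := H ε / S ε ^ (m + k))
    (b := S ε ^ k * (H ε ^ 2)⁻¹) (div_ne_zero h4 (pow_ne_zero _ h2))
    (mul_ne_zero (pow_ne_zero _ h2) (inv_ne_zero (pow_ne_zero _ h4))) hε).2 h1
  have e1 : 1 / (H ε / S ε ^ (m + k)) = S ε ^ (m + k) * (H ε)⁻¹ := by rw [one_div_div]; rfl
  have e2 : S ε ^ m * H ε / (ε * (H ε / S ε ^ (m + k))) = 1 := by
    rw [← h3]
    field_simp
    ring
  have e3 : S ε ^ k * (H ε ^ 2)⁻¹ * (H ε / S ε ^ (m + k)) * (S ε ^ m * H ε) = 1 := by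
    field_simp
    ring
  rwa [e1, e2, e3] at h5

/-- A branch that decays more slowly than `ε` is asymptotic to `± i σ √ε`. -/
theorem branch_intermediate (hB : B.IsHermitian)
    (hinv : (Matrix.fromBlocks A C (-Cᵀ) (-B)).det ≠ 0) (hS0 : Tendsto S (𝓝[>] 0) (𝓝 0))
    (hS : ∀ᶠ ε in 𝓝[>] (0 : ℝ), S ε ≠ 0 ∧ S ε ^ q = ε) (hH : Tendsto H (𝓝[>] 0) (𝓝 c)) (hc : c ≠ 0)
    {m : ℕ} (hmq : m < q) (hqm : q ≤ 2 * m) (hroot : ∀ᶠ ε : ℝ in 𝓝[>] 0,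
      ((S ε ^ m * H ε) • 1 -
        rotatedMatrix A (rotatedCoupling C hB) hB.eigenvalues ε).det = 0) :
    q = 2 * m ∧ ∃ k, k < d₂ - B.rank ∧
      c ^ 2 = -(((nullColumns C hB).toEuclideanLin.singularValues k ^ 2 : ℝ) : ℂ) := by
  -- Now k = q - m and, next, j = 2m - q. The scaling a = λ/ε = H/S^k, b = 1 gives ρ = λ²/ε = S^j
  -- H².
  obtain ⟨k, rfl⟩ : ∃ k, q = m + k := ⟨q - m, by lia⟩
  obtain ⟨j, rfl⟩ : ∃ j, m = k + j := ⟨m - k, by lia⟩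
  have hk : 0 < k := by lia
  have hκ : Tendsto (fun ε => S ε ^ k * (H ε)⁻¹) (𝓝[>] 0) (𝓝 0) := by
    simpa [hk.ne'] using tendsto_pow_mul_limit hS0 (hH.inv₀ hc) k
  have hρ := tendsto_pow_mul_limit hS0 (hH.pow 2) j
  have hl : Tendsto (fun ε => S ε ^ (k + j) * H ε) (𝓝[>] 0) (𝓝 0) := by
    simpa [hk.ne'] using tendsto_pow_mul_limit hS0 hH (k + j)
  have hdet := det_scaledMatrix_limit (A := A) (K := rotatedCoupling C hB) (δ := hB.eigenvalues)
    hκ (tendsto_const_nhds (x := 1)) (tendsto_const_nhds (x := 1)) hρ hl (by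
      filter_upwards [hroot, hS, hH.eventually_ne hc] with ε h1 ⟨h2, h3⟩ h4
      have hε : (ε : ℂ) ≠ 0 := by rw [← h3]; exact pow_ne_zero _ h2
      have h5 := (det_scaledMatrix_eq_zero_iff (a := H ε / S ε ^ k) (b := 1)
        (div_ne_zero h4 (pow_ne_zero _ h2)) one_ne_zero hε).2 h1
      have e1 : 1 / (H ε / S ε ^ k) = S ε ^ k * (H ε)⁻¹ := by rw [one_div_div]; rfl
      have e2 : S ε ^ (k + j) * H ε / (ε * (H ε / S ε ^ k)) = 1 := by
        rw [← h3]
        field_simp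
        ring
      have e3 : 1 * (H ε / S ε ^ k) * (S ε ^ (k + j) * H ε) = S ε ^ j * H ε ^ 2 := by
        field_simp
        ring
      rwa [e1, e2, e3] at h5)
  obtain ⟨i, hi, hiρ⟩ := exists_singularValue_of_det_eq_zero hB hdet
  have hσ := singularValues_nullColumns_pos hB hinv hi
  -- For j > 0 the limit of ρ would be 0, whereas it equals -σ² with σ > 0.
  have hj : j = 0 := by
    by_contra hj
    rw [if_neg hj, eq_comm, neg_eq_zero, Complex.ofReal_eq_zero] at hiρ
    exact (pow_pos hσ 2).ne' hiρ
  rw [if_pos hj] at hiρ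
  exact ⟨by lia, i, hi, hiρ⟩

/-- The rescaled limit of a branch of order `ε` is a positive real number. -/
theorem branch_slow (hA : A.IsHermitian) (hB : B.IsHermitian)
    (hinv : (Matrix.fromBlocks A C (-Cᵀ) (-B)).det ≠ 0)
    (hSr : (restrictedSchur A C hB).PosSemidef) (hS0 : Tendsto S (𝓝[>] 0) (𝓝 0))
    (hS : ∀ᶠ ε in 𝓝[>] (0 : ℝ), S ε ≠ 0 ∧ S ε ^ q = ε) (hH : Tendsto H (𝓝[>] 0) (𝓝 c))
    (hq : 0 < q) {m : ℕ} (hqm : q ≤ m) (hroot : ∀ᶠ ε : ℝ in 𝓝[>] 0,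
      ((S ε ^ m * H ε) • 1 -
        rotatedMatrix A (rotatedCoupling C hB) hB.eigenvalues ε).det = 0) :
    ∃ μ : ℝ, 0 < μ ∧ Tendsto (fun ε : ℝ => S ε ^ m * H ε / ε) (𝓝[>] 0) (𝓝 μ) := by
  obtain ⟨k, rfl⟩ : ∃ k, m = q + k := ⟨m - q, by lia⟩
  have hω := tendsto_pow_mul_limit hS0 hH k
  have hω' : Tendsto (fun ε : ℝ => S ε ^ (q + k) * H ε / ε) (𝓝[>] 0)
      (𝓝 (if k = 0 then c else 0)) := by
    refine hω.congr' ?_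
    filter_upwards [hS] with ε ⟨h2, h3⟩
    rw [← h3]
    field_simp
    ring
  have hl : Tendsto (fun ε => S ε ^ (q + k) * H ε) (𝓝[>] 0) (𝓝 0) := by
    simpa [hq.ne'] using tendsto_pow_mul_limit hS0 hH (q + k)
  have hdet := det_scaledMatrix_limit (A := A) (K := rotatedCoupling C hB) (δ := hB.eigenvalues)
    (tendsto_const_nhds (x := 1)) hω' (tendsto_const_nhds (x := 1)) hl hl (by
      filter_upwards [hroot, hS] with ε h1 ⟨h2, h3⟩
      have hε : (ε : ℂ) ≠ 0 := by rw [← h3]; exact pow_ne_zero _ h2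
      have h5 := (det_scaledMatrix_eq_zero_iff (a := 1) (b := 1) one_ne_zero one_ne_zero hε).2 h1
      simpa using h5)
  set w : ℂ := if k = 0 then c else 0
  have hw : w = (w.re : ℂ) :=
    Complex.ext (by simp) (by simpa using im_eq_zero_of_det_slow hA hB hinv hdet)
  rw [hw] at hdet hω'
  -- The limit of λ/ε is an eigenvalue of S_r: nonnegative by semidefiniteness, and nonzero because
  -- H is invertible.
  obtain ⟨hμ, u, hu, huS⟩ := exists_restrictedSchur_eigenvector hB hinv hdet
  refine ⟨w.re, lt_of_le_of_ne ?_ hμ.symm, hω'⟩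
  have h1 := hSr.re_dotProduct_nonneg u
  rw [huS, star_trivial, dotProduct_smul, smul_eq_mul] at h1
  have h2 : 0 < u ⬝ᵥ u := by
    have := Matrix.dotProduct_star_self_pos_iff.2 hu
    rwa [star_trivial] at this
  have h1 : 0 ≤ w.re * (u ⬝ᵥ u) := h1
  exact nonneg_of_mul_nonneg_left h1 h2

/-- Here (Re λ)² and (Im λ)² are both O(ε²), so v = 0 and the threshold for Re λ/ε is 0; c = μ/2
lies strictly between it and the limit μ. -/
theorem stable_of_slow {lam : ℝ → ℂ} {μ η : ℝ} (hμ : 0 < μ) (hη : 0 < η)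
    (h : Tendsto (fun ε : ℝ => lam ε / ε) (𝓝[>] 0) (𝓝 μ)) :
    ∀ᶠ ε in 𝓝[>] (0 : ℝ), ‖1 - η * lam ε + (η * lam ε) ^ 2‖ < 1 := by
  have hε : Tendsto (fun ε : ℝ => ε) (𝓝[>] 0) (𝓝 0) := tendsto_nhdsWithin_of_tendsto_nhds tendsto_id
  have hre := (Complex.continuous_re.tendsto _).comp h
  have him := (Complex.continuous_im.tendsto _).comp h
  have e1 : Tendsto (fun ε => (lam ε).re ^ 2 / ε) (𝓝[>] 0) (𝓝 0) := by
    have := hε.mul (hre.pow 2)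
    rw [zero_mul] at this
    refine this.congr' ?_
    filter_upwards [self_mem_nhdsWithin] with ε (h0 : 0 < ε)
    simp only [Function.comp_apply, Complex.div_ofReal_re]
    field_simp
  have e2 : Tendsto (fun ε => (lam ε).im ^ 2 / ε) (𝓝[>] 0) (𝓝 0) := by
    have := hε.mul (him.pow 2)
    rw [zero_mul] at this
    refine this.congr' ?_
    filter_upwards [self_mem_nhdsWithin] with ε (h0 : 0 < ε)
    simp only [Function.comp_apply, Complex.div_ofReal_im]
    field_simp
  refine eventually_norm_egFactor_lt_one (c := μ / 2) hη e1 e2 (by simp; positivity) ?_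
  have := hre.eventually (lt_mem_nhds (show μ / 2 < (μ : ℂ).re by simpa using hμ))
  filter_upwards [this] with ε h
  simpa [Complex.div_ofReal_re] using h.le

theorem eq_or_eq_neg_of_sq_eq_neg {c : ℂ} {σ : ℝ} (h : c ^ 2 = -((σ ^ 2 : ℝ) : ℂ)) :
    c = Complex.I * σ ∨ c = -(Complex.I * σ) := by
  refine sq_eq_sq_iff_eq_or_eq_neg.1 ?_
  rw [h, mul_pow, Complex.I_sq]
  push_cast
  ring

theorem isPuiseuxEigenvalue_of_branch (hB : B.IsHermitian) {g : ℂ → ℂ} (hg : AnalyticAt ℂ g 0)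
    (hq : 0 < q) (hroot : ∀ᶠ ε : ℝ in 𝓝[>] 0, (g ((ε ^ (1 / (q : ℝ)) : ℝ) : ℂ) • 1 -
      rotatedMatrix A (rotatedCoupling C hB) hB.eigenvalues ε).det = 0) :
    ∃ α, IsPuiseuxEigenvalue (Matrix.fromBlocks A C (-Cᵀ) (-B))
      (fun ε => g ((ε ^ (1 / (q : ℝ)) : ℝ) : ℂ)) q α := by
  obtain ⟨p, hp⟩ := hg
  refine ⟨p.coeff, hq, ?_, ?_⟩
  · filter_upwards [hroot] with ε h
    exact (mem_spectrum_iff_det_rotatedMatrix hB).2 h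
  · have hs : Tendsto (fun ε : ℝ => ((ε ^ (1 / (q : ℝ)) : ℝ) : ℂ)) (𝓝[>] 0) (𝓝 0) :=
      tendsto_branch (g := id) continuousAt_id hq
    filter_upwards [hs.eventually (hasFPowerSeriesAt_iff.1 hp), self_mem_nhdsWithin]
      with ε h (hε : 0 < ε)
    rw [zero_add] at h
    refine h.congr_fun fun k => ?_
    rw [← rpow_inv_pow hε k, smul_eq_mul, mul_comm]
    push_cast
    rfl

theorem branch_stable_of_eq_zero (hA : A.IsHermitian) (hB : B.IsHermitian)
    (hinv : (Matrix.fromBlocks A C (-Cᵀ) (-B)).det ≠ 0)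
    (hSr : (restrictedSchur A C hB).PosSemidef) {η : ℝ} (hη : 0 < η)
    (hι : ∀ ι ∈ hemicurvatures (Matrix.fromBlocks A C (-Cᵀ) (-B)) C hB,
      ((-(η / 2) : ℝ) : EReal) < ι) {g : ℂ → ℂ} (hg : AnalyticAt ℂ g 0) (hq : 0 < q)
    (hroot : ∀ᶠ ε : ℝ in 𝓝[>] 0, (g ((ε ^ (1 / (q : ℝ)) : ℝ) : ℂ) • 1 -
      rotatedMatrix A (rotatedCoupling C hB) hB.eigenvalues ε).det = 0) (h0 : g 0 = 0) :
    ∀ᶠ ε : ℝ in 𝓝[>] 0, ‖1 - η * g ((ε ^ (1 / (q : ℝ)) : ℝ) : ℂ) +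
        (η * g ((ε ^ (1 / (q : ℝ)) : ℝ) : ℂ)) ^ 2‖ < 1 := by
  obtain ⟨m, h, hh, hc, hgh⟩ := branch_factorization hB hinv hg hq hroot
  have hm : 0 < m := by
    refine Nat.pos_of_ne_zero fun hm => hc ?_
    have := hgh.self_of_nhds
    rw [hm, pow_zero, one_mul, h0] at this
    exact this.symm
  set S : ℝ → ℂ := fun ε => ((ε ^ (1 / (q : ℝ)) : ℝ) : ℂ) with hSdef
  have hS0 : Tendsto S (𝓝[>] 0) (𝓝 0) := tendsto_branch (g := id) continuousAt_id hq
  have hS : ∀ᶠ ε in 𝓝[>] (0 : ℝ), S ε ≠ 0 ∧ S ε ^ q = ε := by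
    filter_upwards [self_mem_nhdsWithin] with ε (hε : 0 < ε)
    refine ⟨Complex.ofReal_ne_zero.2 (Real.rpow_pos_of_pos hε _).ne', ?_⟩
    rw [hSdef, ← Complex.ofReal_pow, rpow_inv_pow_self hq hε]
  have hH : Tendsto (fun ε => h (S ε)) (𝓝[>] 0) (𝓝 (h 0)) := tendsto_branch hh.continuousAt hq
  have hgS : ∀ᶠ ε in 𝓝[>] (0 : ℝ), g (S ε) = S ε ^ m * h (S ε) := hS0.eventually hgh
  have hroot' : ∀ᶠ ε : ℝ in 𝓝[>] 0, ((S ε ^ m * h (S ε)) • 1 -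
      rotatedMatrix A (rotatedCoupling C hB) hB.eigenvalues ε).det = 0 := by
    filter_upwards [hroot, hgS] with ε h1 h2
    rwa [← h2]
  -- The branch has order ε^{m/q}: it is slow if m ≥ q, and otherwise it is of type ±iσ√ε with q =
  -- 2m.
  rcases le_or_gt q m with hqm | hqm
  · obtain ⟨μ, hμ, hlim⟩ := branch_slow hA hB hinv hSr hS0 hS hH hq hqm hroot'
    refine stable_of_slow hμ hη (hlim.congr' ?_)
    filter_upwards [hgS] with ε h1
    rw [← h1]
  obtain ⟨hq2, k, hk, hck⟩ := branch_intermediate hB hinv hS0 hS hH hc hqm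
    (branch_order_ge hS0 hS hH hc hm hroot') hroot'
  set σ := (nullColumns C hB).toEuclideanLin.singularValues k with hσ
  have hσ0 : 0 < σ := singularValues_nullColumns_pos hB hinv hk
  obtain ⟨α, hα⟩ := isPuiseuxEigenvalue_of_branch hB hg hq hroot
  have hlittle : ∀ w : ℂ, h 0 = w →
      (fun ε : ℝ => g (S ε) - w * (√ε : ℂ)) =o[𝓝[>] (0 : ℝ)] (fun ε : ℝ => √ε) := by
    rintro w rfl
    have h1 : (fun ε => h (S ε) - h 0) =o[𝓝[>] (0 : ℝ)] (fun _ => (1 : ℝ)) := by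
      rw [isLittleO_one_iff]
      simpa using hH.sub_const (h 0)
    have h2 : (fun ε : ℝ => ((√ε : ℝ) : ℂ)) =O[𝓝[>] (0 : ℝ)] (fun ε : ℝ => √ε) :=
      isBigO_of_le _ fun ε => by simp
    have h3 : (fun ε : ℝ => (h (S ε) - h 0) * ((√ε : ℝ) : ℂ)) =o[𝓝[>] (0 : ℝ)]
        (fun ε : ℝ => √ε) := by
      simpa using h1.mul_isBigO h2
    refine h3.congr' ?_ EventuallyEq.rfl
    filter_upwards [hgS, self_mem_nhdsWithin] with ε h4 (hε : 0 < ε)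
    have h5 : S ε ^ m = ((√ε : ℝ) : ℂ) := by
      rw [hSdef, ← Complex.ofReal_pow, rpow_inv_pow hε, Real.sqrt_eq_rpow, hq2]
      congr 2
      have : (m : ℝ) ≠ 0 := by exact_mod_cast hm.ne'
      push_cast
      field_simp
    rw [h4, h5]
    ring
  have hor : (fun ε : ℝ => g (S ε) - Complex.I * (σ : ℂ) * (√ε : ℂ)) =o[𝓝[>] (0 : ℝ)]
        (fun ε : ℝ => √ε) ∨
      (fun ε : ℝ => g (S ε) + Complex.I * (σ : ℂ) * (√ε : ℂ)) =o[𝓝[>] (0 : ℝ)]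
        (fun ε : ℝ => √ε) := by
    rcases eq_or_eq_neg_of_sq_eq_neg hck with h1 | h1
    · exact Or.inl (hlittle _ h1)
    · refine Or.inr ((hlittle _ h1).congr_left fun ε => by ring)
  obtain ⟨ι, hιlim⟩ := exists_isHemicurvature q α σ
  obtain ⟨hre, him⟩ := tendsto_sq_div_of_isLittleO_or hor
  exact eventually_stable_of_hemicurvature hα.p_pos hα.hasSum hre him hσ0 hη hιlim
    (hι ι ⟨k, σ, _, q, α, hk, hσ, hα, hor, hιlim⟩)

end BranchAtZero

/-! ### The characterization of stability -/

section Main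

variable {d₁ d₂ : ℕ} {A : Matrix (Fin d₁) (Fin d₁) ℝ} {C K : Matrix (Fin d₁) (Fin d₂) ℝ}
  {B : Matrix (Fin d₂) (Fin d₂) ℝ} {δ : Fin d₂ → ℝ}

theorem negSemidef_iff_eigenvalues_nonpos (hB : B.IsHermitian) :
    (-B).PosSemidef ↔ ∀ j, hB.eigenvalues j ≤ 0 := by
  constructor
  · intro h j
    have h1 := h.re_dotProduct_nonneg (hB.eigenvectorBasis j).ofLp
    rw [Matrix.neg_mulVec, hB.mulVec_eigenvectorBasis, star_trivial, dotProduct_neg,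
      dotProduct_smul, smul_eq_mul] at h1
    have h2 : (hB.eigenvectorBasis j).ofLp ⬝ᵥ (hB.eigenvectorBasis j).ofLp = 1 := by
      have := real_inner_self_eq_norm_sq (hB.eigenvectorBasis j)
      rwa [EuclideanSpace.inner_eq_star_dotProduct, star_trivial,
        hB.eigenvectorBasis.orthonormal.1 j, one_pow] at this
    rw [h2, mul_one] at h1
    have h1 : 0 ≤ -hB.eigenvalues j := h1
    linarith
  · intro h
    have hP := eq_mul_diagonal_mul_transpose hB
    have hd : (Matrix.diagonal fun j => -hB.eigenvalues j).PosSemidef :=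
      Matrix.PosSemidef.diagonal fun j => by
        have := h j
        simp only [Pi.zero_apply]
        linarith
    have := hd.mul_mul_conjTranspose_same (hB.eigenvectorUnitary : Matrix (Fin d₂) (Fin d₂) ℝ)
    rw [Matrix.conjTranspose_eq_transpose_of_trivial] at this
    convert this using 1
    nth_rewrite 1 [hP]
    rw [← Matrix.neg_mul, ← Matrix.mul_neg, Matrix.diagonal_neg]

theorem stable_of_conditions (hA : A.IsHermitian) (hB : B.IsHermitian)
    (hinv : (Matrix.fromBlocks A C (-Cᵀ) (-B)).det ≠ 0)
    (hSr : (restrictedSchur A C hB).PosSemidef) (hBn : ∀ j, hB.eigenvalues j ≤ 0) {L : ℝ}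
    (hBL : ∀ j, |hB.eigenvalues j| ≤ L) {η : ℝ} (hη : 0 < η) (hηL : η * L < 1)
    (hι : ∀ ι ∈ hemicurvatures (Matrix.fromBlocks A C (-Cᵀ) (-B)) C hB,
      ((-(η / 2) : ℝ) : EReal) < ι) :
    ∀ᶠ ε : ℝ in 𝓝[>] 0, ∀ l : ℂ,
      (l • 1 - rotatedMatrix A (rotatedCoupling C hB) hB.eigenvalues ε).det = 0 →
        ‖1 - η * l + (η * l) ^ 2‖ < 1 := by
  obtain ⟨q, gs, hq, hgs, hroots⟩ := exists_branches A (rotatedCoupling C hB) hB.eigenvalues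
  have hbranch : ∀ g ∈ gs, ∀ᶠ ε : ℝ in 𝓝[>] 0,
      ‖1 - η * g ((ε ^ (1 / (q : ℝ)) : ℝ) : ℂ) +
        (η * g ((ε ^ (1 / (q : ℝ)) : ℝ) : ℂ)) ^ 2‖ < 1 := by
    intro g hg
    have hroot : ∀ᶠ ε : ℝ in 𝓝[>] 0, (g ((ε ^ (1 / (q : ℝ)) : ℝ) : ℂ) • 1 -
        rotatedMatrix A (rotatedCoupling C hB) hB.eigenvalues ε).det = 0 := by
      filter_upwards [hroots] with ε h
      exact (h _).2 ⟨g, hg, rfl⟩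
    by_cases h0 : g 0 = 0
    · exact branch_stable_of_eq_zero hA hB hinv hSr hη hι (hgs g hg) hq hroot h0
    · exact branch_stable_of_ne_zero hη hηL hBn hBL (hgs g hg) hq hroot h0
  have hall : ∀ᶠ ε : ℝ in 𝓝[>] 0, ∀ g ∈ gs, ‖1 - η * g ((ε ^ (1 / (q : ℝ)) : ℝ) : ℂ) +
      (η * g ((ε ^ (1 / (q : ℝ)) : ℝ) : ℂ)) ^ 2‖ < 1 := by
    classical
    have := (Filter.eventually_all_finset gs.toFinset).2 fun g hg =>
      hbranch g (List.mem_toFinset.1 hg)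
    filter_upwards [this] with ε h g hg
    exact h g (List.mem_toFinset.2 hg)
  filter_upwards [hroots, hall] with ε h1 h2 l hl
  obtain ⟨g, hg, rfl⟩ := (h1 l).1 hl
  exact h2 g hg

/-- A value δ_j > 0 makes -δ_j an eigenvalue at ε = 0, where the factor is 1 + ηδ_j + (ηδ_j)² > 1.
Hurwitz's theorem places eigenvalues nearby for small ε. -/
theorem eigenvalues_nonpos_of_stable {η : ℝ} (hη : 0 < η)
    (hst : ∀ᶠ ε : ℝ in 𝓝[>] 0, ∀ l : ℂ, (l • 1 - rotatedMatrix A K δ ε).det = 0 →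
        ‖1 - η * l + (η * l) ^ 2‖ < 1) (j : Fin d₂) : δ j ≤ 0 := by
  by_contra! hj
  set a : ℂ := -(δ j : ℂ) with ha
  have ha0 : a ≠ 0 := by simpa [ha] using hj.ne'
  have hc : Continuous (Function.uncurry fun (e : ℝ) (l : ℂ) =>
      (l • 1 - rotatedMatrix A K δ (e : ℂ)).det) := by
    simp only [Function.uncurry_def]
    refine Continuous.matrix_det ?_
    unfold rotatedMatrix
    refine Continuous.sub (by fun_prop) (Continuous.matrix_fromBlocks ?_ ?_ ?_ ?_) <;> fun_prop
  have hd : ∀ e : ℝ, Differentiable ℂ fun l : ℂ => (l • 1 - rotatedMatrix A K δ (e : ℂ)).det := by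
    intro e
    have : (fun l : ℂ => (l • 1 - rotatedMatrix A K δ (e : ℂ)).det) =
        fun l => (rotatedMatrix A K δ (e : ℂ)).charpoly.eval l := by
      funext l
      rw [Matrix.eval_charpoly]
      congr 2
      ext i j
      simp [Matrix.scalar_apply, Matrix.diagonal_apply, Matrix.one_apply]
    rw [this]
    exact Polynomial.differentiable _
  have hnorm : Continuous fun l : ℂ => ‖1 - η * l + (η * l) ^ 2‖ := by fun_prop
  have hbig : 1 < ‖1 - η * a + (η * a) ^ 2‖ := by
    have : 1 - η * a + (η * a) ^ 2 = ((1 + η * δ j + (η * δ j) ^ 2 : ℝ) : ℂ) := by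
      rw [ha]; push_cast; ring
    rw [this, Complex.norm_real, Real.norm_eq_abs]
    refine lt_of_lt_of_le ?_ (le_abs_self _)
    have : 0 < η * δ j := mul_pos hη hj
    nlinarith
  obtain ⟨r, hr, hball⟩ := Metric.eventually_nhds_iff.1
    (hnorm.continuousAt.eventually (lt_mem_nhds hbig))
  -- The nonzero roots at ε = 0 are real, so the point i certifies that the limit function is not
  -- identically zero.
  have hex := eventually_exists_zero_near hc hd (w₀ := Complex.I) (z₀ := a) (by
      simp only [Complex.ofReal_zero]
      rw [Ne, det_rotatedMatrix_zero Complex.I_ne_zero]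
      rintro ⟨k, hk⟩
      simpa using congrArg Complex.im hk) (by
      simp only [Complex.ofReal_zero]
      exact (det_rotatedMatrix_zero ha0).2 ⟨j, rfl⟩) hr
  obtain ⟨ε, h1, l, hl1, hl2⟩ := (hst.and (eventually_nhdsWithin_of_eventually_nhds hex)).exists
  exact lt_asymm (h1 l hl2) (hball (by rwa [dist_eq_norm]))

/-- A negative eigenvalue μ of S_r is a zero of the slow determinant. It persists as a zero w near
μ, and the eigenvalue εw has Re w < 0, which pushes the real part of the factor above 1 for small ε.
-/
theorem posSemidef_restrictedSchur_of_stable (hA : A.IsHermitian) (hB : B.IsHermitian)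
    (hinv : (Matrix.fromBlocks A C (-Cᵀ) (-B)).det ≠ 0) {η : ℝ} (hη : 0 < η)
    (hst : ∀ᶠ ε : ℝ in 𝓝[>] 0, ∀ l : ℂ,
      (l • 1 - rotatedMatrix A (rotatedCoupling C hB) hB.eigenvalues ε).det = 0 →
        ‖1 - η * l + (η * l) ^ 2‖ < 1) : (restrictedSchur A C hB).PosSemidef := by
  have hSh := isHermitian_restrictedSchur (C := C) hA hB
  rw [hSh.posSemidef_iff_eigenvalues_nonneg]
  by_contra hneg
  obtain ⟨k, hk⟩ : ∃ k, hSh.eigenvalues k < 0 := by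
    by_contra! h
    exact hneg fun k => h k
  set μ := hSh.eigenvalues k with hμ
  have hdet : (scaledMatrix A (rotatedCoupling C hB) hB.eigenvalues 1 μ 1 0 0).det = 0 := by
    refine det_slow_of_restrictedSchur_eigenvector hB (u := (hSh.eigenvectorBasis k).ofLp) ?_
      (hSh.mulVec_eigenvectorBasis k)
    intro h0
    have h1 := hSh.eigenvectorBasis.orthonormal.1 k
    rw [(WithLp.ofLp_eq_zero 2).1 h0, norm_zero] at h1
    exact zero_ne_one h1
  have hc : Continuous (Function.uncurry fun (e : ℝ) (w : ℂ) =>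
      (scaledMatrix A (rotatedCoupling C hB) hB.eigenvalues 1 w 1 (e * w) (e * w)).det) := by
    simp only [Function.uncurry_def]
    exact continuous_det_scaledMatrix.comp (f := fun p : ℝ × ℂ =>
      ((1 : ℂ), p.2, (1 : ℂ), (p.1 : ℂ) * p.2, (p.1 : ℂ) * p.2)) (by fun_prop)
  have hd : ∀ e : ℝ, Differentiable ℂ fun w : ℂ =>
      (scaledMatrix A (rotatedCoupling C hB) hB.eigenvalues 1 w 1 (e * w) (e * w)).det := by
    intro e
    simp only [Matrix.det_apply]
    refine Differentiable.fun_sum fun σ _ => ?_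
    refine Differentiable.const_smul (Differentiable.fun_finsetProd fun i _ => ?_) _
    rcases hi : σ i with a | a <;> rcases i with b | b
    · simp [scaledMatrix]
    · simp [scaledMatrix]
    · simp [scaledMatrix]
    · by_cases hab : a = b
      · subst hab
        simp [scaledMatrix]
        split_ifs <;> fun_prop
      · simp [scaledMatrix, hab]
  -- The zeros of the slow determinant are real, so i is not one of them. The radius -μ/2 keeps Re w
  -- < μ/2 < 0 and |Im w| < |μ|/2.
  have hex := eventually_exists_zero_near hc hd (w₀ := Complex.I) (z₀ := (μ : ℂ)) (by
      intro h
      simp only [Complex.ofReal_zero, zero_mul] at h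
      simpa using im_eq_zero_of_det_slow hA hB hinv h) (by simpa using hdet)
    (r := -μ / 2) (by linarith)
  have hμ2 : 0 < 8 * η * μ ^ 2 := mul_pos (by positivity) (sq_pos_of_neg hk)
  -- This bound makes (ηε)²μ² smaller than ηε|μ|/8, so the quadratic term cannot offset the linear
  -- gain of at least ηε|μ|/2.
  have hsmall : ∀ᶠ ε : ℝ in 𝓝[>] 0, ε < -μ / (8 * η * μ ^ 2) := by
    refine eventually_nhdsWithin_of_eventually_nhds (gt_mem_nhds ?_)
    exact div_pos (by linarith) hμ2
  obtain ⟨ε, ⟨h1, h2⟩, h3, w, hw1, hw2⟩ := ((hst.and hsmall).and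
    (Eventually.and (self_mem_nhdsWithin (a := (0 : ℝ)) (s := Set.Ioi 0))
      (eventually_nhdsWithin_of_eventually_nhds hex))).exists
  have h3 : 0 < ε := h3
  have hε : (ε : ℂ) ≠ 0 := by exact_mod_cast h3.ne'
  have h4 := h1 (ε * w) ((det_scaledMatrix_eq_zero_iff one_ne_zero one_ne_zero hε).1 (by
    have e1 : (ε : ℂ) * w / (ε * 1) = w := by field_simp
    rw [e1, div_one, one_mul, one_mul]
    exact hw2))
  have hre : |w.re - μ| < -μ / 2 := by
    have := (Complex.abs_re_le_norm (w - μ)).trans_lt hw1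
    simpa using this
  have him : |w.im| < -μ / 2 := by
    have := (Complex.abs_im_le_norm (w - μ)).trans_lt hw1
    simpa using this
  have h5 := (Complex.re_le_norm _).trans_lt h4
  have h6 : (1 - (η : ℂ) * (ε * w) + ((η : ℂ) * (ε * w)) ^ 2).re =
      1 - η * ε * w.re + (η * ε) ^ 2 * (w.re ^ 2 - w.im ^ 2) := by
    simp [pow_two]
    ring
  rw [h6] at h5
  rw [abs_lt] at hre him
  have h7 : w.im ^ 2 ≤ μ ^ 2 := by nlinarith
  have h8 : η * ε * (-w.re) ≥ η * ε * (-μ / 2) :=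
    mul_le_mul_of_nonneg_left (by linarith) (by positivity)
  have h9 : η * ε * μ ^ 2 < -μ / 8 := by
    rw [lt_div_iff₀ hμ2] at h2
    linarith
  have h10 : 0 < η * ε := by positivity
  have h11 : (η * ε) * (η * ε * μ ^ 2) < η * ε * (-μ / 8) := mul_lt_mul_of_pos_left h9 h10
  have h12 : (η * ε) ^ 2 * (w.re ^ 2 - w.im ^ 2) ≥ (η * ε) ^ 2 * (-μ ^ 2) :=
    mul_le_mul_of_nonneg_left (by nlinarith [sq_nonneg w.re]) (by positivity)
  nlinarith

/-- Only the weak inequality follows, since ι = -η/2 is undecided at this order. The main theorem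
regains strictness by choosing the step size below 1/L. -/
theorem le_of_mem_hemicurvatures_of_stable (hB : B.IsHermitian)
    (hinv : (Matrix.fromBlocks A C (-Cᵀ) (-B)).det ≠ 0) {η : ℝ} (hη : 0 < η)
    (hst : ∀ᶠ ε : ℝ in 𝓝[>] 0, ∀ l : ℂ,
      (l • 1 - rotatedMatrix A (rotatedCoupling C hB) hB.eigenvalues ε).det = 0 →
        ‖1 - η * l + (η * l) ^ 2‖ < 1) {ι : EReal}
    (hι : ι ∈ hemicurvatures (Matrix.fromBlocks A C (-Cᵀ) (-B)) C hB) :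
    ((-(η / 2) : ℝ) : EReal) ≤ ι := by
  by_contra! hlt
  obtain ⟨k, σ, lam, p, α, hk, rfl, hα, hor, hlim⟩ := hι
  obtain ⟨hre, him⟩ := tendsto_sq_div_of_isLittleO_or hor
  have := eventually_unstable_of_hemicurvature hα.p_pos hα.hasSum hre him
    (singularValues_nullColumns_pos hB hinv hk) hη hlim hlt
  obtain ⟨ε, h1, h2, h3⟩ := (this.and (hst.and hα.mem_spectrum)).exists
  exact h1 (h2 _ ((mem_spectrum_iff_det_rotatedMatrix hB).1 h3))

end Main

end

theorem mainTheorem2 {d₁ d₂ : ℕ} (f : ZSpace d₁ d₂ → ℝ) (hf : ContDiff ℝ 2 f)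
    (L : ℝ) (hL : 0 < L) (hbound : ∀ z, ‖fderiv ℝ (saddleGradient f) z‖ ≤ L)
    (z : ZSpace d₁ d₂) (hz : saddleGradient f z = 0)
    (hinv : IsUnit (jacobianMatrix (saddleGradient f) z)) :
    ((restrictedSchur (hessXX f z) (hessXY f z) (hessYY_isHermitian hf z)).PosSemidef ∧
        (-hessYY f z).PosSemidef ∧
        sZero (jacobianMatrix (saddleGradient f) z) (hessXY f z) (hessYY_isHermitian hf z) <
          ((1 / (2 * L) : ℝ) : EReal)) ↔
      ∃ ηs : ℝ, 0 < ηs ∧ ηs < 1 / L ∧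
        ∀ η : ℝ, ηs < η → η < 1 / L → IsStableInftyEG f η z := by
  have hA := isHermitian_hessXX hf z
  have hB := hessYY_isHermitian hf z
  have hdet : (Matrix.fromBlocks (hessXX f z) (hessXY f z) (-(hessXY f z)ᵀ)
      (-hessYY f z)).det ≠ 0 := by
    rw [← jacobianMatrix_saddleGradient hf]
    exact ((Matrix.isUnit_iff_isUnit_det _).1 hinv).ne_zero
  simp only [isStableInftyEG_iff hf hz]
  rw [jacobianMatrix_saddleGradient hf, negSemidef_iff_eigenvalues_nonpos hB, sZero]
  constructor
  · rintro ⟨hSr, hBn, hs⟩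
    obtain ⟨s, hs1, hs2⟩ := EReal.lt_iff_exists_real_btwn.1 hs
    have hs2 : s < 1 / (2 * L) := EReal.coe_lt_coe_iff.1 hs2
    have hLL : 1 / (2 * L) = 1 / L / 2 := by field_simp
    have hpos : 0 < 1 / L := by positivity
    -- The bound η > 2s yields -η/2 < -s < ι for each hemicurvature ι. As s may be negative, the
    -- second term keeps the threshold positive.
    refine ⟨max (2 * s) (1 / L / 2), lt_max_of_lt_right (by linarith),
      max_lt (by linarith) (by linarith), fun η hη1 hη2 => ?_⟩
    have hη1s : 2 * s < η := (le_max_left _ _).trans_lt hη1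
    have hη0 : 0 < η := lt_of_lt_of_le (by linarith) ((le_max_right _ _).trans hη1.le)
    refine stable_of_conditions hA hB hdet hSr hBn
      (abs_eigenvalue_hessYY_le hf (hbound z)) hη0 ((lt_div_iff₀ hL).1 hη2) fun ι hι => ?_
    have h1 : -ι < (s : EReal) := lt_of_le_of_lt (le_sSup (Set.mem_image_of_mem _ hι)) hs1
    have h2 : ((-s : ℝ) : EReal) < ι := by
      rw [EReal.coe_neg]
      exact EReal.neg_lt_comm.1 h1
    exact (EReal.coe_lt_coe_iff.2 (by linarith)).trans h2
  · rintro ⟨ηs, hηs, hηL, hst⟩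
    -- A single stable step size η₀ < 1/L suffices: it gives s₀ ≤ η₀/2 < 1/(2L).
    obtain ⟨η₀, hη₀, hη₀L⟩ := exists_between hηL
    have hst₀ := hst η₀ hη₀ hη₀L
    have hpos₀ : 0 < η₀ := hηs.trans hη₀
    refine ⟨posSemidef_restrictedSchur_of_stable hA hB hdet hpos₀ hst₀,
      eigenvalues_nonpos_of_stable hpos₀ hst₀, ?_⟩
    have hle : sSup ((fun ι : EReal => -ι) '' hemicurvatures (Matrix.fromBlocks (hessXX f z)
        (hessXY f z) (-(hessXY f z)ᵀ) (-hessYY f z)) (hessXY f z) hB) ≤ ((η₀ / 2 : ℝ) : EReal) := by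
      refine sSup_le ?_
      rintro _ ⟨ι, hι, rfl⟩
      have := le_of_mem_hemicurvatures_of_stable hB hdet hpos₀ hst₀ hι
      rw [EReal.coe_neg] at this
      exact EReal.neg_le.1 this
    refine hle.trans_lt (EReal.coe_lt_coe_iff.2 ?_)
    have hLL : 1 / (2 * L) = 1 / L / 2 := by field_simp
    rw [hLL]
    linarith
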